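/- Let $n \ge 1$ and $p \in [4, 4+\sqrt{8/n})$. There is a constant $C = C(n,p) > 0$, depending on $n$ and $p$ only, such that the following holds for every $k \ge 1$, every open set $U \subset \mathbb{R}^n$ and every smooth $\psi : U \to \mathbb{R}^k$ whose graph $\Sigma = \{(x,\psi(x)) : x \in U\} \subset \mathbb{R}^{m}$, $m = n+k$, with the metric induced from $\mathbb{R}^m$, has flat normal bundle, i.e. $R^\perp = 0$, where $R^\perp(X,Y)\zeta = \nabla^\perp_X\nabla^\perp_Y\zeta - \nabla^\perp_Y\nabla^\perp_X\zeta - \nabla^\perp_{[X,Y]}\zeta$ and $\nabla^\perp_X\zeta = (D_X\zeta)^\perp$ for tangential vector fields $X,Y$ and normal sections $\zeta$. For every non-negative $\varphi \in C_c^\infty(\Sigma)$, both integrands below are integrable over $\Sigma$ with respect to the $n$-dimensional Hausdorff measure $\mathcal{H}^n$, and $$\int_\Sigma |A|^p\varphi^p \, d\mathcal{H}^n \le C \int_\Sigma \Big( |\nabla\varphi|^p + \big(|H|^p + |\nabla H|^{p/2} + K_1^{p/2} + K_2^{p/3}\big)\varphi^p \Big)\, d\mathcal{H}^n .$$ Here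 $A(X,Y) = (D_XY)^\perp$ is the second fundamental form, $H = \operatorname{trace} A$ the mean curvature vector, and $\nabla H$, $\nabla\nabla H$ are the first and second covariant derivatives of $H$ with respect to $\nabla^\perp$ and the Levi-Civita connection $\nabla_XY = (D_XY)^\top$. With respect to an orthonormal frame $e_1,\dots,e_n$ of $T\Sigma$ (positively oriented in the parametrization $x \mapsto (x,\psi(x))$) and an orthonormal frame $\{e_\alpha\}_{\alpha=n+1,\dots,m}$ of the normal bundle, put $h_{\alpha ij} = \langle A(e_i,e_j), e_\alpha\rangle$, $\nabla_i H_\alpha = \langle \nabla^\perp_{e_i} H, e_\alpha\rangle$ and $\nabla_i\nabla_jH_\alpha = \langle (\nabla\nabla H)(e_i,e_j), e_\alpha\rangle$, where $(\nabla\nabla H)(X,Y) = \nabla^\perp_X\nabla^\perp_Y H - \nabla^\perp_{\nabla_XY}H$; lengths of tensors are $|T|^2 = \sum_{i_1,\dots,i_r} |T(e_{i_1},\dots,e_{i_r})|^2$. With $\Omega = dx^1\wedge\dots\wedge dx^n$, $w = \Omega(e_1,\dots,e_n) > 0$ and $\Omega_{\alpha i} = \Omega(e_1,\dots,e_\alpha,\dots,e_n)$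 ($e_\alpha$ in the $i$-th position), define $$K_1 = \max\Big( w^{-1}\sum_{\alpha,i}\Omega_{\alpha i}\nabla_iH_\alpha,\ 0\Big), \qquad K_2 = \max\Big( -\frac{1}{|A|}\sum_{\alpha,i,j} h_{\alpha ij}\nabla_i\nabla_jH_\alpha,\ 0\Big) \text{ where } |A|>0,$$ and $K_2 = 0$ where $|A| = 0$. -/

import Mathlib

open MeasureTheory
open scoped ContDiff

noncomputable section

namespace FlatNormalGraph

/-! ## Extrinsic geometry of a parametrized immersion `f : ℝⁿ ⊇ U → V`

Tangential vector fields on the immersed manifold are written as `df(X)` with a vector field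
`X : ℝⁿ → ℝⁿ` in the parameter domain; sections of the ambient bundle along the immersion are
functions `ℝⁿ → V`. All notions below are local, so they only depend on `f` near the point. -/

section Immersion

variable {n : ℕ} {V : Type*} [NormedAddCommGroup V] [InnerProductSpace ℝ V]
  [FiniteDimensional ℝ V]

/-- The tangent space `df_x(ℝⁿ) ⊆ V`. -/
def tangentSpace (f : EuclideanSpace ℝ (Fin n) → V) (x : EuclideanSpace ℝ (Fin n)) :
    Submodule ℝ V :=
  LinearMap.range (fderiv ℝ f x).toLinearMap

/-- The tangential part `v ↦ v^⊤`. -/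
def tangentProj (f : EuclideanSpace ℝ (Fin n) → V) (x : EuclideanSpace ℝ (Fin n)) : V →L[ℝ] V :=
  (tangentSpace f x).starProjection

/-- The normal part `v ↦ v^⊥`. -/
def normalProj (f : EuclideanSpace ℝ (Fin n) → V) (x : EuclideanSpace ℝ (Fin n)) : V →L[ℝ] V :=
  (tangentSpace f x)ᗮ.starProjection

/-- The coordinate vector `u ∈ ℝⁿ` with `df_x(u) = v^⊤` (unique where `df_x` is injective). -/
def tangentCoord (f : EuclideanSpace ℝ (Fin n) → V) (x : EuclideanSpace ℝ (Fin n)) (v : V) :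
    EuclideanSpace ℝ (Fin n) :=
  Function.invFun (fderiv ℝ f x) (tangentProj f x v)

/-- The ambient covariant derivative `D_X η` of a `V`-valued function along the immersion. -/
def ambientDeriv (X : EuclideanSpace ℝ (Fin n) → EuclideanSpace ℝ (Fin n))
    (η : EuclideanSpace ℝ (Fin n) → V) (x : EuclideanSpace ℝ (Fin n)) : V :=
  fderiv ℝ η x (X x)

/-- The Levi-Civita connection `∇_X Y = (D_X Y)^⊤`, read in the parameter domain. -/
def leviCivita (f : EuclideanSpace ℝ (Fin n) → V)
    (X Y : EuclideanSpace ℝ (Fin n) → EuclideanSpace ℝ (Fin n))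
    (x : EuclideanSpace ℝ (Fin n)) : EuclideanSpace ℝ (Fin n) :=
  tangentCoord f x (ambientDeriv X (fun y => fderiv ℝ f y (Y y)) x)

/-- The second fundamental form `A(X, Y) = (D_X Y)^⊥`, on vector fields. -/
def secondFundField (f : EuclideanSpace ℝ (Fin n) → V)
    (X Y : EuclideanSpace ℝ (Fin n) → EuclideanSpace ℝ (Fin n))
    (x : EuclideanSpace ℝ (Fin n)) : V :=
  normalProj f x (ambientDeriv X (fun y => fderiv ℝ f y (Y y)) x)

/-- The normal connection `∇^⊥_X η = (D_X η)^⊥`. -/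
def normalConn (f : EuclideanSpace ℝ (Fin n) → V)
    (X : EuclideanSpace ℝ (Fin n) → EuclideanSpace ℝ (Fin n))
    (η : EuclideanSpace ℝ (Fin n) → V) (x : EuclideanSpace ℝ (Fin n)) : V :=
  normalProj f x (ambientDeriv X η x)

/-- The normal curvature `R^⊥(X, Y)ζ = ∇^⊥_X ∇^⊥_Y ζ - ∇^⊥_Y ∇^⊥_X ζ - ∇^⊥_{[X, Y]} ζ`. -/
def normalCurv (f : EuclideanSpace ℝ (Fin n) → V)
    (X Y : EuclideanSpace ℝ (Fin n) → EuclideanSpace ℝ (Fin n))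
    (ζ : EuclideanSpace ℝ (Fin n) → V) (x : EuclideanSpace ℝ (Fin n)) : V :=
  normalConn f X (normalConn f Y ζ) x - normalConn f Y (normalConn f X ζ) x
    - normalConn f (VectorField.lieBracket ℝ X Y) ζ x

/-- `R^⊥ = 0` over `U`: the normal curvature vanishes on all smooth tangential vector fields and
all smooth normal sections over `U`. -/
def HasFlatNormalBundle (f : EuclideanSpace ℝ (Fin n) → V) (U : Set (EuclideanSpace ℝ (Fin n))) :
    Prop :=
  ∀ (X Y : EuclideanSpace ℝ (Fin n) → EuclideanSpace ℝ (Fin n))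
    (ζ : EuclideanSpace ℝ (Fin n) → V),
    ContDiffOn ℝ ∞ X U → ContDiffOn ℝ ∞ Y U → ContDiffOn ℝ ∞ ζ U →
    (∀ x ∈ U, ζ x ∈ (tangentSpace f x)ᗮ) →
    ∀ x ∈ U, normalCurv f X Y ζ x = 0

/-- An orthonormal frame `e₁, …, eₙ` of the tangent space, positively oriented with respect to
the parametrization: the orthonormalization of the coordinate fields `∂₁f, …, ∂ₙf`. -/
def frame (f : EuclideanSpace ℝ (Fin n) → V) (x : EuclideanSpace ℝ (Fin n)) : Fin n → V :=
  InnerProductSpace.gramSchmidtNormed ℝ fun i => fderiv ℝ f x (EuclideanSpace.single i 1)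

/-- The coordinate vectors in `ℝⁿ` that represent the frame: `df_x (frameCoord f x i) = eᵢ`. -/
def frameCoord (f : EuclideanSpace ℝ (Fin n) → V) (x : EuclideanSpace ℝ (Fin n)) (i : Fin n) :
    EuclideanSpace ℝ (Fin n) :=
  tangentCoord f x (frame f x i)

/-- The second fundamental form as a tensor at the point `x`: its value on coordinate vectors
`u, v`, which are extended to vector fields with constant coordinates. -/
def secondFund (f : EuclideanSpace ℝ (Fin n) → V) (x u v : EuclideanSpace ℝ (Fin n)) : V :=
  secondFundField f (fun _ => u) (fun _ => v) x

/-- The mean curvature vector `H = trace A`. -/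
def meanCurv (f : EuclideanSpace ℝ (Fin n) → V) (x : EuclideanSpace ℝ (Fin n)) : V :=
  ∑ i, secondFund f x (frameCoord f x i) (frameCoord f x i)

/-- The normal-bundle-valued 1-tensor `∇H` at `x`, that is `u ↦ ∇^⊥_u H`. -/
def covMeanCurv (f : EuclideanSpace ℝ (Fin n) → V) (x u : EuclideanSpace ℝ (Fin n)) : V :=
  normalConn f (fun _ => u) (meanCurv f) x

/-- The normal-bundle-valued 2-tensor `∇∇H` at `x`, the covariant derivative of `∇H`:
`(u, v) ↦ (∇_u ∇H)(v) = ∇^⊥_u (∇H(v)) - ∇H(∇_u v)`, with `u, v` extended by constant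
coordinates. -/
def covCovMeanCurv (f : EuclideanSpace ℝ (Fin n) → V) (x u v : EuclideanSpace ℝ (Fin n)) : V :=
  normalConn f (fun _ => u) (fun y => covMeanCurv f y v) x
    - covMeanCurv f x (leviCivita f (fun _ => u) (fun _ => v) x)

/-- The length `|A|`. -/
def normSecondFund (f : EuclideanSpace ℝ (Fin n) → V) (x : EuclideanSpace ℝ (Fin n)) : ℝ :=
  √(∑ i, ∑ j, ‖secondFund f x (frameCoord f x i) (frameCoord f x j)‖ ^ 2)

/-- The length `|∇H|`. -/
def normCovMeanCurv (f : EuclideanSpace ℝ (Fin n) → V) (x : EuclideanSpace ℝ (Fin n)) : ℝ :=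
  √(∑ i, ‖covMeanCurv f x (frameCoord f x i)‖ ^ 2)

/-- The length `|∇φ|` of the intrinsic gradient of a scalar function, in the induced metric. -/
def normGrad (f : EuclideanSpace ℝ (Fin n) → V) (φ : EuclideanSpace ℝ (Fin n) → ℝ)
    (x : EuclideanSpace ℝ (Fin n)) : ℝ :=
  √(∑ i, (fderiv ℝ φ x (frameCoord f x i)) ^ 2)

/-- `K₂`, the absolute value of the negative part of `h_{αij} ∇ᵢ∇ⱼH_α / |A|` where `|A| > 0`, and
`0` elsewhere. The sum over `α` is the inner product of the two normal vectors `A(eᵢ, eⱼ)` and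
`(∇∇H)(eᵢ, eⱼ)`. -/
def K₂ (f : EuclideanSpace ℝ (Fin n) → V) (x : EuclideanSpace ℝ (Fin n)) : ℝ :=
  if 0 < normSecondFund f x then
    max (-((∑ i, ∑ j,
      inner ℝ (secondFund f x (frameCoord f x i) (frameCoord f x j))
        (covCovMeanCurv f x (frameCoord f x i) (frameCoord f x j))) / normSecondFund f x)) 0
  else 0

end Immersion

/-! ## Graphs in `ℝⁿ × ℝᵏ = ℝ^(n+k)` with the Euclidean metric -/

/-- The graph parametrization `x ↦ (x, ψ(x))`. -/
def graphMap {n k : ℕ} (ψ : EuclideanSpace ℝ (Fin n) → EuclideanSpace ℝ (Fin k))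
    (x : EuclideanSpace ℝ (Fin n)) :
    WithLp 2 (EuclideanSpace ℝ (Fin n) × EuclideanSpace ℝ (Fin k)) :=
  WithLp.toLp 2 (x, ψ x)

/-- The parallel `n`-form `Ω = dx¹ ∧ … ∧ dxⁿ` on `ℝⁿ × ℝᵏ`. -/
def Ω {n k : ℕ} (v : Fin n → WithLp 2 (EuclideanSpace ℝ (Fin n) × EuclideanSpace ℝ (Fin k))) : ℝ :=
  Matrix.det (Matrix.of fun i j => (v j).fst i)

/-- `w = *Ω = Ω(e₁, …, eₙ)`. -/
def starΩ {n k : ℕ}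
    (f : EuclideanSpace ℝ (Fin n) → WithLp 2 (EuclideanSpace ℝ (Fin n) × EuclideanSpace ℝ (Fin k)))
    (x : EuclideanSpace ℝ (Fin n)) : ℝ :=
  Ω (frame f x)

/-- `K₁ = (w⁻¹ Ω_{αi} ∇ᵢH_α)⁺`. Since `Ω_{αi} = Ω(e₁, …, e_α, …, eₙ)` with `e_α` in position `i` and
`∇_{eᵢ}H = ∑_α (∇ᵢH_α) e_α`, the sum over `α` is `Ω` with `∇_{eᵢ}H` in position `i`. -/
def K₁ {n k : ℕ}
    (f : EuclideanSpace ℝ (Fin n) → WithLp 2 (EuclideanSpace ℝ (Fin n) × EuclideanSpace ℝ (Fin k)))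
    (x : EuclideanSpace ℝ (Fin n)) : ℝ :=
  max ((starΩ f x)⁻¹ *
    ∑ i, Ω (Function.update (frame f x) i (covMeanCurv f x (frameCoord f x i)))) 0

end FlatNormalGraph

end

/-! The proof plays a stability-type inequality off against Simons' identity, as in the
Schoen–Simon–Yau curvature estimates. Put `p = 2q + 4`, so that `p < 4 + √(8/n)` becomes `q² < 2/n`,
and put `v = |A|² + δ` with `δ > 0`.

All geometry is read off the field `P` of tangential projections of the ambient space `V`. Its
tangential derivative `Q` (`shape`) is the second fundamental form, extended to a symmetric operator
on `V` for each direction. The symmetry of `A` and the Codazzi equation come from differentiating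
identities for `P` and commuting derivatives, so that no moving frame is ever differentiated.
Vanishing normal curvature says that the shape operators commute. Hence at each point there is an
orthonormal tangent basis `e i` with `A(e i, e j) = 0` for `i ≠ j` and `A(e i, e i) = λ i`
(`IsFlatShape.exists_principalBasis`). All pointwise identities are computed in such a basis and
stated in a basis-free form.

The first inequality comes from the volume density `J` of the graph. The covector field `slope` is
`-d log J`, and its divergence is `-|A|² - |slope|² + tr(L ∇H)`, with `L` the projection onto the
tangent space along the fibres of the graph (`sum_tD_slope`). The positive part of the trace is `K₁`
(`K₁_eq`). Testing with `v^(q+1) φ^p` and completing the square gives `X ≤ (1 + τ)(q + 1)² Y + ...`,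
where `X = ∫ |A|² v^(q+1) φ^p` and `Y = ∫ v^q |∇|A|²|² / (4v) φ^p` (`integral_stability`).

The second comes from `½Δ|A|² = |∇A|² + ⟨A, ∇∇H⟩ + Σ ⟨H, λ i⟩|λ i|² - Σ ⟨λ k, λ i⟩²`
(`laplacian_sq_normSecondFund`), whose last sum is at most `|A|⁴`. Total symmetry of `∇A` improves
the Kato inequality: for each `κ < 2/n`, `|∇A|²` dominates `(1 + κ)|∇|A|²|² / (4v)` up to a multiple
of `|∇H|²` (`exists_kato_constant`). Testing with `v^q φ^p` yields `(1 + κ + 2q - ε) Y ≤ X + ...`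
(`integral_simons`).

The two can be combined when `(q + 1)² < 1 + κ + 2q`, that is `q² < κ`, and `q² < 2/n` leaves room
for such a `κ`. Young's inequality absorbs the lower-order terms, with exponents dictated by
scaling, and `δ → 0` finishes the estimate (`exists_energy_constant`). The area formula
`map_euclideanHausdorffMeasure` transfers it from the parameter domain to the graph. Every constant
is fixed before the graph and its codimension appear. -/

open scoped Topology

set_option linter.unusedSectionVars false


/-! ## Orthonormal bases -/

section LinearAlgebra

variable {V : Type*} [NormedAddCommGroup V] [InnerProductSpace ℝ V]

/-- The trace of a bilinear map over a Parseval-type family does not depend on the family. -/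
theorem OrthonormalBasis.sum_bilin_eq {ι ι' G : Type*} [Fintype ι] [Fintype ι'] [AddCommGroup G]
    [Module ℝ G] (b : OrthonormalBasis ι ℝ V) (P : V →L[ℝ] V) (e : ι' → V) (he : Orthonormal ℝ e)
    (hP : ∀ v, P v = ∑ j, inner ℝ (e j) v • e j) (B : V →ₗ[ℝ] V →ₗ[ℝ] G) :
    ∑ i, B (P (b i)) (P (b i)) = ∑ j, B (e j) (e j) := by
  classical
  have h1 : ∀ i, B (P (b i)) (P (b i)) =
      ∑ j, ∑ k, (inner ℝ (e j) (b i) * inner ℝ (b i) (e k)) • B (e j) (e k) := by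
    intro i
    rw [hP (b i)]
    simp only [map_sum, map_smul, LinearMap.sum_apply, LinearMap.smul_apply, Finset.smul_sum,
      smul_smul, real_inner_comm (b i)]
    rw [Finset.sum_comm]
    refine Finset.sum_congr rfl fun j _ => Finset.sum_congr rfl fun k _ => ?_
    rw [mul_comm]
  simp only [h1]
  rw [Finset.sum_comm]
  refine Finset.sum_congr rfl fun j _ => ?_
  rw [Finset.sum_comm]
  simp only [← Finset.sum_smul, b.sum_inner_mul_inner]
  rw [Finset.sum_eq_single j]
  · rw [real_inner_self_eq_norm_sq, he.1 j]; simp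
  · intro k _ hk
    rw [he.2 hk.symm, zero_smul]
  · simp

theorem OrthonormalBasis.sum_bilin_eq_sum_bilin {ι ι' G : Type*} [Fintype ι] [Fintype ι']
    [AddCommGroup G] [Module ℝ G] (b : OrthonormalBasis ι ℝ V) (b' : OrthonormalBasis ι' ℝ V)
    (B : V →ₗ[ℝ] V →ₗ[ℝ] G) :
    ∑ i, B (b i) (b i) = ∑ j, B (b' j) (b' j) := by
  have := b.sum_bilin_eq (ContinuousLinearMap.id ℝ V) b' b'.orthonormal
    (fun v => (b'.sum_repr' v).symm) B
  simpa using this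

-- The joint eigenspaces of commuting symmetric operators form an orthogonal internal direct sum.
-- The index type may be infinite, which is needed because the shape operators are indexed by all of
-- `V`.
open Module.End in
theorem LinearMap.IsSymmetric.exists_joint_eigenbasis [FiniteDimensional ℝ V] {ι : Type*}
    {T : ι → V →ₗ[ℝ] V} (hT : ∀ i, (T i).IsSymmetric) (hc : ∀ i j, Commute (T i) (T j)) {n : ℕ}
    (hn : Module.finrank ℝ V = n) :
    ∃ (b : OrthonormalBasis (Fin n) ℝ V) (μ : Fin n → ι → ℝ), ∀ i j, T j (b i) = μ i j • b i := by
  classical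
  have h := _root_.LinearMap.IsSymmetric.directSum_isInternal_of_pairwise_commute hT
    (fun i j _ => hc i j)
  have ho := LinearMap.IsSymmetric.orthogonalFamily_iInf_eigenspaces hT
  have h' := (DirectSum.isInternal_ne_bot_iff).2 h
  -- There are infinitely many candidate eigenvalue functions, but independence in finite dimension
  -- leaves only finitely many nonzero joint eigenspaces.
  have hfin : Finite {γ : ι → ℝ // (⨅ j, eigenspace (T j) (γ j)) ≠ ⊥} :=
    WellFoundedGT.finite_ne_bot_of_iSupIndep h.submodule_iSupIndep
  have := Fintype.ofFinite {γ : ι → ℝ // (⨅ j, eigenspace (T j) (γ j)) ≠ ⊥}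
  have ho' : OrthogonalFamily ℝ (fun γ : {γ : ι → ℝ // (⨅ j, eigenspace (T j) (γ j)) ≠ ⊥} =>
      (⨅ j, eigenspace (T j) (γ.1 j) : Submodule ℝ V))
      fun γ => (⨅ j, eigenspace (T j) (γ.1 j)).subtypeₗᵢ :=
    ho.comp Subtype.val_injective
  refine ⟨h'.subordinateOrthonormalBasis hn ho',
    fun i => (h'.subordinateOrthonormalBasisIndex hn i ho').1, fun i j => ?_⟩
  have := h'.subordinateOrthonormalBasis_subordinate hn i ho'
  rw [Submodule.mem_iInf] at this
  exact Module.End.mem_eigenspace_iff.1 (this j)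

end LinearAlgebra

/-! ## Derivatives of a field of projections at a point -/

section PointwiseShape

variable {V : Type*} [NormedAddCommGroup V] [InnerProductSpace ℝ V]

/-- The algebraic properties of the tangential projection `P` and its tangential derivative `Q` at
a point of a submanifold with flat normal bundle. -/
structure IsFlatShape (P : V →L[ℝ] V) (Q : V →L[ℝ] V →L[ℝ] V) : Prop where
  proj_symm : ∀ v w, inner ℝ (P v) w = inner ℝ v (P w)
  proj_proj : ∀ v, P (P v) = P v
  symm : ∀ a v w, inner ℝ (Q a v) w = inner ℝ v (Q a w)
  swap : ∀ a v, P (Q a v) + Q a (P v) = Q a v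
  proj_arg : ∀ a, Q (P a) = Q a
  comm : ∀ a b, Q a (P b) = Q b (P a)
  flat : ∀ a b v, P v = 0 → Q a (Q b v) = Q b (Q a v)

/-- An orthonormal basis that consists of principal directions `e i` and normal vectors. -/
structure IsPrincipalBasis {n m : ℕ} (P : V →L[ℝ] V) (Q : V →L[ℝ] V →L[ℝ] V)
    (b : OrthonormalBasis (Fin n ⊕ Fin m) ℝ V) (lam : Fin n → V) : Prop where
  proj_inl : ∀ i, P (b (.inl i)) = b (.inl i)
  proj_inr : ∀ α, P (b (.inr α)) = 0
  proj_lam : ∀ i, P (lam i) = 0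
  apply_inl : ∀ i v, Q (b (.inl i)) v =
    inner ℝ (b (.inl i)) v • lam i + inner ℝ (lam i) v • b (.inl i)

variable {P : V →L[ℝ] V} {Q : V →L[ℝ] V →L[ℝ] V}

namespace IsFlatShape

variable (h : IsFlatShape P Q)
include h

theorem proj_apply_of_normal (a : V) {v : V} (hv : P v = 0) : P (Q a v) = Q a v := by
  simpa [hv] using h.swap a v

theorem proj_apply_of_tangent (a : V) {v : V} (hv : P v = v) : P (Q a v) = 0 := by
  simpa [hv] using h.swap a v

theorem apply_normal {a : V} (ha : P a = 0) : Q a = 0 := by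
  rw [← h.proj_arg, ha, map_zero]

theorem inner_tangent_normal {v w : V} (hv : P v = v) (hw : P w = 0) : inner ℝ v w = 0 := by
  rw [← hv, h.proj_symm, hw, inner_zero_right]

/-- The shape operator in direction `v - P v`. -/
noncomputable def shapeOp (v : V) : LinearMap.range P.toLinearMap →ₗ[ℝ] LinearMap.range P.toLinearMap where
  toFun e := ⟨Q e (v - P v), ⟨Q e (v - P v),
    h.proj_apply_of_normal _ (by rw [map_sub, h.proj_proj, sub_self])⟩⟩
  map_add' e e' := by ext; simp
  map_smul' c e := by ext; simp

theorem proj_range (e : LinearMap.range P.toLinearMap) : P e = e := by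
  obtain ⟨e, w, rfl⟩ := e
  exact h.proj_proj w

theorem shapeOp_symmetric (v : V) : (h.shapeOp v).IsSymmetric := by
  intro e e'
  simp only [shapeOp, LinearMap.coe_mk, AddHom.coe_mk, Submodule.coe_inner]
  rw [h.symm, ← real_inner_comm, ← h.proj_range e', h.comm, h.proj_range e, ← h.symm,
    h.proj_range e', real_inner_comm]

/-- This is the Ricci equation read backwards. The matrix entries of a product of two shape
operators are pairings `⟨v, Q e (Q e' w)⟩`, and flatness allows `Q e` and `Q e'` to be exchanged on
normal vectors. -/
theorem shapeOp_commute (v w : V) : Commute (h.shapeOp v) (h.shapeOp w) := by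
  have key : ∀ v w e e' : V, P v = 0 → P w = 0 → P e' = e' →
      inner ℝ (Q (Q e w) v) e' = inner ℝ v (Q e (Q e' w)) := by
    intro v w e e' hv hw he'
    rw [h.symm, ← he', h.comm, h.proj_apply_of_normal e hw, he', h.flat _ _ _ hw]
  have hN : ∀ v, P (v - P v) = 0 := fun v => by rw [map_sub, h.proj_proj, sub_self]
  refine LinearMap.ext fun e => ext_inner_right ℝ fun e' => ?_
  change inner ℝ (Q (Q e (w - P w)) (v - P v)) (e' : V) =
    inner ℝ (Q (Q e (v - P v)) (w - P w)) (e' : V)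
  rw [key _ _ _ _ (hN v) (hN w) (h.proj_range e'), key _ _ _ _ (hN w) (hN v) (h.proj_range e'),
    ← h.symm, ← h.symm, ← real_inner_comm, h.flat _ _ _ (hN v)]

/-- A joint eigenbasis of the shape operators diagonalizes `A` with vector-valued entries. Completed
by any orthonormal normal basis, it turns each `Q (e i)` into the rank-two symmetric operator
spanned by `e i` and `lam i`. -/
theorem exists_principalBasis [FiniteDimensional ℝ V] {n : ℕ}
    (hn : Module.finrank ℝ (LinearMap.range P.toLinearMap) = n) :
    ∃ (m : ℕ) (b : OrthonormalBasis (Fin n ⊕ Fin m) ℝ V) (lam : Fin n → V),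
      IsPrincipalBasis P Q b lam := by
  set T := LinearMap.range P.toLinearMap
  obtain ⟨e, μ, he⟩ : ∃ (e : OrthonormalBasis (Fin n) ℝ T) (μ : Fin n → V → ℝ),
      ∀ i j, h.shapeOp j (e i) = μ i j • e i :=
    LinearMap.IsSymmetric.exists_joint_eigenbasis h.shapeOp_symmetric h.shapeOp_commute hn
  refine ⟨_, (e.prod (stdOrthonormalBasis ℝ Tᗮ)).map T.orthogonalDecomposition.symm,
    fun i => Q (e i) (e i), ?_⟩
  set b := (e.prod (stdOrthonormalBasis ℝ Tᗮ)).map T.orthogonalDecomposition.symm with hb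
  have hl : ∀ i, b (.inl i) = e i := by
    intro i
    simp [hb]
  have hPi : ∀ i, P (e i) = e i := fun i => h.proj_range (e i)
  have hr : ∀ α, P (b (.inr α)) = 0 := by
    intro α
    have h1 : b (.inr α) ∈ Tᗮ := by simp [hb]
    refine ext_inner_left ℝ fun w => ?_
    rw [← h.proj_symm, inner_zero_right]
    exact h1 _ ⟨w, rfl⟩
  refine ⟨fun i => by rw [hl, hPi], hr, fun i => h.proj_apply_of_tangent _ (hPi i), ?_⟩
  -- The eigenvalue is identified by pairing with the unit vector `e i`: it is the component of `A(e
  -- i, e i)` along `v`.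
  have hN : ∀ i v, P v = 0 → Q (e i) v = inner ℝ (Q (e i) (e i) : V) v • (e i : V) := by
    intro i v hv
    have h1 : Q (e i) v = μ i v • (e i : V) := by
      have := congrArg (Subtype.val) (he i v)
      simpa [shapeOp, hv] using this
    rw [h1]
    congr 1
    rw [h.symm, h1, inner_smul_right]
    have : inner ℝ (e i : V) (e i : V) = (1 : ℝ) := by
      have : ‖(e i : V)‖ = 1 := e.orthonormal.1 i
      rw [real_inner_self_eq_norm_sq, this, one_pow]
    rw [this, mul_one]
  -- By symmetry the normal components of `Q (e i) (e j)` are the pairings of `e j` with `Q (e i) w`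
  -- for normal `w`, and these vectors are parallel to `e i` by `hN`.
  have hT : ∀ i j, Q (e i) (e j) = if i = j then Q (e i) (e i) else 0 := by
    intro i j
    split_ifs with hij
    · rw [hij]
    · refine ext_inner_right ℝ fun w => ?_
      have hw : w = P w + (w - P w) := by abel
      have h0 : P (w - P w) = 0 := by rw [map_sub, h.proj_proj, sub_self]
      rw [hw, inner_add_right, ← h.proj_symm, h.proj_apply_of_tangent _ (hPi j), h.symm,
        hN i _ h0, inner_smul_right]
      have : inner ℝ (e j : V) (e i : V) = (0 : ℝ) := by
        have := e.orthonormal.2 (Ne.symm hij)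
        simpa using this
      rw [this]
      simp
  intro i v
  rw [hl]
  have hv : v = P v + (v - P v) := by abel
  have h0 : P (v - P v) = 0 := by rw [map_sub, h.proj_proj, sub_self]
  have h1 : P v = ∑ j, inner ℝ (e j : V) v • (e j : V) := by
    have := e.sum_repr' ⟨P v, ⟨v, rfl⟩⟩
    have h2 := congrArg Subtype.val this
    simp only [Submodule.coe_sum, Submodule.coe_smul, Submodule.coe_inner] at h2
    rw [← h2]
    refine Finset.sum_congr rfl fun j _ => ?_
    rw [← h.proj_symm, hPi]
  have h3 : Q (e i) (P v) = inner ℝ (e i : V) v • Q (e i) (e i) := by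
    rw [h1]
    simp only [map_sum, map_smul]
    rw [Finset.sum_eq_single i (fun j _ hj => by rw [hT, if_neg hj.symm, smul_zero]) (by simp)]
  have h4 : inner ℝ (Q (e i) (e i) : V) v = inner ℝ (Q (e i) (e i) : V) (v - P v) := by
    rw [inner_sub_right, ← h.proj_symm, h.proj_apply_of_tangent _ (hPi i), inner_zero_left,
      sub_zero]
  rw [h4, ← hN i _ h0, ← h3, ← map_add, add_sub_cancel]

end IsFlatShape

end PointwiseShape



/-! ### Pointwise algebra of the first and second derivatives of the projection -/

section PointwiseAlgebra

variable {V : Type*} [NormedAddCommGroup V] [InnerProductSpace ℝ V]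

/-- The algebraic properties of the second tangential derivative `R d a = ∂_d Q_a` of the
tangential projection. -/
structure IsShapeDeriv (P : V →L[ℝ] V) (Q : V →L[ℝ] V →L[ℝ] V)
    (R : V →L[ℝ] V →L[ℝ] V →L[ℝ] V) : Prop where
  symm : ∀ d a v w, inner ℝ (R d a v) w = inner ℝ v (R d a w)
  swap : ∀ d a v, Q d (Q a v) + P (R d a v) + (R d a (P v) + Q a (Q d v)) = R d a v
  comm : ∀ d a b, R d a (P b) + Q a (Q d b) = R d b (P a) + Q b (Q d a)
  antisymm : ∀ d a, R d a - R a d = Q (Q d a - Q a d)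
  proj_left : ∀ d, R (P d) = R d
  normal : ∀ d a, P a = 0 → R d a = Q (Q d a)

variable {P : V →L[ℝ] V} {Q : V →L[ℝ] V →L[ℝ] V} {n m : ℕ}
  {b : OrthonormalBasis (Fin n ⊕ Fin m) ℝ V} {lam : Fin n → V}

namespace IsPrincipalBasis

variable (h : IsFlatShape P Q) (hb : IsPrincipalBasis P Q b lam)

omit hb in
theorem inner_inl_inl (b : OrthonormalBasis (Fin n ⊕ Fin m) ℝ V) (i j : Fin n) :
    inner ℝ (b (.inl i)) (b (.inl j)) = if i = j then (1 : ℝ) else 0 := by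
  rw [orthonormal_iff_ite.1 b.orthonormal]
  simp

include h hb

theorem inner_lam_inl (i j : Fin n) : inner ℝ (lam i) (b (.inl j)) = (0 : ℝ) := by
  rw [real_inner_comm, h.inner_tangent_normal (hb.proj_inl j) (hb.proj_lam i)]

theorem apply_inl_inl (i j : Fin n) :
    Q (b (.inl i)) (b (.inl j)) = if i = j then lam i else 0 := by
  rw [hb.apply_inl, inner_inl_inl, hb.inner_lam_inl h]
  by_cases hij : i = j <;> simp [hij]

theorem apply_inl_self (i : Fin n) : Q (b (.inl i)) (b (.inl i)) = lam i := by
  rw [hb.apply_inl_inl h, if_pos rfl]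

theorem apply_inl_normal (i : Fin n) {v : V} (hv : P v = 0) :
    Q (b (.inl i)) v = inner ℝ (lam i) v • b (.inl i) := by
  rw [hb.apply_inl, h.inner_tangent_normal (hb.proj_inl i) hv, zero_smul, zero_add]

theorem apply_inl_lam (i j : Fin n) :
    Q (b (.inl i)) (lam j) = inner ℝ (lam i) (lam j) • b (.inl i) :=
  hb.apply_inl_normal h i (hb.proj_lam j)

theorem apply_inr (α : Fin m) : Q (b (.inr α)) = 0 := h.apply_normal (hb.proj_inr α)

theorem sum_inr_inner_mul {v w : V} (hv : P v = 0) :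
    ∑ α, inner ℝ v (b (.inr α)) * inner ℝ (b (.inr α)) w = inner ℝ v w := by
  have := b.sum_inner_mul_inner v w
  rw [Fintype.sum_sum_type] at this
  rw [← this]
  simp only [right_eq_add]
  refine Finset.sum_eq_zero fun i _ => ?_
  rw [real_inner_comm, h.inner_tangent_normal (hb.proj_inl i) hv, zero_mul]

theorem sum_inl_inner_mul {v w : V} (hv : P v = v) :
    ∑ i, inner ℝ v (b (.inl i)) * inner ℝ (b (.inl i)) w = inner ℝ v w := by
  have := b.sum_inner_mul_inner v w
  rw [Fintype.sum_sum_type] at this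
  rw [← this]
  simp only [left_eq_add]
  refine Finset.sum_eq_zero fun α _ => ?_
  rw [h.inner_tangent_normal hv (hb.proj_inr α), zero_mul]

theorem proj_eq_sum (v : V) : P v = ∑ i, inner ℝ (b (.inl i)) v • b (.inl i) := by
  have := b.sum_repr' v
  conv_lhs => rw [← this]
  rw [Fintype.sum_sum_type]
  simp [hb.proj_inl, hb.proj_inr]

/-- The Hilbert-Schmidt pairing of `Q` with a family of symmetric operators. -/
theorem sum_inner_apply (X : V → V →L[ℝ] V) (hX : ∀ i v w, inner ℝ (X (b (.inl i)) v) w =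
      inner ℝ v (X (b (.inl i)) w)) :
    ∑ a, ∑ c, inner ℝ (Q (b a) (b c)) (X (b a) (b c)) =
      2 * ∑ i, inner ℝ (lam i) (X (b (.inl i)) (b (.inl i))) := by
  rw [Fintype.sum_sum_type]
  simp only [hb.apply_inr h, zero_apply, inner_zero_left,
    Finset.sum_const_zero, add_zero, Finset.mul_sum]
  refine Finset.sum_congr rfl fun i _ => ?_
  rw [Fintype.sum_sum_type, Finset.sum_eq_single i]
  -- One copy of the entry is the tangential column `e i`. The normal columns together give the
  -- other copy, because both operators are symmetric.
  · rw [hb.apply_inl_self h, two_mul]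
    congr 1
    have : ∀ α, inner ℝ (Q (b (.inl i)) (b (.inr α))) (X (b (.inl i)) (b (.inr α))) =
        inner ℝ (lam i) (b (.inr α)) * inner ℝ (b (.inr α)) (X (b (.inl i)) (b (.inl i))) := by
      intro α
      rw [hb.apply_inl_normal h i (hb.proj_inr α), inner_smul_left, ← hX,
        real_inner_comm (b (.inr α)) (X _ _)]
      simp
    simp only [this]
    exact hb.sum_inr_inner_mul h (hb.proj_lam i)
  · intro j _ hj
    rw [hb.apply_inl_inl h, if_neg hj.symm, inner_zero_left]
  · simp

theorem sum_norm_sq_apply :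
    ∑ a, ∑ c, ‖Q (b a) (b c)‖ ^ 2 = 2 * ∑ i, ‖lam i‖ ^ 2 := by
  have := hb.sum_inner_apply h (fun a => Q a) (fun i v w => h.symm _ v w)
  simpa only [real_inner_self_eq_norm_sq, hb.apply_inl_self h] using this

theorem norm_sq_add {v : V} : ‖v‖ ^ 2 = ‖P v‖ ^ 2 + ‖v - P v‖ ^ 2 := by
  have h0 : P (v - P v) = 0 := by rw [map_sub, h.proj_proj, sub_self]
  have := h.inner_tangent_normal (h.proj_proj v) h0
  have h1 := norm_add_sq_real (P v) (v - P v)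
  rw [add_sub_cancel, this] at h1
  linarith

variable {R : V →L[ℝ] V →L[ℝ] V →L[ℝ] V} (hR : IsShapeDeriv P Q R)

/-- The component `h_{kij}` of the covariant derivative of the second fundamental form. -/
noncomputable def covShape (P : V →L[ℝ] V) (R : V →L[ℝ] V →L[ℝ] V →L[ℝ] V)
    (b : OrthonormalBasis (Fin n ⊕ Fin m) ℝ V) (k i j : Fin n) : V :=
  R (b (.inl k)) (b (.inl i)) (b (.inl j)) - P (R (b (.inl k)) (b (.inl i)) (b (.inl j)))

include hR

theorem deriv_inr (k : Fin n) (α : Fin m) :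
    R (b (.inl k)) (b (.inr α)) = inner ℝ (lam k) (b (.inr α)) • Q (b (.inl k)) := by
  rw [hR.normal _ _ (hb.proj_inr α), hb.apply_inl_normal h k (hb.proj_inr α), map_smul]

theorem deriv_inr_left (α : Fin m) : R (b (.inr α)) = 0 := by
  rw [← hR.proj_left, hb.proj_inr, map_zero]

/-- Differentiating `PQ + QP = Q` expresses the tangential part of `R` on tangent vectors through
products of `Q`. Only the normal part, `covShape`, carries information about `∇A`. -/
theorem proj_deriv (k i j : Fin n) :
    P (R (b (.inl k)) (b (.inl i)) (b (.inl j))) = - (inner ℝ (lam k) (lam i) •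
      ((if i = j then b (.inl k) else 0) + (if k = j then b (.inl i) else 0))) := by
  have h1 := hR.swap (b (.inl k)) (b (.inl i)) (b (.inl j))
  rw [hb.proj_inl, hb.apply_inl_inl h, hb.apply_inl_inl h] at h1
  have h2 : P (R (b (.inl k)) (b (.inl i)) (b (.inl j))) =
      -(Q (b (.inl k)) (if i = j then lam i else 0) + Q (b (.inl i)) (if k = j then lam k else 0))
      := by
    generalize Q (b (.inl k)) (if i = j then lam i else 0) = x at h1 ⊢
    generalize Q (b (.inl i)) (if k = j then lam k else 0) = y at h1 ⊢
    rw [← sub_eq_zero] at h1 ⊢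
    rw [← h1]; abel
  rw [h2]
  split_ifs <;> simp [hb.apply_inl_lam h, real_inner_comm (lam i) (lam k)]

theorem deriv_normal (k i : Fin n) {v : V} (hv : P v = 0) :
    R (b (.inl k)) (b (.inl i)) v - P (R (b (.inl k)) (b (.inl i)) v) =
      if k = i then (2 * inner ℝ (lam k) v) • lam k else 0 := by
  have h1 := hR.swap (b (.inl k)) (b (.inl i)) v
  rw [hv, map_zero, hb.apply_inl_normal h _ hv, hb.apply_inl_normal h _ hv, map_smul, map_smul,
    hb.apply_inl_inl h, hb.apply_inl_inl h] at h1
  rw [← h1]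
  by_cases hki : k = i
  · subst hki
    simp only [if_true, zero_add]
    rw [two_mul, add_smul]
    simp only [map_add, map_smul, hb.proj_lam, h.proj_proj, smul_zero]
    abel
  · simp [hki, Ne.symm hki, h.proj_proj]

/-- This is the Codazzi equation. The first-order term in the commutator of the derivatives vanishes
because `Q (e k) (e i)` is already symmetric in a principal basis. -/
theorem covShape_swap_left (k i j : Fin n) : covShape P R b k i j = covShape P R b i k j := by
  have h1 := hR.antisymm (b (.inl k)) (b (.inl i))
  have h2 : Q (b (.inl k)) (b (.inl i)) - Q (b (.inl i)) (b (.inl k)) = 0 := by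
    rw [hb.apply_inl_inl h, hb.apply_inl_inl h]
    by_cases hki : k = i
    · subst hki; simp
    · simp [hki, Ne.symm hki]
  rw [h2, map_zero, sub_eq_zero] at h1
  rw [covShape, covShape, h1]

/-- This is the derivative of the symmetry of `A`. The additional terms are tangential and disappear
in the normal part. -/
theorem covShape_swap_right (k i j : Fin n) : covShape P R b k i j = covShape P R b k j i := by
  have h1 := hR.comm (b (.inl k)) (b (.inl i)) (b (.inl j))
  rw [hb.proj_inl, hb.proj_inl, hb.apply_inl_inl h, hb.apply_inl_inl h] at h1
  have h3 : ∀ i j : Fin n, P (Q (b (.inl i)) (if k = j then lam k else 0)) =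
      Q (b (.inl i)) (if k = j then lam k else 0) := by
    intro i j
    apply h.proj_apply_of_normal
    split_ifs <;> simp [hb.proj_lam]
  have h2 := congrArg (fun v => v - P v) h1
  simp only [map_add, h3] at h2
  rw [covShape, covShape]
  simpa using h2

theorem covShape_normal (k i j : Fin n) : P (covShape P R b k i j) = 0 := by
  rw [covShape, map_sub, h.proj_proj, sub_self]

theorem inner_lam_deriv (i k l j : Fin n) :
    inner ℝ (lam i) (R (b (.inl k)) (b (.inl l)) (b (.inl j))) =
      inner ℝ (lam i) (covShape P R b k l j) := by
  rw [covShape, inner_sub_right, ← h.proj_symm, hb.proj_lam, inner_zero_left, sub_zero]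

/-- Each `covShape` entry is counted twice, in the tangent-to-normal block and in its transpose. The
two diagonal blocks are quadratic in `Q` and produce the quartic terms in `lam`. -/
theorem sum_norm_sq_deriv_apply (k i : Fin n) :
    ∑ c, ‖R (b (.inl k)) (b (.inl i)) (b c)‖ ^ 2 =
      2 * ∑ j, ‖covShape P R b k i j‖ ^ 2 + 2 * inner ℝ (lam k) (lam i) ^ 2 +
        if k = i then 6 * (‖lam k‖ ^ 2) ^ 2 else 0 := by
  have hT : ∀ j, ‖R (b (.inl k)) (b (.inl i)) (b (.inl j))‖ ^ 2 =
      inner ℝ (lam k) (lam i) ^ 2 * ((if i = j then 1 else 0) + (if k = j then 1 else 0) +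
        2 * if i = j then (if k = j then 1 else 0) else 0) +
      ‖covShape P R b k i j‖ ^ 2 := by
    intro j
    rw [hb.norm_sq_add h, ← covShape, hb.proj_deriv h hR, norm_neg, norm_smul, mul_pow,
      Real.norm_eq_abs, sq_abs]
    congr 2
    rw [norm_add_sq_real]
    by_cases hij : i = j <;> by_cases hkj : k = j <;> simp [hij, hkj] <;> norm_num
  have hN : ∀ α, ‖R (b (.inl k)) (b (.inl i)) (b (.inr α))‖ ^ 2 =
      ∑ j, inner ℝ (covShape P R b k i j) (b (.inr α)) * inner ℝ (b (.inr α))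
        (covShape P R b k i j) + (if k = i then 4 * ‖lam k‖ ^ 2 *
          (inner ℝ (lam k) (b (.inr α)) * inner ℝ (b (.inr α)) (lam k)) else 0) := by
    intro α
    rw [hb.norm_sq_add h, hb.deriv_normal h hR _ _ (hb.proj_inr α)]
    congr 1
    · rw [← real_inner_self_eq_norm_sq, ← hb.sum_inl_inner_mul h (h.proj_proj _)]
      refine Finset.sum_congr rfl fun j _ => ?_
      have h1 : inner ℝ (P (R (b (.inl k)) (b (.inl i)) (b (.inr α)))) (b (.inl j)) =
          inner ℝ (covShape P R b k i j) (b (.inr α)) := by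
        rw [h.proj_symm, hb.proj_inl, hR.symm, covShape, inner_sub_left,
          h.inner_tangent_normal (h.proj_proj _) (hb.proj_inr α), sub_zero, real_inner_comm]
      rw [real_inner_comm (P _), h1, real_inner_comm (covShape P R b k i j)]
    · split_ifs
      · rw [norm_smul, mul_pow, Real.norm_eq_abs, sq_abs, real_inner_comm (lam k)]; ring
      · simp
  rw [Fintype.sum_sum_type]
  simp only [hT, hN, Finset.sum_add_distrib]
  rw [Finset.sum_comm (s := (Finset.univ : Finset (Fin m)))]
  simp only [hb.sum_inr_inner_mul h (hb.covShape_normal h hR k i _), real_inner_self_eq_norm_sq]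
  rw [← Finset.mul_sum]
  simp only [Finset.sum_add_distrib, ← Finset.mul_sum]
  by_cases hki : k = i
  · subst hki
    simp only [if_true, ← Finset.mul_sum, hb.sum_inr_inner_mul h (hb.proj_lam k),
      real_inner_self_eq_norm_sq, Finset.sum_ite_eq, Finset.mem_univ]
    ring
  · have : ∑ x, (if i = x then (if k = x then (1:ℝ) else 0) else 0) = 0 := by
      simp [hki]
    rw [this]
    simp [hki]; ring

/-- This is the gradient term in the Laplacian of `|Q|² = 2|A|²`. Besides `2|∇A|²` it contains
quartic terms, because `R` is an ambient derivative rather than a covariant one; they cancel in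
Simons' identity. -/
theorem sum_norm_sq_deriv :
    ∑ d, ∑ a, ∑ c, ‖R (b d) (b a) (b c)‖ ^ 2 =
      2 * ∑ k, ∑ i, ∑ j, ‖covShape P R b k i j‖ ^ 2 + 8 * ∑ k, (‖lam k‖ ^ 2) ^ 2 +
        2 * ∑ k, ∑ i, inner ℝ (lam k) (lam i) ^ 2 := by
  rw [Fintype.sum_sum_type]
  simp only [hb.deriv_inr_left h hR, zero_apply, zero_apply, norm_zero]
  have hα : ∀ k, ∑ α, ∑ c, ‖R (b (.inl k)) (b (.inr α)) (b c)‖ ^ 2 = 2 * (‖lam k‖ ^ 2) ^ 2 := by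
    intro k
    have h1 : ∑ c, ‖Q (b (.inl k)) (b c)‖ ^ 2 = 2 * ‖lam k‖ ^ 2 := by
      rw [Fintype.sum_sum_type, Finset.sum_eq_single k]
      · rw [hb.apply_inl_self h, two_mul]
        congr 1
        rw [← real_inner_self_eq_norm_sq, ← hb.sum_inr_inner_mul h (hb.proj_lam k)]
        refine Finset.sum_congr rfl fun α _ => ?_
        rw [hb.apply_inl_normal h k (hb.proj_inr α), norm_smul, mul_pow, Real.norm_eq_abs, sq_abs,
          b.orthonormal.1, real_inner_comm (lam k)]
        ring
      · intro j _ hj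
        rw [hb.apply_inl_inl h, if_neg hj.symm]; simp
      · simp
    have h2 : ∀ α, ∑ c, ‖R (b (.inl k)) (b (.inr α)) (b c)‖ ^ 2 =
        (inner ℝ (lam k) (b (.inr α)) * inner ℝ (b (.inr α)) (lam k)) * (2 * ‖lam k‖ ^ 2) := by
      intro α
      rw [← h1, Finset.mul_sum]
      refine Finset.sum_congr rfl fun c _ => ?_
      rw [hb.deriv_inr h hR, smul_apply, norm_smul, mul_pow, Real.norm_eq_abs,
        sq_abs, real_inner_comm (lam k)]
      ring
    simp only [h2]
    rw [← Finset.sum_mul, hb.sum_inr_inner_mul h (hb.proj_lam k), real_inner_self_eq_norm_sq]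
    ring
  have hk : ∀ k, ∑ a, ∑ c, ‖R (b (.inl k)) (b a) (b c)‖ ^ 2 =
      2 * ∑ i, ∑ j, ‖covShape P R b k i j‖ ^ 2 + 2 * ∑ i, inner ℝ (lam k) (lam i) ^ 2 +
        8 * (‖lam k‖ ^ 2) ^ 2 := by
    intro k
    rw [Fintype.sum_sum_type, hα]
    simp only [hb.sum_norm_sq_deriv_apply h hR, Finset.sum_add_distrib, ← Finset.mul_sum]
    simp only [Finset.sum_ite_eq, Finset.mem_univ, if_true]
    ring
  simp only [hk, Finset.sum_add_distrib, ← Finset.mul_sum]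
  simp
  ring

end IsPrincipalBasis
end PointwiseAlgebra



/-! ### Tangential calculus on a parametrized submanifold -/

/-- The Euclidean parameter space. -/
abbrev Eu (n : ℕ) := EuclideanSpace ℝ (Fin n)

namespace FlatNormalGraph

noncomputable section Calculus

variable {n : ℕ} {V : Type*} [NormedAddCommGroup V] [InnerProductSpace ℝ V]
  [FiniteDimensional ℝ V]

theorem two_le_infty : minSmoothness ℝ 2 ≤ ∞ := by
  rw [minSmoothness_of_isRCLikeNormedField]
  exact WithTop.coe_le_coe.2 (le_top (a := (2 : ℕ∞)))

/-- `f` parametrizes a smooth submanifold over `U`, and the linear map `π` reads off the parameter.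
-/
structure IsGraphOver (π : V →L[ℝ] Eu n) (f : Eu n → V) (U : Set (Eu n)) : Prop where
  isOpen : IsOpen U
  contDiffOn : ContDiffOn ℝ ∞ f U
  proj : ∀ x ∈ U, π (f x) = x

variable {G G' : Type*} [NormedAddCommGroup G] [NormedSpace ℝ G] [NormedAddCommGroup G']
  [NormedSpace ℝ G']

/-- The tangential derivative `a ↦ ∂_{a^⊤} u` of a function on the submanifold. -/
def tD (π : V →L[ℝ] Eu n) (f : Eu n → V) (u : Eu n → G) (x : Eu n) : V →L[ℝ] G :=
  (fderiv ℝ u x).comp (π.comp (tangentProj f x))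

/-- The tangential derivative of the tangential projection. -/
def shape (π : V →L[ℝ] Eu n) (f : Eu n → V) : Eu n → V →L[ℝ] V →L[ℝ] V :=
  tD π f (tangentProj f)

variable {π : V →L[ℝ] Eu n} {f : Eu n → V} {U : Set (Eu n)} {x : Eu n}

theorem tangentProj_symm (f : Eu n → V) (x : Eu n) (v w : V) :
    inner ℝ (tangentProj f x v) w = inner ℝ v (tangentProj f x w) :=
  Submodule.inner_starProjection_left_eq_right _ v w

theorem tangentProj_proj (f : Eu n → V) (x : Eu n) (v : V) :
    tangentProj f x (tangentProj f x v) = tangentProj f x v :=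
  Submodule.starProjection_eq_self_iff.2 (Submodule.starProjection_apply_mem _ v)

theorem normalProj_apply (f : Eu n → V) (x : Eu n) (v : V) :
    normalProj f x v = v - tangentProj f x v := by
  rw [normalProj, Submodule.starProjection_orthogonal]
  rfl

theorem tangentProj_fderiv (f : Eu n → V) (x u : Eu n) :
    tangentProj f x (fderiv ℝ f x u) = fderiv ℝ f x u :=
  Submodule.starProjection_eq_self_iff.2 ⟨u, rfl⟩

theorem tD_apply (u : Eu n → G) (x : Eu n) (a : V) :
    tD π f u x a = fderiv ℝ u x (π (tangentProj f x a)) := rfl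

theorem tD_proj (u : Eu n → G) (x : Eu n) (a : V) :
    tD π f u x (tangentProj f x a) = tD π f u x a := by
  rw [tD_apply, tangentProj_proj, tD_apply]

theorem tD_congr {u v : Eu n → G} (h : u =ᶠ[𝓝 x] v) : tD π f u x = tD π f v x := by
  rw [tD, tD, h.fderiv_eq]

theorem tD_const (c : G) : tD π f (fun _ => c) x = 0 := by
  ext a; simp [tD_apply]

theorem tD_add {u v : Eu n → G} (hu : DifferentiableAt ℝ u x) (hv : DifferentiableAt ℝ v x)
    (a : V) : tD π f (fun y => u y + v y) x a = tD π f u x a + tD π f v x a := by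
  rw [tD_apply, fderiv_fun_add hu hv]; rfl

theorem tD_sub {u v : Eu n → G} (hu : DifferentiableAt ℝ u x) (hv : DifferentiableAt ℝ v x)
    (a : V) : tD π f (fun y => u y - v y) x a = tD π f u x a - tD π f v x a := by
  rw [tD_apply, fderiv_fun_sub hu hv]; rfl

theorem tD_sum {ι : Type*} {s : Finset ι} {u : ι → Eu n → G}
    (hu : ∀ i ∈ s, DifferentiableAt ℝ (u i) x) (a : V) :
    tD π f (fun y => ∑ i ∈ s, u i y) x a = ∑ i ∈ s, tD π f (u i) x a := by
  rw [tD_apply, fderiv_fun_sum hu]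
  simp [tD_apply]

theorem tD_clm_apply {c : Eu n → G →L[ℝ] G'} {u : Eu n → G} (hc : DifferentiableAt ℝ c x)
    (hu : DifferentiableAt ℝ u x) (a : V) :
    tD π f (fun y => c y (u y)) x a = tD π f c x a (u x) + c x (tD π f u x a) := by
  rw [tD_apply, fderiv_clm_apply hc hu, add_comm]; rfl

theorem tD_clm_const {c : Eu n → G →L[ℝ] G'} (hc : DifferentiableAt ℝ c x) (v : G) (a : V) :
    tD π f (fun y => c y v) x a = tD π f c x a v := by
  rw [tD_clm_apply hc (differentiableAt_const v), tD_const]; simp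

theorem tD_const_clm (c : G →L[ℝ] G') {u : Eu n → G} (hu : DifferentiableAt ℝ u x) (a : V) :
    tD π f (fun y => c (u y)) x a = c (tD π f u x a) := by
  rw [tD_clm_apply (differentiableAt_const c) hu, tD_const]; simp

theorem tD_clm_comp {H : Type*} [NormedAddCommGroup H] [NormedSpace ℝ H] {c : Eu n → G →L[ℝ] G'}
    {d : Eu n → H →L[ℝ] G} (hc : DifferentiableAt ℝ c x) (hd : DifferentiableAt ℝ d x) (a : V) :
    tD π f (fun y => (c y).comp (d y)) x a =
      (tD π f c x a).comp (d x) + (c x).comp (tD π f d x a) := by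
  rw [tD_apply, fderiv_clm_comp hc hd, add_comm]; rfl

theorem tD_inner {u v : Eu n → V} (hu : DifferentiableAt ℝ u x) (hv : DifferentiableAt ℝ v x)
    (a : V) : tD π f (fun y => inner ℝ (u y) (v y)) x a =
      inner ℝ (tD π f u x a) (v x) + inner ℝ (u x) (tD π f v x a) := by
  rw [tD_apply, fderiv_inner_apply ℝ hu hv, add_comm]; rfl

theorem tD_smul {u : Eu n → ℝ} {v : Eu n → G} (hu : DifferentiableAt ℝ u x)
    (hv : DifferentiableAt ℝ v x) (a : V) : tD π f (fun y => u y • v y) x a =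
      tD π f u x a • v x + u x • tD π f v x a := by
  rw [tD_apply, fderiv_fun_smul hu hv, add_comm]; rfl

theorem tD_mul {u v : Eu n → ℝ} (hu : DifferentiableAt ℝ u x)
    (hv : DifferentiableAt ℝ v x) (a : V) : tD π f (fun y => u y * v y) x a =
      tD π f u x a * v x + u x * tD π f v x a := tD_smul hu hv a

namespace IsGraphOver

variable (hf : IsGraphOver π f U) (hx : x ∈ U)
include hf hx

theorem eventually_mem : ∀ᶠ y in 𝓝 x, y ∈ U := hf.isOpen.mem_nhds hx

theorem contDiffAt : ContDiffAt ℝ ∞ f x := hf.contDiffOn.contDiffAt (hf.isOpen.mem_nhds hx)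

theorem contDiffAt_fderiv : ContDiffAt ℝ ∞ (fderiv ℝ f) x :=
  (hf.contDiffAt hx).fderiv_right (by simp)

theorem proj_fderiv (u : Eu n) : π (fderiv ℝ f x u) = u := by
  have h1 : (fun y => π (f y)) =ᶠ[𝓝 x] fun y => y :=
    (hf.eventually_mem hx).mono fun y hy => hf.proj y hy
  have h2 := h1.fderiv_eq (𝕜 := ℝ)
  have h3 : fderiv ℝ (fun y => π (f y)) x = π.comp (fderiv ℝ f x) :=
    π.hasFDerivAt.comp x ((hf.contDiffAt hx).differentiableAt (by simp)).hasFDerivAt |>.fderiv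
  rw [h3, fderiv_fun_id] at h2
  simpa using congrArg (fun L => L u) h2

theorem fderiv_injective : Function.Injective (fderiv ℝ f x) :=
  Function.LeftInverse.injective (hf.proj_fderiv hx)

theorem fderiv_proj (v : V) : fderiv ℝ f x (π (tangentProj f x v)) = tangentProj f x v := by
  have : tangentProj f x v ∈ tangentSpace f x := Submodule.starProjection_apply_mem _ v
  obtain ⟨u, hu⟩ := this
  rw [← hu]
  change fderiv ℝ f x (π (fderiv ℝ f x u)) = fderiv ℝ f x u
  rw [hf.proj_fderiv hx]

omit hf hx in
theorem _root_.ContDiffAt.adjoint {E F : Type*} [NormedAddCommGroup E] [InnerProductSpace ℝ E]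
    [FiniteDimensional ℝ E] [NormedAddCommGroup F] [InnerProductSpace ℝ F] [FiniteDimensional ℝ F]
    {A : Eu n → E →L[ℝ] F} {x : Eu n} {N : WithTop ℕ∞} (hA : ContDiffAt ℝ N A x) :
    letI := FiniteDimensional.complete ℝ E
    letI := FiniteDimensional.complete ℝ F
    ContDiffAt ℝ N (fun y => (A y).adjoint) x := by
  let := FiniteDimensional.complete ℝ E
  let := FiniteDimensional.complete ℝ F
  let T : (E →L[ℝ] F) →ₗ[ℝ] (F →L[ℝ] E) :=
    { toFun := fun A => A.adjoint
      map_add' := fun A B => map_add _ A B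
      map_smul' := fun c A => by simp }
  have hT : ContDiff ℝ N T := T.toContinuousLinearMap.contDiff
  exact hT.contDiffAt.comp x hA

/-- With `D = df`, the projection is `D (D* D)⁻¹ D*`. Injectivity of `D` makes `D* D` invertible,
and inversion is smooth. -/
theorem contDiffAt_tangentProj : ContDiffAt ℝ ∞ (tangentProj f) x := by
  have := FiniteDimensional.complete ℝ V
  let g : Eu n → Eu n →L[ℝ] Eu n := fun y => (fderiv ℝ f y).adjoint.comp (fderiv ℝ f y)
  have hinj : ∀ y ∈ U, Function.Injective (g y) := by
    intro y hy
    rw [injective_iff_map_eq_zero]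
    intro u hu
    have h1 : inner ℝ (g y u) u = (0 : ℝ) := by rw [hu, inner_zero_left]
    rw [ContinuousLinearMap.comp_apply, ContinuousLinearMap.adjoint_inner_left,
      inner_self_eq_zero] at h1
    exact (map_eq_zero_iff _ (hf.fderiv_injective hy)).1 h1
  have hinv : ∀ y ∈ U, (g y).IsInvertible := by
    intro y hy
    exact ⟨(LinearEquiv.ofInjectiveEndo (g y).toLinearMap (hinj y hy)).toContinuousLinearEquiv,
      by ext1 v; rfl⟩
  have hg : ContDiffAt ℝ ∞ g x := (hf.contDiffAt_fderiv hx).adjoint.clm_comp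
    (hf.contDiffAt_fderiv hx)
  have hgi : ContDiffAt ℝ ∞ (fun y => (g y).inverse) x :=
    ((hinv x hx).contDiffAt_map_inverse).comp x hg
  have hF : ContDiffAt ℝ ∞ (fun y => (fderiv ℝ f y).comp
      (((g y).inverse).comp (fderiv ℝ f y).adjoint)) x :=
    (hf.contDiffAt_fderiv hx).clm_comp (hgi.clm_comp (hf.contDiffAt_fderiv hx).adjoint)
  refine hF.congr_of_eventuallyEq ((hf.eventually_mem hx).mono fun y hy => ?_)
  ext1 v
  rw [tangentProj]
  refine Submodule.eq_starProjection_of_mem_of_inner_eq_zero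
    (show _ ∈ tangentSpace f y from ⟨(g y).inverse ((fderiv ℝ f y).adjoint v), rfl⟩) ?_
  rintro w ⟨u, rfl⟩
  change inner ℝ (v - fderiv ℝ f y ((g y).inverse ((fderiv ℝ f y).adjoint v)))
    (fderiv ℝ f y u) = 0
  rw [← ContinuousLinearMap.adjoint_inner_left, map_sub]
  have : (fderiv ℝ f y).adjoint (fderiv ℝ f y ((g y).inverse ((fderiv ℝ f y).adjoint v))) =
      g y ((g y).inverse ((fderiv ℝ f y).adjoint v)) := rfl
  rw [this, (hinv y hy).self_apply_inverse, sub_self, inner_zero_left]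

theorem differentiableAt_tangentProj : DifferentiableAt ℝ (tangentProj f) x :=
  (hf.contDiffAt_tangentProj hx).differentiableAt (by simp)

theorem contDiffAt_tD {u : Eu n → G} (hu : ContDiffAt ℝ ∞ u x) : ContDiffAt ℝ ∞ (tD π f u) x :=
  (hu.fderiv_right (by simp)).clm_comp (contDiffAt_const.clm_comp (hf.contDiffAt_tangentProj hx))

theorem contDiffAt_shape : ContDiffAt ℝ ∞ (shape π f) x :=
  hf.contDiffAt_tD hx (hf.contDiffAt_tangentProj hx)

theorem differentiableAt_shape : DifferentiableAt ℝ (shape π f) x :=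
  (hf.contDiffAt_shape hx).differentiableAt (by simp)

theorem finrank_range_tangentProj :
    Module.finrank ℝ (LinearMap.range (tangentProj f x).toLinearMap) = n := by
  have h1 : LinearMap.range (tangentProj f x).toLinearMap = tangentSpace f x := by
    ext v
    constructor
    · rintro ⟨w, rfl⟩
      exact Submodule.starProjection_apply_mem _ w
    · intro hv
      exact ⟨v, Submodule.starProjection_eq_self_iff.2 hv⟩
  rw [h1, tangentSpace, LinearMap.finrank_range_of_inj (hf.fderiv_injective hx)]
  simp

theorem fderiv_tangentProj_symm (u : Eu n) (v w : V) :
    inner ℝ (fderiv ℝ (tangentProj f) x u v) w = inner ℝ v (fderiv ℝ (tangentProj f) x u w) := by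
  have hP := hf.differentiableAt_tangentProj hx
  have h1 : (fun y => inner ℝ (tangentProj f y v) w) = fun y => inner ℝ v (tangentProj f y w) :=
    funext fun y => tangentProj_symm f y v w
  have h2 := congrArg (fun g => fderiv ℝ g x u) h1
  rw [fderiv_inner_apply ℝ (hP.clm_apply (differentiableAt_const v)) (differentiableAt_const w),
    fderiv_inner_apply ℝ (differentiableAt_const v) (hP.clm_apply (differentiableAt_const w)),
    fderiv_clm_apply hP (differentiableAt_const v), fderiv_clm_apply hP (differentiableAt_const w)]
    at h2
  simpa using h2

theorem fderiv_tangentProj_swap (u : Eu n) (v : V) :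
    tangentProj f x (fderiv ℝ (tangentProj f) x u v) +
      fderiv ℝ (tangentProj f) x u (tangentProj f x v) = fderiv ℝ (tangentProj f) x u v := by
  have hP := hf.differentiableAt_tangentProj hx
  have hPv := hP.clm_apply (differentiableAt_const v)
  have h1 : (fun y => tangentProj f y (tangentProj f y v)) = fun y => tangentProj f y v :=
    funext fun y => tangentProj_proj f y v
  have h2 := congrArg (fun g => fderiv ℝ g x u) h1
  rw [fderiv_clm_apply hP hPv, fderiv_clm_apply hP (differentiableAt_const v)] at h2
  simpa using h2

/-- Differentiating `P (df v) = df v` shows that the derivative of `P` on tangent vectors is the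
normal part of `D²f`, hence the second fundamental form. -/
theorem fderiv_tangentProj_fderiv (u v : Eu n) :
    fderiv ℝ (tangentProj f) x u (fderiv ℝ f x v) =
      fderiv ℝ (fderiv ℝ f) x u v - tangentProj f x (fderiv ℝ (fderiv ℝ f) x u v) := by
  have hP := hf.differentiableAt_tangentProj hx
  have hd : DifferentiableAt ℝ (fderiv ℝ f) x :=
    (hf.contDiffAt_fderiv hx).differentiableAt (by simp)
  have hdv := hd.clm_apply (differentiableAt_const v)
  have h1 : (fun y => tangentProj f y (fderiv ℝ f y v)) = fun y => fderiv ℝ f y v :=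
    funext fun y => tangentProj_fderiv f y v
  have h2 := congrArg (fun g => fderiv ℝ g x u) h1
  rw [fderiv_clm_apply hP hdv, fderiv_clm_apply hd (differentiableAt_const v)] at h2
  simp at h2
  exact eq_sub_of_add_eq (by rw [add_comm]; exact h2)

theorem fderiv_tangentProj_comm (u v : Eu n) :
    fderiv ℝ (tangentProj f) x u (fderiv ℝ f x v) =
      fderiv ℝ (tangentProj f) x v (fderiv ℝ f x u) := by
  rw [hf.fderiv_tangentProj_fderiv hx, hf.fderiv_tangentProj_fderiv hx,
    ((hf.contDiffAt hx).isSymmSndFDerivAt two_le_infty).eq u v]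

end IsGraphOver

end Calculus

end FlatNormalGraph



/-! ### Commuting tangential derivatives and the flatness condition -/

namespace FlatNormalGraph

noncomputable section Curvature

variable {n : ℕ} {V : Type*} [NormedAddCommGroup V] [InnerProductSpace ℝ V]
  [FiniteDimensional ℝ V] {G : Type*} [NormedAddCommGroup G] [NormedSpace ℝ G]
  {π : V →L[ℝ] Eu n} {f : Eu n → V} {U : Set (Eu n)} {x : Eu n}

namespace IsGraphOver

variable (hf : IsGraphOver π f U) (hx : x ∈ U)
include hf hx

theorem shape_symm (a v w : V) :
    inner ℝ (shape π f x a v) w = inner ℝ v (shape π f x a w) :=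
  hf.fderiv_tangentProj_symm hx _ v w

theorem shape_swap (a v : V) :
    tangentProj f x (shape π f x a v) + shape π f x a (tangentProj f x v) = shape π f x a v :=
  hf.fderiv_tangentProj_swap hx _ v

theorem shape_comm (a b : V) :
    shape π f x a (tangentProj f x b) = shape π f x b (tangentProj f x a) := by
  have := hf.fderiv_tangentProj_comm hx (π (tangentProj f x a)) (π (tangentProj f x b))
  rwa [hf.fderiv_proj hx, hf.fderiv_proj hx] at this

theorem differentiableAt_tD {u : Eu n → G} (hu : ContDiffAt ℝ ∞ u x) :
    DifferentiableAt ℝ (tD π f u) x := (hf.contDiffAt_tD hx hu).differentiableAt (by simp)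

/-- `Q a b` and `Q b a` have the same normal component by `shape_comm`. Their difference can
therefore serve as a direction of differentiation in the commutator of two tangential derivatives.
-/
theorem shape_sub_tangent (a b : V) : tangentProj f x (shape π f x a b - shape π f x b a) =
      shape π f x a b - shape π f x b a := by
  rw [map_sub]
  have h1 := hf.shape_swap hx a b
  have h2 := hf.shape_swap hx b a
  rw [hf.shape_comm hx b a] at h2
  rw [← eq_sub_iff_add_eq] at h1 h2
  rw [h1, h2]
  abel

/-- The tangential derivatives commute up to a first order term. -/
theorem tD_tD_sub_tD_tD {u : Eu n → G} (hu : ContDiffAt ℝ ∞ u x) (a b : V) :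
    tD π f (tD π f u) x a b - tD π f (tD π f u) x b a =
      tD π f u x (shape π f x a b - shape π f x b a) := by
  have hd : DifferentiableAt ℝ (fderiv ℝ u) x :=
    (hu.fderiv_right (m := ∞) (by simp)).differentiableAt (by simp)
  have hP := hf.differentiableAt_tangentProj hx
  have key : ∀ a b : V, tD π f (tD π f u) x a b =
      fderiv ℝ (fderiv ℝ u) x (π (tangentProj f x a)) (π (tangentProj f x b)) +
        fderiv ℝ u x (π (shape π f x a b)) := by
    intro a b
    have h0 : DifferentiableAt ℝ (fun y => π.comp (tangentProj f y)) x :=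
      (differentiableAt_const π).clm_comp hP
    have h1 := tD_clm_comp (π := π) (f := f) hd h0 a
    have h2 := tD_clm_comp (π := π) (f := f) (differentiableAt_const (x := x) π) hP a
    change tD π f (fun y => (fderiv ℝ u y).comp (π.comp (tangentProj f y))) x a b = _
    rw [h1, h2, tD_const]
    simp [tD_apply, shape]
  rw [key, key, (hu.isSymmSndFDerivAt two_le_infty).eq, tD_apply,
    hf.shape_sub_tangent hx, map_sub, map_sub]
  abel

/-- On the normal part of a constant vector, the normal connection is minus the normal part of a
derivative of `P`. A second derivative adds a Hessian of `P`, which is symmetric in `u` and `v` and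
cancels in the curvature, leaving a commutator of shape operators. -/
theorem normalConn_normalConn (u v : Eu n) (w : V) :
    normalConn f (fun _ => u) (normalConn f (fun _ => v) (fun y => normalProj f y w)) x =
      normalProj f x (fderiv ℝ (tangentProj f) x u (fderiv ℝ (tangentProj f) x v w)) -
      normalProj f x (fderiv ℝ (fderiv ℝ (tangentProj f)) x u v w) := by
  have h1 : normalConn f (fun _ => v) (fun y => normalProj f y w) =ᶠ[𝓝 x]
      fun y => tangentProj f y (fderiv ℝ (tangentProj f) y v w) -
        fderiv ℝ (tangentProj f) y v w := by
    filter_upwards [hf.eventually_mem hx] with y hy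
    simp only [normalConn, ambientDeriv, normalProj_apply]
    rw [fderiv_const_sub, fderiv_clm_apply (hf.differentiableAt_tangentProj hy)
      (differentiableAt_const w)]
    simp
    abel
  have hP := hf.differentiableAt_tangentProj hx
  have hD : DifferentiableAt ℝ (fun y => fderiv ℝ (tangentProj f) y v) x :=
    (((hf.contDiffAt_tangentProj hx).fderiv_right (m := ∞) (by simp)).differentiableAt
      (by simp)).clm_apply (differentiableAt_const v)
  have hD' := hD.clm_apply (differentiableAt_const w)
  rw [normalConn, ambientDeriv, h1.fderiv_eq, fderiv_fun_sub (hP.clm_apply hD') hD',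
    fderiv_clm_apply hP hD', fderiv_clm_apply hD (differentiableAt_const w),
    fderiv_clm_apply (((hf.contDiffAt_tangentProj hx).fderiv_right (m := ∞)
      (by simp)).differentiableAt (by simp)) (differentiableAt_const v)]
  simp [normalProj_apply, tangentProj_proj]
  abel

/-- The curvature is tested on constant coordinate fields, whose bracket vanishes, and on the normal
part of a constant vector. -/
theorem shape_flat (hflat : HasFlatNormalBundle f U) (a b v : V) (hv : tangentProj f x v = 0) :
    shape π f x a (shape π f x b v) = shape π f x b (shape π f x a v) := by
  set u := π (tangentProj f x a)
  set w := π (tangentProj f x b)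
  have h1 := hflat (fun _ => u) (fun _ => w) (fun y => normalProj f y v) contDiffOn_const
    contDiffOn_const (fun y hy => by
      simp only [normalProj_apply]
      exact (contDiffAt_const.sub ((hf.contDiffAt_tangentProj hy).clm_apply
        contDiffAt_const)).contDiffWithinAt)
    (fun y _ => Submodule.starProjection_apply_mem _ v) x hx
  have h2 : VectorField.lieBracket ℝ (fun _ : Eu n => u) (fun _ => w) = fun _ => 0 := by
    ext y : 1
    simp [VectorField.lieBracket]
  rw [normalCurv, hf.normalConn_normalConn hx, hf.normalConn_normalConn hx, h2,
    (((hf.contDiffAt_tangentProj hx).isSymmSndFDerivAt two_le_infty).eq u w)] at h1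
  have h3 : normalConn f (fun _ => 0) (fun y => normalProj f y v) x = 0 := by
    simp [normalConn, ambientDeriv]
  -- `Q` exchanges tangential and normal vectors, so two applications to a normal vector give a
  -- normal vector and the projection in the curvature loses nothing.
  have h4 : ∀ a b : V, tangentProj f x (shape π f x a (shape π f x b v)) = 0 := by
    intro a b
    have e1 := hf.shape_swap hx b v
    rw [hv, map_zero, add_zero] at e1
    have e2 := hf.shape_swap hx a (shape π f x b v)
    rw [e1] at e2
    simpa using e2
  rw [h3] at h1
  have h5 : normalProj f x (shape π f x a (shape π f x b v)) -
      normalProj f x (shape π f x b (shape π f x a v)) = 0 := by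
    rw [← h1]
    simp only [shape, tD_apply]
    abel
  rw [normalProj_apply, normalProj_apply, h4, h4, sub_zero, sub_zero] at h5
  exact sub_eq_zero.1 h5

theorem isFlatShape (hflat : HasFlatNormalBundle f U) :
    IsFlatShape (tangentProj f x) (shape π f x) where
  proj_symm := tangentProj_symm f x
  proj_proj := tangentProj_proj f x
  symm := hf.shape_symm hx
  swap := hf.shape_swap hx
  proj_arg a := tD_proj _ x a
  comm := hf.shape_comm hx
  flat := hf.shape_flat hx hflat

/-- Most fields are derivatives of identities for `Q` that hold in a neighbourhood. The field
`antisymm` is the commutator formula for tangential derivatives applied to `P` itself, and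
`proj_left` holds because `tD` only sees the tangential part of its direction. -/
theorem isShapeDeriv : IsShapeDeriv (tangentProj f x) (shape π f x) (tD π f (shape π f) x) := by
  have hP := hf.differentiableAt_tangentProj hx
  have hS := hf.differentiableAt_shape hx
  have hSa : ∀ a, DifferentiableAt ℝ (fun y => shape π f y a) x := fun a =>
    hS.clm_apply (differentiableAt_const a)
  have hSav : ∀ a v, DifferentiableAt ℝ (fun y => shape π f y a v) x := fun a v =>
    (hSa a).clm_apply (differentiableAt_const v)
  have hPv : ∀ v, DifferentiableAt ℝ (fun y => tangentProj f y v) x := fun v =>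
    hP.clm_apply (differentiableAt_const v)
  have dPv : ∀ d v, tD π f (fun y => tangentProj f y v) x d = shape π f x d v := fun d v =>
    tD_clm_const hP v d
  have dSav : ∀ d a v, tD π f (fun y => shape π f y a v) x d = tD π f (shape π f) x d a v := by
    intro d a v
    rw [tD_clm_const (hSa a), tD_clm_const hS]
  have dSa : ∀ d a, tD π f (fun y => shape π f y a) x d = tD π f (shape π f) x d a := by
    intro d a
    rw [tD_clm_const hS]
  constructor
  · intro d a v w
    have h1 : (fun y => inner ℝ (shape π f y a v) w) =ᶠ[𝓝 x]
        fun y => inner ℝ v (shape π f y a w) :=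
      (hf.eventually_mem hx).mono fun y hy => hf.shape_symm hy a v w
    have h2 := congrArg (fun L => L d) (tD_congr (π := π) (f := f) h1)
    rw [tD_inner (hSav a v) (differentiableAt_const w),
      tD_inner (differentiableAt_const v) (hSav a w), tD_const, tD_const, dSav, dSav] at h2
    simpa using h2
  · intro d a v
    have h1 : (fun y => tangentProj f y (shape π f y a v) + shape π f y a (tangentProj f y v))
        =ᶠ[𝓝 x] fun y => shape π f y a v :=
      (hf.eventually_mem hx).mono fun y hy => hf.shape_swap hy a v
    have h2 := congrArg (fun L => L d) (tD_congr (π := π) (f := f) h1)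
    rw [tD_add (hP.clm_apply (hSav a v)) ((hSa a).clm_apply (hPv v)),
      tD_clm_apply hP (hSav a v), tD_clm_apply (hSa a) (hPv v), dSav, dSa, dPv] at h2
    exact h2
  · intro d a b
    have h1 : (fun y => shape π f y a (tangentProj f y b)) =ᶠ[𝓝 x]
        fun y => shape π f y b (tangentProj f y a) :=
      (hf.eventually_mem hx).mono fun y hy => hf.shape_comm hy a b
    have h2 := congrArg (fun L => L d) (tD_congr (π := π) (f := f) h1)
    rw [tD_clm_apply (hSa a) (hPv b), tD_clm_apply (hSa b) (hPv a), dSa, dSa, dPv, dPv] at h2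
    exact h2
  · intro d a
    exact hf.tD_tD_sub_tD_tD hx (hf.contDiffAt_tangentProj hx) d a
  · intro d
    exact tD_proj _ x d
  · intro d a ha
    have h1 : (fun y => shape π f y (tangentProj f y a)) =ᶠ[𝓝 x] fun y => shape π f y a :=
      Filter.Eventually.of_forall fun y => tD_proj _ y a
    have h2 := congrArg (fun L => L d) (tD_congr (π := π) (f := f) h1)
    rw [tD_clm_apply hS (hPv a), ha, map_zero, zero_add, dSa, dPv] at h2
    exact h2.symm

theorem exists_principalBasis (hflat : HasFlatNormalBundle f U) :
    ∃ (m : ℕ) (b : OrthonormalBasis (Fin n ⊕ Fin m) ℝ V) (lam : Fin n → V),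
      IsPrincipalBasis (tangentProj f x) (shape π f x) b lam :=
  (hf.isFlatShape hx hflat).exists_principalBasis (hf.finrank_range_tangentProj hx)

end IsGraphOver
end Curvature
end FlatNormalGraph



/-! ### Translation of the geometric definitions into derivatives of the projection -/

/-- A double trace over an orthonormal family only depends on the projection onto its span. -/
theorem Orthonormal.sum_sum_inner_eq {V G ι ι' : Type*} [NormedAddCommGroup V]
    [InnerProductSpace ℝ V] [FiniteDimensional ℝ V] [Fintype ι] [Fintype ι'] {P : V →L[ℝ] V}
    {e : ι → V} {e' : ι' → V} (he : Orthonormal ℝ e) (he' : Orthonormal ℝ e')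
    (hP : ∀ v, P v = ∑ j, inner ℝ (e j) v • e j) (hP' : ∀ v, P v = ∑ j, inner ℝ (e' j) v • e' j)
    [AddCommGroup G] [Module ℝ G] (B : V →ₗ[ℝ] V →ₗ[ℝ] G) :
    ∑ j, B (e j) (e j) = ∑ j, B (e' j) (e' j) := by
  rw [← (stdOrthonormalBasis ℝ V).sum_bilin_eq P e he hP,
    ← (stdOrthonormalBasis ℝ V).sum_bilin_eq P e' he' hP']

theorem Orthonormal.sum_inner_eq {V W ι ι' : Type*} [NormedAddCommGroup V]
    [InnerProductSpace ℝ V] [FiniteDimensional ℝ V] [Fintype ι] [Fintype ι'] {P : V →L[ℝ] V}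
    {e : ι → V} {e' : ι' → V} (he : Orthonormal ℝ e) (he' : Orthonormal ℝ e')
    (hP : ∀ v, P v = ∑ j, inner ℝ (e j) v • e j) (hP' : ∀ v, P v = ∑ j, inner ℝ (e' j) v • e' j)
    [NormedAddCommGroup W] [InnerProductSpace ℝ W] (S T : V →L[ℝ] W) :
    ∑ j, inner ℝ (S (e j)) (T (e j)) = ∑ j, inner ℝ (S (e' j)) (T (e' j)) :=
  he.sum_sum_inner_eq he' hP hP'
    (LinearMap.mk₂ ℝ (fun a b => inner ℝ (S a) (T b)) (by simp [inner_add_left])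
      (by simp [inner_smul_left]) (by simp [inner_add_right]) (by simp [inner_smul_right]))

theorem Orthonormal.sum_inner_bilin_eq {V W ι ι' : Type*} [NormedAddCommGroup V]
    [InnerProductSpace ℝ V] [FiniteDimensional ℝ V] [Fintype ι] [Fintype ι'] {P : V →L[ℝ] V}
    {e : ι → V} {e' : ι' → V} (he : Orthonormal ℝ e) (he' : Orthonormal ℝ e')
    (hP : ∀ v, P v = ∑ j, inner ℝ (e j) v • e j) (hP' : ∀ v, P v = ∑ j, inner ℝ (e' j) v • e' j)
    [NormedAddCommGroup W] [InnerProductSpace ℝ W] (S T : V →L[ℝ] V →L[ℝ] W) :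
    ∑ i, ∑ j, inner ℝ (S (e i) (e j)) (T (e i) (e j)) =
      ∑ i, ∑ j, inner ℝ (S (e' i) (e' j)) (T (e' i) (e' j)) := by
  calc _ = ∑ i, ∑ j, inner ℝ (S (e i) (e' j)) (T (e i) (e' j)) :=
        Finset.sum_congr rfl fun i _ => he.sum_inner_eq he' hP hP' (S (e i)) (T (e i))
    _ = ∑ j, ∑ i, inner ℝ (S.flip (e' j) (e i)) (T.flip (e' j) (e i)) := Finset.sum_comm
    _ = ∑ j, ∑ i, inner ℝ (S.flip (e' j) (e' i)) (T.flip (e' j) (e' i)) :=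
        Finset.sum_congr rfl fun j _ => he.sum_inner_eq he' hP hP' (S.flip (e' j)) (T.flip (e' j))
    _ = _ := Finset.sum_comm

namespace FlatNormalGraph

noncomputable section Dictionary

variable {n m : ℕ} {V : Type*} [NormedAddCommGroup V] [InnerProductSpace ℝ V]
  [FiniteDimensional ℝ V] {π : V →L[ℝ] Eu n} {f : Eu n → V} {U : Set (Eu n)} {x : Eu n}

/-- The Hessian `∇∇H`, contracted with tangential vectors. -/
def hessMeanCurv (π : V →L[ℝ] Eu n) (f : Eu n → V) (x : Eu n) : V →L[ℝ] V →L[ℝ] V :=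
  (ContinuousLinearMap.compL ℝ V V V (ContinuousLinearMap.id ℝ V - tangentProj f x)).comp
    (tD π f (tD π f (meanCurv f)) x -
      ((ContinuousLinearMap.compL ℝ V V V).flip (tD π f (meanCurv f) x)).comp (shape π f x))

theorem hessMeanCurv_apply (a b : V) : hessMeanCurv π f x a b =
    (tD π f (tD π f (meanCurv f)) x a b - shape π f x a (tD π f (meanCurv f) x b)) -
      tangentProj f x (tD π f (tD π f (meanCurv f)) x a b -
        shape π f x a (tD π f (meanCurv f) x b)) := rfl

namespace IsGraphOver

variable (hf : IsGraphOver π f U) (hx : x ∈ U)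
include hf hx

theorem linearIndependent_fderiv :
    LinearIndependent ℝ fun i => fderiv ℝ f x (EuclideanSpace.single i 1) := by
  have h := (EuclideanSpace.basisFun (Fin n) ℝ).toBasis.linearIndependent.map'
    (fderiv ℝ f x).toLinearMap (LinearMap.ker_eq_bot.2 (hf.fderiv_injective hx))
  have he : (fun i => fderiv ℝ f x (EuclideanSpace.single i 1)) =
      (fderiv ℝ f x).toLinearMap ∘ (EuclideanSpace.basisFun (Fin n) ℝ).toBasis := by
    funext i
    simp
  rw [he]
  exact h

theorem orthonormal_frame : Orthonormal ℝ (frame f x) :=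
  InnerProductSpace.gramSchmidtNormed_orthonormal (hf.linearIndependent_fderiv hx)

omit hf hx in
theorem span_frame (f : Eu n → V) (x : Eu n) :
    Submodule.span ℝ (Set.range (frame f x)) = tangentSpace f x := by
  rw [frame, InnerProductSpace.span_gramSchmidtNormed_range, InnerProductSpace.span_gramSchmidt,
    tangentSpace]
  have h := (EuclideanSpace.basisFun (Fin n) ℝ).toBasis.span_eq
  rw [← Submodule.map_top, ← h, Submodule.map_span, ← Set.range_comp]
  congr 2
  ext i
  simp

theorem tangentProj_eq_sum_frame (v : V) :
    tangentProj f x v = ∑ i, inner ℝ (frame f x i) v • frame f x i := by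
  have hmem : ∀ i, frame f x i ∈ tangentSpace f x := fun i => by
    rw [← span_frame f x]; exact Submodule.subset_span ⟨i, rfl⟩
  refine Submodule.eq_starProjection_of_mem_of_inner_eq_zero
    (Submodule.sum_mem _ fun i _ => Submodule.smul_mem _ _ (hmem i)) ?_
  intro w hw
  rw [← span_frame f x] at hw
  induction hw using Submodule.span_induction with
  | mem w hw =>
    obtain ⟨j, rfl⟩ := hw
    rw [inner_sub_left, sum_inner]
    simp only [inner_smul_left, orthonormal_iff_ite.1 (hf.orthonormal_frame hx)]
    simp [real_inner_comm]
  | zero => simp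
  | add w w' _ _ h h' => rw [inner_add_right, h, h', add_zero]
  | smul c w _ h => rw [inner_smul_right, h, mul_zero]

theorem tangentProj_frame (i : Fin n) : tangentProj f x (frame f x i) = frame f x i := by
  refine Submodule.starProjection_eq_self_iff.2 ?_
  rw [← span_frame f x]; exact Submodule.subset_span ⟨i, rfl⟩

theorem tangentCoord_eq (v : V) : tangentCoord f x v = π (tangentProj f x v) := by
  have h1 : fderiv ℝ f x (tangentCoord f x v) = tangentProj f x v :=
    Function.invFun_eq ⟨_, hf.fderiv_proj hx v⟩
  rw [← h1, hf.proj_fderiv hx]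

theorem frameCoord_eq (i : Fin n) : frameCoord f x i = π (frame f x i) := by
  rw [frameCoord, hf.tangentCoord_eq hx, hf.tangentProj_frame hx]

theorem fderiv_frameCoord (i : Fin n) : fderiv ℝ f x (frameCoord f x i) = frame f x i := by
  rw [frameCoord, hf.tangentCoord_eq hx, hf.fderiv_proj hx, hf.tangentProj_frame hx]

theorem fderiv_apply_frameCoord {G : Type*} [NormedAddCommGroup G] [NormedSpace ℝ G] (u : Eu n → G)
    (i : Fin n) : fderiv ℝ u x (frameCoord f x i) = tD π f u x (frame f x i) := by
  rw [tD_apply, hf.tangentProj_frame hx, hf.frameCoord_eq hx]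

theorem secondFund_eq (u v : Eu n) :
    secondFund f x u v = fderiv ℝ (tangentProj f) x u (fderiv ℝ f x v) := by
  rw [hf.fderiv_tangentProj_fderiv hx, secondFund, secondFundField, ambientDeriv,
    normalProj_apply, fderiv_clm_apply ((hf.contDiffAt_fderiv hx).differentiableAt (by simp))
      (differentiableAt_const v)]
  simp

theorem secondFund_frame (i j : Fin n) : secondFund f x (frameCoord f x i) (frameCoord f x j) =
    shape π f x (frame f x i) (frame f x j) := by
  rw [hf.secondFund_eq hx, hf.fderiv_frameCoord hx, shape, tD_apply, hf.tangentProj_frame hx,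
    hf.frameCoord_eq hx]

/-- Since `π ∘ df` is the identity, `π` annihilates `D²f`. The coordinates of the tangential part of
`D²f` are therefore minus those of its normal part. -/
theorem leviCivita_eq (u v : Eu n) : leviCivita f (fun _ => u) (fun _ => v) x =
    - π (fderiv ℝ (tangentProj f) x u (fderiv ℝ f x v)) := by
  have hd : DifferentiableAt ℝ (fderiv ℝ f) x :=
    (hf.contDiffAt_fderiv hx).differentiableAt (by simp)
  have h1 : (fun y => π (fderiv ℝ f y v)) =ᶠ[𝓝 x] fun _ => v :=
    (hf.eventually_mem hx).mono fun y hy => hf.proj_fderiv hy v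
  have h2 := congrArg (fun L => L u) (h1.fderiv_eq (𝕜 := ℝ))
  rw [fderiv_clm_apply (differentiableAt_const π) (hd.clm_apply (differentiableAt_const v)),
    fderiv_clm_apply hd (differentiableAt_const v)] at h2
  have h3 : π (fderiv ℝ (fderiv ℝ f) x u v) = 0 := by simpa using h2
  rw [hf.fderiv_tangentProj_fderiv hx, map_sub, h3, zero_sub, neg_neg, leviCivita,
    hf.tangentCoord_eq hx, ambientDeriv, fderiv_clm_apply hd (differentiableAt_const v)]
  simp

section Principal

variable (hflat : HasFlatNormalBundle f U) {b : OrthonormalBasis (Fin n ⊕ Fin m) ℝ V}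
  {lam : Fin n → V} (hb : IsPrincipalBasis (tangentProj f x) (shape π f x) b lam)
include hflat hb

omit hf hx hflat in
theorem orthonormal_inl : Orthonormal ℝ fun i => b (.inl i) :=
  b.orthonormal.comp _ Sum.inl_injective

theorem tangentProj_eq_sum_inl (v : V) :
    tangentProj f x v = ∑ i, inner ℝ (b (.inl i)) v • b (.inl i) :=
  hb.proj_eq_sum (hf.isFlatShape hx hflat) v

theorem sq_normSecondFund : normSecondFund f x ^ 2 = ∑ i, ‖lam i‖ ^ 2 := by
  have h := hf.isFlatShape hx hflat
  rw [normSecondFund, Real.sq_sqrt (by positivity)]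
  simp only [hf.secondFund_frame hx, ← real_inner_self_eq_norm_sq]
  rw [(hf.orthonormal_frame hx).sum_inner_bilin_eq (orthonormal_inl hb)
    (hf.tangentProj_eq_sum_frame hx) (hf.tangentProj_eq_sum_inl hx hflat hb)]
  refine Finset.sum_congr rfl fun i _ => ?_
  rw [Finset.sum_eq_single i]
  · rw [hb.apply_inl_self h]
  · intro j _ hj
    rw [hb.apply_inl_inl h, if_neg hj.symm, inner_zero_left]
  · simp

theorem meanCurv_eq_sum_lam : meanCurv f x = ∑ i, lam i := by
  have h := hf.isFlatShape hx hflat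
  rw [meanCurv]
  simp only [hf.secondFund_frame hx]
  have := (hf.orthonormal_frame hx).sum_sum_inner_eq (orthonormal_inl hb)
    (hf.tangentProj_eq_sum_frame hx) (hf.tangentProj_eq_sum_inl hx hflat hb)
    (LinearMap.mk₂ ℝ (fun a b => shape π f x a b) (by simp) (by simp) (by simp) (by simp))
  simp only [LinearMap.mk₂_apply] at this
  rw [this]
  exact Finset.sum_congr rfl fun i _ => hb.apply_inl_self h i

end Principal

variable (hflat : HasFlatNormalBundle f U)
include hflat

/-- As `Q` only depends on the tangential part of its direction, the tangential trace equals the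
trace over all of `V`. A fixed ambient basis then replaces the moving frame, and `H` is visibly
smooth. -/
theorem meanCurv_eq {ι : Type*} [Fintype ι] (b : OrthonormalBasis ι ℝ V) :
    meanCurv f x = ∑ d, shape π f x (b d) (b d) := by
  have h := hf.isFlatShape hx hflat
  obtain ⟨m, b', lam, hb⟩ := hf.exists_principalBasis hx hflat
  rw [hf.meanCurv_eq_sum_lam hx hflat hb]
  have := b.sum_bilin_eq_sum_bilin b'
    (LinearMap.mk₂ ℝ (fun a b => shape π f x a b) (by simp) (by simp) (by simp) (by simp))
  simp only [LinearMap.mk₂_apply] at this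
  rw [this, Fintype.sum_sum_type]
  simp [hb.apply_inl_self h, hb.apply_inr h]

/-- The factor `2⁻¹` appears because `Q` contains `A` together with its transpose. -/
theorem sq_normSecondFund_eq {ι : Type*} [Fintype ι] (b : OrthonormalBasis ι ℝ V) :
    normSecondFund f x ^ 2 = 2⁻¹ * ∑ a, ∑ c, ‖shape π f x (b a) (b c)‖ ^ 2 := by
  have h := hf.isFlatShape hx hflat
  obtain ⟨m, b', lam, hb⟩ := hf.exists_principalBasis hx hflat
  have h1 := b.orthonormal.sum_inner_bilin_eq b'.orthonormal
    (P := ContinuousLinearMap.id ℝ V) (fun v => (b.sum_repr' v).symm)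
    (fun v => (b'.sum_repr' v).symm) (shape π f x) (shape π f x)
  simp only [real_inner_self_eq_norm_sq] at h1
  rw [h1, hb.sum_norm_sq_apply h, hf.sq_normSecondFund hx hflat hb]
  ring

theorem contDiffAt_meanCurv : ContDiffAt ℝ ∞ (meanCurv f) x := by
  have h1 : meanCurv f =ᶠ[𝓝 x] fun y => ∑ d, shape π f y (stdOrthonormalBasis ℝ V d)
      (stdOrthonormalBasis ℝ V d) :=
    (hf.eventually_mem hx).mono fun y hy => hf.meanCurv_eq hy hflat _
  refine ContDiffAt.congr_of_eventuallyEq ?_ h1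
  exact ContDiffAt.sum fun d _ => ((hf.contDiffAt_shape hx).clm_apply contDiffAt_const).clm_apply
    contDiffAt_const

theorem contDiffAt_sq_normSecondFund : ContDiffAt ℝ ∞ (fun y => normSecondFund f y ^ 2) x := by
  have h1 : (fun y => normSecondFund f y ^ 2) =ᶠ[𝓝 x] fun y => 2⁻¹ * ∑ a, ∑ c,
      ‖shape π f y (stdOrthonormalBasis ℝ V a) (stdOrthonormalBasis ℝ V c)‖ ^ 2 :=
    (hf.eventually_mem hx).mono fun y hy => hf.sq_normSecondFund_eq hy hflat _
  refine ContDiffAt.congr_of_eventuallyEq ?_ h1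
  exact contDiffAt_const.mul (ContDiffAt.sum fun a _ => ContDiffAt.sum fun c _ =>
    (((hf.contDiffAt_shape hx).clm_apply contDiffAt_const).clm_apply
    contDiffAt_const).norm_sq ℝ)

theorem covMeanCurv_eq (u : Eu n) : covMeanCurv f x u =
    fderiv ℝ (meanCurv f) x u - tangentProj f x (fderiv ℝ (meanCurv f) x u) := by
  rw [covMeanCurv, normalConn, ambientDeriv, normalProj_apply]

theorem covMeanCurv_frame (i : Fin n) : covMeanCurv f x (frameCoord f x i) =
    tD π f (meanCurv f) x (frame f x i) - tangentProj f x (tD π f (meanCurv f) x (frame f x i)) := by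
  rw [hf.covMeanCurv_eq hx hflat, hf.fderiv_apply_frameCoord hx]

/-- The derivative of `P` inside `∇^⊥ H = dH - P dH` gives the term with `shape`. The first-order
term of the iterated tangential derivative is exactly the Levi-Civita correction in constant
coordinates. -/
theorem covCovMeanCurv_frame (i j : Fin n) :
    covCovMeanCurv f x (frameCoord f x i) (frameCoord f x j) =
      hessMeanCurv π f x (frame f x i) (frame f x j) := by
  set u := frameCoord f x i with hu
  set v := frameCoord f x j with hv
  have hP := hf.differentiableAt_tangentProj hx
  have hH := hf.contDiffAt_meanCurv hx hflat
  have hdH : DifferentiableAt ℝ (fderiv ℝ (meanCurv f)) x :=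
    (hH.fderiv_right (m := ∞) (by simp)).differentiableAt (by simp)
  have hdv := hdH.clm_apply (differentiableAt_const v)
  have h1 : (fun y => covMeanCurv f y v) =ᶠ[𝓝 x] fun y => fderiv ℝ (meanCurv f) y v -
      tangentProj f y (fderiv ℝ (meanCurv f) y v) :=
    (hf.eventually_mem hx).mono fun y hy => hf.covMeanCurv_eq hy hflat v
  have h2 : tD π f (tD π f (meanCurv f)) x (frame f x i) (frame f x j) =
      fderiv ℝ (fderiv ℝ (meanCurv f)) x u v + fderiv ℝ (meanCurv f) x
        (π (shape π f x (frame f x i) (frame f x j))) := by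
    have h0 : DifferentiableAt ℝ (fun y => π.comp (tangentProj f y)) x :=
      (differentiableAt_const π).clm_comp hP
    change tD π f (fun y => (fderiv ℝ (meanCurv f) y).comp (π.comp (tangentProj f y))) x _ _ = _
    rw [tD_clm_comp hdH h0, tD_clm_comp (differentiableAt_const π) hP, tD_const]
    simp [tD_apply, shape, hf.tangentProj_frame hx, hu, hv, hf.frameCoord_eq hx]
  rw [covCovMeanCurv, normalConn, ambientDeriv, normalProj_apply, h1.fderiv_eq,
    fderiv_fun_sub hdv (hP.clm_apply hdv), fderiv_clm_apply hP hdv,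
    fderiv_clm_apply hdH (differentiableAt_const v), hf.leviCivita_eq hx,
    hf.covMeanCurv_eq hx hflat, hessMeanCurv_apply, h2]
  have h3 : fderiv ℝ (tangentProj f) x u (fderiv ℝ f x v) =
      shape π f x (frame f x i) (frame f x j) := by
    rw [← hf.secondFund_eq hx, hu, hv, hf.secondFund_frame hx]
  have h4 : fderiv ℝ (tangentProj f) x u = shape π f x (frame f x i) := by
    rw [hu, hf.fderiv_apply_frameCoord hx]; rfl
  have h5 : fderiv ℝ (meanCurv f) x v = tD π f (meanCurv f) x (frame f x j) := by
    rw [hv, hf.fderiv_apply_frameCoord hx]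
  rw [h3]
  simp [h4, h5, tangentProj_proj]
  abel

variable {b : OrthonormalBasis (Fin n ⊕ Fin m) ℝ V}
  {lam : Fin n → V} (hb : IsPrincipalBasis (tangentProj f x) (shape π f x) b lam)

theorem sum_inner_covCovMeanCurv (hb : IsPrincipalBasis (tangentProj f x) (shape π f x) b lam) :
    ∑ i, ∑ j, inner ℝ (secondFund f x (frameCoord f x i) (frameCoord f x j))
        (covCovMeanCurv f x (frameCoord f x i) (frameCoord f x j)) =
      ∑ i, inner ℝ (lam i) (tD π f (tD π f (meanCurv f)) x (b (.inl i)) (b (.inl i)) -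
        shape π f x (b (.inl i)) (tD π f (meanCurv f) x (b (.inl i)))) := by
  have h := hf.isFlatShape hx hflat
  simp only [hf.secondFund_frame hx, hf.covCovMeanCurv_frame hx hflat]
  rw [(hf.orthonormal_frame hx).sum_inner_bilin_eq (orthonormal_inl hb)
    (hf.tangentProj_eq_sum_frame hx) (hf.tangentProj_eq_sum_inl hx hflat hb)]
  refine Finset.sum_congr rfl fun i _ => ?_
  rw [Finset.sum_eq_single i]
  · rw [hb.apply_inl_self h, hessMeanCurv_apply, inner_sub_right, ← tangentProj_symm, hb.proj_lam,
      inner_zero_left, sub_zero]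
  · intro j _ hj
    rw [hb.apply_inl_inl h, if_neg hj.symm, inner_zero_left]
  · simp

theorem sq_normCovMeanCurv (hb : IsPrincipalBasis (tangentProj f x) (shape π f x) b lam) :
    normCovMeanCurv f x ^ 2 = ∑ i, ‖tD π f (meanCurv f) x (b (.inl i)) -
      tangentProj f x (tD π f (meanCurv f) x (b (.inl i)))‖ ^ 2 := by
  rw [normCovMeanCurv, Real.sq_sqrt (by positivity)]
  simp only [hf.covMeanCurv_frame hx hflat, ← real_inner_self_eq_norm_sq]
  exact (hf.orthonormal_frame hx).sum_inner_eq (orthonormal_inl hb)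
    (hf.tangentProj_eq_sum_frame hx) (hf.tangentProj_eq_sum_inl hx hflat hb)
    (tD π f (meanCurv f) x - (tangentProj f x).comp (tD π f (meanCurv f) x))
    (tD π f (meanCurv f) x - (tangentProj f x).comp (tD π f (meanCurv f) x))

theorem sq_normGrad {ι : Type*} [Fintype ι] (b : OrthonormalBasis ι ℝ V) (φ : Eu n → ℝ) :
    normGrad f φ x ^ 2 = ∑ d, tD π f φ x (b d) ^ 2 := by
  rw [normGrad, Real.sq_sqrt (by positivity)]
  simp only [hf.fderiv_apply_frameCoord hx]
  have h1 := b.sum_bilin_eq (tangentProj f x) (frame f x) (hf.orthonormal_frame hx)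
    (hf.tangentProj_eq_sum_frame hx)
    (LinearMap.mk₂ ℝ (fun a b => tD π f φ x a * tD π f φ x b) (by simp [add_mul])
      (by simp [mul_assoc]) (by simp [mul_add]) (by simp [mul_left_comm]))
  simp only [LinearMap.mk₂_apply, tD_proj] at h1
  simp only [sq]
  exact h1.symm

end IsGraphOver
end Dictionary
end FlatNormalGraph



/-! ### Simons' identity -/

namespace FlatNormalGraph

noncomputable section Simons

variable {n m : ℕ} {V : Type*} [NormedAddCommGroup V] [InnerProductSpace ℝ V]
  [FiniteDimensional ℝ V] {π : V →L[ℝ] Eu n} {f : Eu n → V} {U : Set (Eu n)} {x : Eu n}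

namespace IsGraphOver

variable (hf : IsGraphOver π f U) (hx : x ∈ U)
include hf hx

theorem differentiableAt_tD_shape : DifferentiableAt ℝ (tD π f (shape π f)) x :=
  hf.differentiableAt_tD hx (hf.contDiffAt_shape hx)

theorem tD_shape_apply (d a v : V) :
    tD π f (fun y => shape π f y a v) x d = tD π f (shape π f) x d a v := by
  rw [tD_clm_const ((hf.differentiableAt_shape hx).clm_apply (differentiableAt_const a)),
    tD_clm_const (hf.differentiableAt_shape hx)]

theorem tD_tD_shape_apply (c d a v : V) : tD π f (fun y => tD π f (shape π f) y d a v) x c =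
    tD π f (tD π f (shape π f)) x c d a v := by
  have h := hf.differentiableAt_tD_shape hx
  have h1 := h.clm_apply (differentiableAt_const d)
  rw [tD_clm_const (h1.clm_apply (differentiableAt_const a)), tD_clm_const h1, tD_clm_const h]

theorem tD_tD_shape_symm (c d a v w : V) :
    inner ℝ (tD π f (tD π f (shape π f)) x c d a v) w =
      inner ℝ v (tD π f (tD π f (shape π f)) x c d a w) := by
  have h := hf.differentiableAt_tD_shape hx
  have h1 : ∀ v, DifferentiableAt ℝ (fun y => tD π f (shape π f) y d a v) x := fun v =>
    ((h.clm_apply (differentiableAt_const d)).clm_apply (differentiableAt_const a)).clm_apply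
      (differentiableAt_const v)
  have h2 : (fun y => inner ℝ (tD π f (shape π f) y d a v) w) =ᶠ[𝓝 x]
      fun y => inner ℝ v (tD π f (shape π f) y d a w) :=
    (hf.eventually_mem hx).mono fun y hy => (hf.isShapeDeriv hy).symm d a v w
  have h3 := congrArg (fun L => L c) (tD_congr (π := π) (f := f) h2)
  rw [tD_inner (h1 v) (differentiableAt_const w), tD_inner (differentiableAt_const v) (h1 w),
    tD_const, tD_const, hf.tD_tD_shape_apply hx, hf.tD_tD_shape_apply hx] at h3
  simpa using h3

variable (hflat : HasFlatNormalBundle f U)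
include hflat

theorem tD_meanCurv {ι : Type*} [Fintype ι] (b : OrthonormalBasis ι ℝ V) (c : V) :
    tD π f (meanCurv f) x c = ∑ d, tD π f (shape π f) x c (b d) (b d) := by
  have h1 : meanCurv f =ᶠ[𝓝 x] fun y => ∑ d, shape π f y (b d) (b d) :=
    (hf.eventually_mem hx).mono fun y hy => hf.meanCurv_eq hy hflat _
  rw [tD_congr h1, tD_sum fun d _ => ((hf.differentiableAt_shape hx).clm_apply
    (differentiableAt_const _)).clm_apply (differentiableAt_const _)]
  exact Finset.sum_congr rfl fun d _ => hf.tD_shape_apply hx c _ _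

variable {b : OrthonormalBasis (Fin n ⊕ Fin m) ℝ V} {lam : Fin n → V}

/-- This is the traced Codazzi equation. The normal directions of the ambient trace contribute only
tangential vectors, so they drop out of the normal part. -/
theorem normal_tD_meanCurv (hb : IsPrincipalBasis (tangentProj f x) (shape π f x) b lam)
    (j : Fin n) :
    tD π f (meanCurv f) x (b (.inl j)) - tangentProj f x (tD π f (meanCurv f) x (b (.inl j))) =
      ∑ k, IsPrincipalBasis.covShape (tangentProj f x) (tD π f (shape π f) x) b k k j := by
  have h := hf.isFlatShape hx hflat
  have hR := hf.isShapeDeriv hx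
  rw [hf.tD_meanCurv hx hflat b, Fintype.sum_sum_type, map_add, map_sum, map_sum]
  have h1 : ∀ α, tangentProj f x (tD π f (shape π f) x (b (.inl j)) (b (.inr α)) (b (.inr α))) =
      tD π f (shape π f) x (b (.inl j)) (b (.inr α)) (b (.inr α)) := by
    intro α
    rw [hb.deriv_inr h hR, smul_apply, hb.apply_inl_normal h j (hb.proj_inr α),
      map_smul, map_smul, hb.proj_inl]
  simp only [h1, add_sub_add_right_eq_sub, ← Finset.sum_sub_distrib]
  refine Finset.sum_congr rfl fun k _ => ?_
  rw [hb.covShape_swap_right h hR k k j, hb.covShape_swap_left h hR k j k]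
  rfl

/-- The normal part of the Laplacian of the tangential projection is the gradient of the mean
curvature. -/
theorem normal_laplacian {ι : Type*} [Fintype ι] (b : OrthonormalBasis ι ℝ V) (c : V) :
    (∑ d, tD π f (shape π f) x (b d) (b d) (tangentProj f x c)) -
      tangentProj f x (∑ d, tD π f (shape π f) x (b d) (b d) (tangentProj f x c)) =
    tD π f (meanCurv f) x c - tangentProj f x (tD π f (meanCurv f) x c) := by
  have h := hf.isFlatShape hx hflat
  have hR := hf.isShapeDeriv hx
  obtain ⟨m, b', lam, hb⟩ := hf.exists_principalBasis hx hflat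
  have h1 : ∑ d, tD π f (shape π f) x (b d) (b d) = ∑ d, tD π f (shape π f) x (b' d) (b' d) :=
    b.sum_bilin_eq_sum_bilin b' (LinearMap.mk₂ ℝ (fun a b => tD π f (shape π f) x a b) (by simp)
      (by simp) (by simp) (by simp))
  rw [← tD_proj (meanCurv f) x c, ← sum_apply, h1,
    hf.tangentProj_eq_sum_inl hx hflat hb c, sum_apply]
  simp only [map_sum, map_smul, ← Finset.sum_sub_distrib, ← smul_sub]
  rw [Finset.sum_comm]
  refine Finset.sum_congr rfl fun j _ => ?_
  rw [← Finset.smul_sum, hf.normal_tD_meanCurv hx hflat hb, Fintype.sum_sum_type]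
  congr 1
  simp only [hb.deriv_inr_left h hR, zero_apply, map_zero, sub_zero, Finset.sum_const_zero,
    add_zero]
  rfl

/-- The derivative of the Laplacian of the tangential projection, contracted with the second
fundamental form. -/
theorem inner_tD_laplacian (hb : IsPrincipalBasis (tangentProj f x) (shape π f x) b lam)
    (i : Fin n) :
    inner ℝ (lam i) (∑ d, tD π f (tD π f (shape π f)) x (b (.inl i)) (b d) (b d) (b (.inl i))) =
      inner ℝ (lam i) (tD π f (tD π f (meanCurv f)) x (b (.inl i)) (b (.inl i)) -
        shape π f x (b (.inl i)) (tD π f (meanCurv f) x (b (.inl i)))) -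
        2 * (‖lam i‖ ^ 2) ^ 2 - 2 * ∑ k, inner ℝ (lam k) (lam i) ^ 2 := by
  have h := hf.isFlatShape hx hflat
  have hR := hf.isShapeDeriv hx
  set c := b (.inl i) with hc
  have hP := hf.differentiableAt_tangentProj hx
  have hPc := hP.clm_apply (differentiableAt_const c)
  have hT := hf.differentiableAt_tD_shape hx
  have hTd : ∀ d, DifferentiableAt ℝ (fun y => tD π f (shape π f) y (b d) (b d)) x := fun d =>
    (hT.clm_apply (differentiableAt_const _)).clm_apply (differentiableAt_const _)
  have hm : ∀ d, DifferentiableAt ℝ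
      (fun y => tD π f (shape π f) y (b d) (b d) (tangentProj f y c)) x := fun d =>
    (hTd d).clm_apply hPc
  have hms : DifferentiableAt ℝ
      (fun y => ∑ d, tD π f (shape π f) y (b d) (b d) (tangentProj f y c)) x :=
    DifferentiableAt.fun_sum fun d _ => hm d
  have hH := hf.differentiableAt_tD hx (hf.contDiffAt_meanCurv hx hflat)
  have hHc := hH.clm_apply (differentiableAt_const c)
  -- `normal_laplacian` holds near `x` with `c` frozen, so it can be differentiated in direction
  -- `c`. Pairing with the normal vector `lam i` then removes every term in the range of `P`.
  have h1 : (fun y => (∑ d, tD π f (shape π f) y (b d) (b d) (tangentProj f y c)) -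
      tangentProj f y (∑ d, tD π f (shape π f) y (b d) (b d) (tangentProj f y c))) =ᶠ[𝓝 x]
      fun y => tD π f (meanCurv f) y c - tangentProj f y (tD π f (meanCurv f) y c) :=
    (hf.eventually_mem hx).mono fun y hy => hf.normal_laplacian hy hflat b c
  have h2 := congrArg (fun L => inner ℝ (lam i) (L c)) (tD_congr (π := π) (f := f) h1)
  have hl : ∀ v, inner ℝ (lam i) (tangentProj f x v) = (0 : ℝ) := fun v => by
    rw [← tangentProj_symm, hb.proj_lam, inner_zero_left]
  have h3 : tD π f (fun y => ∑ d, tD π f (shape π f) y (b d) (b d) (tangentProj f y c)) x c =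
      (∑ d, tD π f (tD π f (shape π f)) x c (b d) (b d) c) +
        ∑ d, tD π f (shape π f) x (b d) (b d) (lam i) := by
    rw [tD_sum fun d _ => hm d, ← Finset.sum_add_distrib]
    refine Finset.sum_congr rfl fun d _ => ?_
    rw [tD_clm_apply (hTd d) hPc, tD_clm_const (hT.clm_apply (differentiableAt_const _)),
      tD_clm_const hT, tD_clm_const hP, hc, hb.proj_inl]
    congr 2
    exact hb.apply_inl_self h i
  have h4 : ∑ d, tD π f (shape π f) x (b d) (b d) (tangentProj f x c) =
      ∑ k, tD π f (shape π f) x (b (.inl k)) (b (.inl k)) c := by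
    rw [Fintype.sum_sum_type, hc, hb.proj_inl]
    simp [hb.deriv_inr_left h hR]
  -- This quartic term arises where the derivative falls on the outer projection, and `h6` below
  -- treats the one where it falls on `P c`, whose derivative is `lam i`.
  have h5 : inner ℝ (lam i) (shape π f x c
      (∑ k, tD π f (shape π f) x (b (.inl k)) (b (.inl k)) c)) = -2 * (‖lam i‖ ^ 2) ^ 2 := by
    have e1 : ∀ v, inner ℝ (lam i) (shape π f x c v) =
        inner ℝ (lam i) (lam i) * inner ℝ c (tangentProj f x v) := by
      intro v
      rw [← h.symm, hc, hb.apply_inl_lam h, inner_smul_left, ← tangentProj_symm, hb.proj_inl]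
      simp
    rw [e1, map_sum, inner_sum, Finset.sum_eq_single i]
    · rw [hc, hb.proj_deriv h hR, inner_neg_right, inner_smul_right, inner_add_right,
        if_pos rfl, IsPrincipalBasis.inner_inl_inl, if_pos rfl, real_inner_self_eq_norm_sq]
      ring
    · intro k _ hk
      rw [hc, hb.proj_deriv h hR, if_neg hk]
      simp
    · simp
  have h6 : inner ℝ (lam i) (∑ d, tD π f (shape π f) x (b d) (b d) (lam i)) =
      2 * ∑ k, inner ℝ (lam k) (lam i) ^ 2 := by
    rw [Fintype.sum_sum_type]
    simp only [hb.deriv_inr_left h hR, zero_apply, Finset.sum_const_zero, add_zero]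
    rw [inner_sum, Finset.mul_sum]
    refine Finset.sum_congr rfl fun k _ => ?_
    have e1 := hb.deriv_normal h hR k k (hb.proj_lam i)
    rw [if_pos rfl, sub_eq_iff_eq_add] at e1
    rw [e1, inner_add_right, hl, inner_smul_right, real_inner_comm (lam k) (lam i)]
    ring
  rw [tD_sub hms (hP.clm_apply hms), tD_clm_apply hP hms, tD_sub hHc (hP.clm_apply hHc),
    tD_clm_apply hP hHc, tD_clm_const hH, h3, h4] at h2
  simp only [inner_sub_right, inner_add_right, hl, h6, add_zero] at h2
  rw [inner_sub_right]
  change _ - inner ℝ (lam i) (shape π f x c _) = _ - inner ℝ (lam i) (shape π f x c _) at h2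
  rw [h5] at h2
  linarith

/-- The derivative `c` is moved outwards past `∂_k ∂_k`, which reduces the Laplacian of `Q` to the
derivative of the Laplacian of `P`. The commutator terms are quadratic in `A` times `Q`; tracing
them produces `⟨H, lam i⟩ |lam i|²` and the quartic corrections. -/
theorem inner_laplacian_shape (hb : IsPrincipalBasis (tangentProj f x) (shape π f x) b lam)
    (i : Fin n) :
    inner ℝ (lam i) (∑ d, tD π f (tD π f (shape π f)) x (b d) (b d) (b (.inl i)) (b (.inl i))) =
      inner ℝ (lam i) (tD π f (tD π f (meanCurv f)) x (b (.inl i)) (b (.inl i)) -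
        shape π f x (b (.inl i)) (tD π f (meanCurv f) x (b (.inl i)))) +
        inner ℝ (meanCurv f x) (lam i) * ‖lam i‖ ^ 2
        - 4 * (‖lam i‖ ^ 2) ^ 2 - 2 * ∑ k, inner ℝ (lam k) (lam i) ^ 2 := by
  have h := hf.isFlatShape hx hflat
  have hR := hf.isShapeDeriv hx
  set c := b (.inl i) with hc
  have hS := hf.differentiableAt_shape hx
  have hT := hf.differentiableAt_tD_shape hx
  have hα : ∀ α, tD π f (tD π f (shape π f)) x (b (.inr α)) = 0 := by
    intro α
    rw [← tD_proj, hb.proj_inr, map_zero]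
  have hs0 : ∀ k, shape π f x (b (.inl k)) c - shape π f x c (b (.inl k)) = 0 := by
    intro k
    rw [hc, hb.apply_inl_inl h, hb.apply_inl_inl h]
    by_cases hki : k = i
    · subst hki; simp
    · simp [hki, Ne.symm hki]
  -- interchange of the derivatives in tangential directions
  have hk : ∀ k, tD π f (tD π f (shape π f)) x (b (.inl k)) (b (.inl k)) c =
      tD π f (tD π f (shape π f)) x c (b (.inl k)) (b (.inl k)) +
        shape π f x (tD π f (shape π f) x (b (.inl k)) (b (.inl k)) c -
          tD π f (shape π f) x (b (.inl k)) c (b (.inl k))) := by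
    intro k
    set e := b (.inl k) with he
    have e1 := hf.tD_tD_sub_tD_tD hx (hf.contDiffAt_shape hx) e c
    rw [hs0, map_zero, sub_eq_zero] at e1
    have hSe : ∀ a v, DifferentiableAt ℝ (fun y => shape π f y a v) x := fun a v =>
      (hS.clm_apply (differentiableAt_const a)).clm_apply (differentiableAt_const v)
    have e2 : (fun y => tD π f (shape π f) y e c) =ᶠ[𝓝 x] fun y => tD π f (shape π f) y c e +
        shape π f y (shape π f y e c - shape π f y c e) :=
      (hf.eventually_mem hx).mono fun y hy => by
        change _ = _ + shape π f y (shape π f y e c - shape π f y c e)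
        rw [← (hf.isShapeDeriv hy).antisymm e c]
        abel
    have e3 := congrArg (fun L => L e) (tD_congr (π := π) (f := f) e2)
    have hTe : ∀ e, DifferentiableAt ℝ (fun y => tD π f (shape π f) y e) x := fun e =>
      hT.clm_apply (differentiableAt_const e)
    have hds := (hSe e c).fun_sub (hSe c e)
    rw [tD_clm_const (hTe e), tD_clm_const hT,
      tD_add ((hTe c).clm_apply (differentiableAt_const e)) (hS.clm_apply hds),
      tD_clm_const (hTe c), tD_clm_const hT, tD_clm_apply hS hds, tD_sub (hSe e c) (hSe c e),
      hf.tD_shape_apply hx, hf.tD_shape_apply hx, hs0, map_zero, zero_add, e1] at e3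
    rw [← e3]
  -- The ambient Laplacian also sums over normal indices. A second derivative with a normal inner
  -- direction does not vanish, and together these terms give `|lam i|² lam i`.
  have hM : ∑ k, tD π f (tD π f (shape π f)) x c (b (.inl k)) (b (.inl k)) c =
      (∑ d, tD π f (tD π f (shape π f)) x c (b d) (b d) c) - ‖lam i‖ ^ 2 • lam i := by
    have e1 : ∀ α, tD π f (tD π f (shape π f)) x c (b (.inr α)) (b (.inr α)) c =
        (inner ℝ (lam i) (b (.inr α)) * inner ℝ (b (.inr α)) (lam i)) • lam i := by
      intro α
      have e2 := hf.tD_tD_sub_tD_tD hx (hf.contDiffAt_shape hx) c (b (.inr α))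
      rw [hα, zero_apply, sub_zero, hb.apply_inr h, zero_apply, sub_zero, hc,
        hb.apply_inl_normal h i (hb.proj_inr α), map_smul] at e2
      rw [hc, e2, smul_apply, smul_apply, hb.deriv_inr h hR, smul_apply, hb.apply_inl_self h,
        smul_smul, real_inner_comm (lam i)]
    rw [Fintype.sum_sum_type]
    simp only [e1]
    rw [← Finset.sum_smul, hb.sum_inr_inner_mul h (hb.proj_lam i), real_inner_self_eq_norm_sq]
    abel
  -- Only the tangential part of the direction enters `Q`, and `proj_deriv` computes it without
  -- third derivatives of the parametrization.
  have hQ : ∀ k, inner ℝ (lam i) (shape π f x (tD π f (shape π f) x (b (.inl k)) (b (.inl k)) c -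
      tD π f (shape π f) x (b (.inl k)) c (b (.inl k))) c) =
      inner ℝ (lam k) (lam i) * ‖lam i‖ ^ 2 - if k = i then (‖lam i‖ ^ 2) ^ 2 else 0 := by
    intro k
    set v := tD π f (shape π f) x (b (.inl k)) (b (.inl k)) c -
      tD π f (shape π f) x (b (.inl k)) c (b (.inl k)) with hv
    have e1 : tangentProj f x v =
        (inner ℝ (lam k) (lam i) - if k = i then ‖lam i‖ ^ 2 else 0) • c := by
      rw [hv, map_sub, hc, hb.proj_deriv h hR, hb.proj_deriv h hR]
      by_cases hki : k = i
      · subst hki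
        simp only [if_true, real_inner_self_eq_norm_sq, sub_self, zero_smul]
      · simp [hki, Ne.symm hki]
    rw [← h.proj_arg, e1, map_smul, smul_apply, hc, hb.apply_inl_self h, inner_smul_right,
      real_inner_self_eq_norm_sq]
    split_ifs <;> ring
  rw [Fintype.sum_sum_type]
  simp only [hα, zero_apply, Finset.sum_const_zero, add_zero, hk, add_apply,
    Finset.sum_add_distrib]
  rw [hM, inner_add_right, inner_sub_right, hf.inner_tD_laplacian hx hflat hb i, inner_smul_right,
    real_inner_self_eq_norm_sq, inner_sum]
  simp only [hQ, Finset.sum_sub_distrib, ← Finset.sum_mul]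
  rw [hf.meanCurv_eq_sum_lam hx hflat hb, sum_inner]
  simp only [Finset.sum_ite_eq', Finset.mem_univ, if_true]
  ring

/-- The tangential derivative of `|A|²`. -/
theorem tD_sq_normSecondFund {ι : Type*} [Fintype ι] (b : OrthonormalBasis ι ℝ V) (d : V) :
    tD π f (fun y => normSecondFund f y ^ 2) x d =
      ∑ a, ∑ c, inner ℝ (shape π f x (b a) (b c)) (tD π f (shape π f) x d (b a) (b c)) := by
  have hS : ∀ a v, DifferentiableAt ℝ (fun y => shape π f y a v) x := fun a v =>
    ((hf.differentiableAt_shape hx).clm_apply (differentiableAt_const a)).clm_apply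
      (differentiableAt_const v)
  have h1 : (fun y => normSecondFund f y ^ 2) =ᶠ[𝓝 x] fun y => (2⁻¹ : ℝ) • ∑ a, ∑ c,
      inner ℝ (shape π f y (b a) (b c)) (shape π f y (b a) (b c)) :=
    (hf.eventually_mem hx).mono fun y hy => by
      simp only [hf.sq_normSecondFund_eq hy hflat b, real_inner_self_eq_norm_sq, smul_eq_mul]
  have h2 : ∀ a c, DifferentiableAt ℝ
      (fun y => (inner ℝ (shape π f y (b a) (b c)) (shape π f y (b a) (b c)) : ℝ)) x := fun a c =>
    (hS _ _).inner ℝ (hS _ _)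
  have h3 : ∀ a, DifferentiableAt ℝ
      (fun y => ∑ c, (inner ℝ (shape π f y (b a) (b c)) (shape π f y (b a) (b c)) : ℝ)) x :=
    fun a => DifferentiableAt.fun_sum fun c _ => h2 a c
  rw [tD_congr h1, tD_smul (differentiableAt_const _) (DifferentiableAt.fun_sum fun a _ => h3 a),
    tD_const, zero_apply, zero_smul, zero_add, tD_sum fun a _ => h3 a, Finset.smul_sum]
  refine Finset.sum_congr rfl fun a _ => ?_
  rw [tD_sum fun c _ => h2 a c, Finset.smul_sum]
  refine Finset.sum_congr rfl fun c _ => ?_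
  rw [tD_inner (hS _ _) (hS _ _), hf.tD_shape_apply hx, real_inner_comm, smul_eq_mul]
  ring

theorem tD_sq_normSecondFund_inl (hb : IsPrincipalBasis (tangentProj f x) (shape π f x) b lam)
    (k : Fin n) : tD π f (fun y => normSecondFund f y ^ 2) x (b (.inl k)) =
      2 * ∑ i, inner ℝ (lam i)
        (IsPrincipalBasis.covShape (tangentProj f x) (tD π f (shape π f) x) b k i i) := by
  have h := hf.isFlatShape hx hflat
  have hR := hf.isShapeDeriv hx
  rw [hf.tD_sq_normSecondFund hx hflat b, hb.sum_inner_apply h _ fun i v w => hR.symm _ _ v w]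
  congr 1
  exact Finset.sum_congr rfl fun i _ => hb.inner_lam_deriv h hR i k i i

/-- **Simons' identity** for a submanifold with flat normal bundle. -/
theorem laplacian_sq_normSecondFund
    (hb : IsPrincipalBasis (tangentProj f x) (shape π f x) b lam) :
    2⁻¹ * ∑ d, tD π f (tD π f (fun y => normSecondFund f y ^ 2)) x (b d) (b d) =
      ∑ k, ∑ i, ∑ j, ‖IsPrincipalBasis.covShape (tangentProj f x)
        (tD π f (shape π f) x) b k i j‖ ^ 2 +
      ∑ i, ∑ j, inner ℝ (secondFund f x (frameCoord f x i) (frameCoord f x j))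
        (covCovMeanCurv f x (frameCoord f x i) (frameCoord f x j)) +
      ∑ i, inner ℝ (meanCurv f x) (lam i) * ‖lam i‖ ^ 2 -
      ∑ k, ∑ i, inner ℝ (lam k) (lam i) ^ 2 := by
  have h := hf.isFlatShape hx hflat
  have hR := hf.isShapeDeriv hx
  have hT := hf.differentiableAt_tD_shape hx
  have hS : ∀ a v, DifferentiableAt ℝ (fun y => shape π f y a v) x := fun a v =>
    ((hf.differentiableAt_shape hx).clm_apply (differentiableAt_const a)).clm_apply
      (differentiableAt_const v)
  have hTd : ∀ d a v, DifferentiableAt ℝ (fun y => tD π f (shape π f) y d a v) x := fun d a v =>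
    ((hT.clm_apply (differentiableAt_const d)).clm_apply (differentiableAt_const a)).clm_apply
      (differentiableAt_const v)
  have h1 : ∀ d, tD π f (tD π f (fun y => normSecondFund f y ^ 2)) x d d =
      ∑ a, ∑ c, (‖tD π f (shape π f) x d (b a) (b c)‖ ^ 2 +
        inner ℝ (shape π f x (b a) (b c))
          (tD π f (tD π f (shape π f)) x d d (b a) (b c))) := by
    intro d
    have e1 : (fun y => tD π f (fun y => normSecondFund f y ^ 2) y d) =ᶠ[𝓝 x] fun y =>
        ∑ a, ∑ c, inner ℝ (shape π f y (b a) (b c)) (tD π f (shape π f) y d (b a) (b c)) :=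
      (hf.eventually_mem hx).mono fun y hy => hf.tD_sq_normSecondFund hy hflat b d
    have e2 : ∀ a c, DifferentiableAt ℝ (fun y => (inner ℝ (shape π f y (b a) (b c))
        (tD π f (shape π f) y d (b a) (b c)) : ℝ)) x := fun a c =>
      (hS _ _).inner ℝ (hTd _ _ _)
    have e3 : ∀ a, DifferentiableAt ℝ (fun y => ∑ c, (inner ℝ (shape π f y (b a) (b c))
        (tD π f (shape π f) y d (b a) (b c)) : ℝ)) x := fun a =>
      DifferentiableAt.fun_sum fun c _ => e2 a c
    rw [← tD_clm_const (hf.differentiableAt_tD hx (hf.contDiffAt_sq_normSecondFund hx hflat)),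
      tD_congr e1, tD_sum fun a _ => e3 a]
    refine Finset.sum_congr rfl fun a _ => ?_
    rw [tD_sum fun c _ => e2 a c]
    refine Finset.sum_congr rfl fun c _ => ?_
    rw [tD_inner (hS _ _) (hTd _ _ _), hf.tD_shape_apply hx, hf.tD_tD_shape_apply hx,
      real_inner_self_eq_norm_sq]
  have h2 : ∑ d, ∑ a, ∑ c, inner ℝ (shape π f x (b a) (b c))
      (tD π f (tD π f (shape π f)) x (b d) (b d) (b a) (b c)) =
      2 * ∑ i, inner ℝ (lam i)
        (∑ d, tD π f (tD π f (shape π f)) x (b d) (b d) (b (.inl i)) (b (.inl i))) := by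
    have e1 := hb.sum_inner_apply h
      (fun a => ∑ d, tD π f (tD π f (shape π f)) x (b d) (b d) a) (by
        intro i v w
        simp only [sum_apply, sum_inner, inner_sum, hf.tD_tD_shape_symm hx _ _ _ v w])
    simp only [sum_apply, inner_sum] at e1 ⊢
    rw [← e1, Finset.sum_comm]
    exact Finset.sum_congr rfl fun a _ => Finset.sum_comm
  -- The quartic terms of `|R|²` cancel `-4 Σ |lam i|⁴` and one of the two copies of `-Σ ⟨lam k, lam
  -- i⟩²`.
  simp only [h1, Finset.sum_add_distrib]
  rw [h2, hb.sum_norm_sq_deriv h hR, hf.sum_inner_covCovMeanCurv hx hflat hb]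
  simp only [hf.inner_laplacian_shape hx hflat hb, Finset.sum_add_distrib, Finset.sum_sub_distrib,
    ← Finset.mul_sum]
  rw [Finset.sum_comm (f := fun i k => inner ℝ (lam k) (lam i) ^ 2)]
  ring

end IsGraphOver
end Simons
end FlatNormalGraph



/-! ### The improved Kato inequality -/

namespace FlatNormalGraph

section Kato

/-- A Kato-type inequality for totally symmetric vector-valued 3-tensors. -/
theorem exists_kato_constant (n : ℕ) (κ : ℝ) (hκ0 : 0 ≤ κ) (hκ : κ * n < 2) :
    ∃ C : ℝ, 0 ≤ C ∧ ∀ (W : Type*) [NormedAddCommGroup W] [InnerProductSpace ℝ W]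
      (h : Fin n → Fin n → Fin n → W), (∀ k i j, h k i j = h i k j) → (∀ k i j, h k i j = h k j i) →
      (1 + κ) * ∑ k, ∑ i, ‖h k i i‖ ^ 2 ≤
        ∑ k, ∑ i, ∑ j, ‖h k i j‖ ^ 2 + C * ∑ j, ‖∑ k, h k k j‖ ^ 2 := by
  -- The choice gives `τ (κ n + 1) = 2 - κ n`, just enough for `κ (1 + (1 + τ)(n - 1)) ≤ 2` in `hs`.
  set τ : ℝ := (2 - κ * n) / (κ * n + 1) with hτ
  have hκn : 0 ≤ κ * n := by positivity
  have hτ0 : 0 < τ := div_pos (by linarith) (by linarith)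
  refine ⟨κ * (1 + τ⁻¹), by positivity, ?_⟩
  intro W _ _ h h1 h2
  set Y := ∑ k, ∑ i, if k = i then 0 else ‖h k i i‖ ^ 2 with hY
  have hY0 : 0 ≤ Y := Finset.sum_nonneg fun k _ => Finset.sum_nonneg fun i _ => by positivity
  set W' := ∑ j, ‖∑ k, h k k j‖ ^ 2 with hW
  have hZ : ∑ k, ∑ i, ‖h k i i‖ ^ 2 = Y + ∑ i, ‖h i i i‖ ^ 2 := by
    rw [hY, ← Finset.sum_add_distrib]
    refine Finset.sum_congr rfl fun k _ => ?_
    rw [← Finset.add_sum_erase _ _ (Finset.mem_univ k),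
      ← Finset.add_sum_erase (Finset.univ) (fun i => if k = i then (0 : ℝ) else ‖h k i i‖ ^ 2)
        (Finset.mem_univ k), if_pos rfl, zero_add, add_comm]
    congr 1
    refine Finset.sum_congr rfl fun i hi => ?_
    rw [if_neg (Finset.ne_of_mem_erase hi).symm]
  -- For `k ≠ i` the component `h k i i` occurs at three positions of the symmetric tensor, but only
  -- once in the sum on the left. The surplus is `2 * Y`.
  have hA : ∑ k, ∑ i, ‖h k i i‖ ^ 2 + 2 * Y ≤ ∑ k, ∑ i, ∑ j, ‖h k i j‖ ^ 2 := by
    have e1 : ∀ k i j, ((if i = j then ‖h k i j‖ ^ 2 else 0) +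
        (if k = i then (if i = j then 0 else ‖h k i j‖ ^ 2) else 0) +
        (if k = j then (if i = j then 0 else ‖h k i j‖ ^ 2) else 0)) ≤ ‖h k i j‖ ^ 2 := by
      intro k i j
      by_cases hij : i = j <;> by_cases hki : k = i <;> by_cases hkj : k = j <;>
        simp_all
    refine le_trans (le_of_eq ?_) (Finset.sum_le_sum fun k _ => Finset.sum_le_sum fun i _ =>
      Finset.sum_le_sum fun j _ => e1 k i j)
    simp only [Finset.sum_add_distrib]
    have e2 : ∑ k, ∑ i, ∑ j, (if i = j then ‖h k i j‖ ^ 2 else 0) =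
        ∑ k, ∑ i, ‖h k i i‖ ^ 2 := by simp
    have e3 : ∑ k, ∑ i, ∑ j, (if k = i then (if i = j then 0 else ‖h k i j‖ ^ 2) else 0) = Y := by
      rw [hY, Finset.sum_comm (f := fun k i => if k = i then (0 : ℝ) else ‖h k i i‖ ^ 2)]
      refine Finset.sum_congr rfl fun k _ => ?_
      rw [Finset.sum_comm]
      refine Finset.sum_congr rfl fun j _ => ?_
      rw [Finset.sum_ite_eq]
      simp only [Finset.mem_univ, if_true, eq_comm (a := k)]
      rw [h2 k k j, h1 k j k, h2 j k k]
    have e4 : ∑ k, ∑ i, ∑ j, (if k = j then (if i = j then 0 else ‖h k i j‖ ^ 2) else 0) = Y := by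
      rw [hY, Finset.sum_comm (f := fun k i => if k = i then (0 : ℝ) else ‖h k i i‖ ^ 2)]
      refine Finset.sum_congr rfl fun k _ => Finset.sum_congr rfl fun i _ => ?_
      rw [Finset.sum_ite_eq]
      simp only [Finset.mem_univ, if_true]
      rw [h1 k i k]
    rw [e2, e3, e4]
    ring
  -- The components `h i i i` occur only once in the tensor norm and have no surplus. They are
  -- bounded by the off-diagonal ones through the trace, `h i i i = ∑ k, h k k i - ∑_{j ≠ i} h i j
  -- j`.
  have hD : ∑ i, ‖h i i i‖ ^ 2 ≤ (1 + τ) * (n - 1) * Y + (1 + τ⁻¹) * W' := by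
    rw [hY, hW, Finset.mul_sum, Finset.mul_sum, ← Finset.sum_add_distrib]
    refine Finset.sum_le_sum fun i _ => ?_
    have e1 : ∑ k, h k k i = h i i i + ∑ j ∈ Finset.univ.erase i, h i j j := by
      rw [← Finset.add_sum_erase _ _ (Finset.mem_univ i)]
      congr 1
      exact Finset.sum_congr rfl fun j _ => by rw [h2 j j i, h1 j i j]
    have e2 : ‖∑ j ∈ Finset.univ.erase i, h i j j‖ ^ 2 ≤
        (n - 1) * ∑ j, if i = j then 0 else ‖h i j j‖ ^ 2 := by
      have c1 : ‖∑ j ∈ Finset.univ.erase i, h i j j‖ ^ 2 ≤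
          (∑ j ∈ Finset.univ.erase i, ‖h i j j‖) ^ 2 := by
        gcongr
        exact norm_sum_le _ _
      have c2 := sq_sum_le_card_mul_sum_sq (s := Finset.univ.erase i) (f := fun j => ‖h i j j‖)
      have c3 : ((Finset.univ.erase i).card : ℝ) = n - 1 := by
        rw [Finset.card_erase_of_mem (Finset.mem_univ i), Finset.card_univ, Fintype.card_fin,
          Nat.cast_sub (Fin.pos i)]
        simp
      have c4 : ∑ j ∈ Finset.univ.erase i, ‖h i j j‖ ^ 2 =
          ∑ j, if i = j then 0 else ‖h i j j‖ ^ 2 := by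
        rw [← Finset.add_sum_erase Finset.univ (fun j => if i = j then (0 : ℝ) else ‖h i j j‖ ^ 2)
          (Finset.mem_univ i), if_pos rfl, zero_add]
        refine Finset.sum_congr rfl fun j hj => ?_
        rw [if_neg (Finset.ne_of_mem_erase hj).symm]
      rw [c3, c4] at c2
      exact c1.trans c2
    set r := ∑ j ∈ Finset.univ.erase i, h i j j
    have e3 : h i i i = (∑ k, h k k i) - r := by rw [e1, add_sub_cancel_right]
    set w := ∑ k, h k k i
    have e4 : ‖w - r‖ ^ 2 ≤ (1 + τ) * ‖r‖ ^ 2 + (1 + τ⁻¹) * ‖w‖ ^ 2 := by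
      have c1 : ‖w - r‖ ≤ ‖w‖ + ‖r‖ := norm_sub_le _ _
      have c2 : 2 * ‖w‖ * ‖r‖ ≤ τ * ‖r‖ ^ 2 + τ⁻¹ * ‖w‖ ^ 2 := by
        have c3 := mul_nonneg (inv_nonneg.2 hτ0.le) (sq_nonneg (τ * ‖r‖ - ‖w‖))
        have c4 : τ⁻¹ * (τ * ‖r‖ - ‖w‖) ^ 2 =
            τ * ‖r‖ ^ 2 - 2 * ‖w‖ * ‖r‖ + τ⁻¹ * ‖w‖ ^ 2 := by
          field_simp
          ring
        linarith
      have c5 : ‖w - r‖ ^ 2 ≤ (‖w‖ + ‖r‖) ^ 2 := by gcongr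
      linarith [add_sq ‖w‖ ‖r‖]
    rw [e3]
    calc _ ≤ _ := e4
      _ ≤ (1 + τ) * ((n - 1) * ∑ j, if i = j then 0 else ‖h i j j‖ ^ 2) + (1 + τ⁻¹) * ‖w‖ ^ 2 := by
        gcongr
      _ = _ := by ring
  have hs : κ * (1 + (1 + τ) * (n - 1)) ≤ 2 := by
    have e1 : τ * (κ * n + 1) = 2 - κ * n := div_mul_cancel₀ _ (by linarith)
    nlinarith [mul_nonneg hκ0 hτ0.le]
  have hZ' : κ * ∑ k, ∑ i, ‖h k i i‖ ^ 2 ≤ 2 * Y + κ * (1 + τ⁻¹) * W' := by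
    calc κ * ∑ k, ∑ i, ‖h k i i‖ ^ 2 ≤
        κ * (Y + ((1 + τ) * (n - 1) * Y + (1 + τ⁻¹) * W')) := by
          rw [hZ]; gcongr
      _ = κ * (1 + (1 + τ) * (n - 1)) * Y + κ * (1 + τ⁻¹) * W' := by ring
      _ ≤ _ := by gcongr
  linarith

end Kato

/-! ### Divergence of the logarithmic gradient, and Simons' inequality -/

noncomputable section Slope

variable {n m : ℕ} {V : Type*} [NormedAddCommGroup V] [InnerProductSpace ℝ V]
  [FiniteDimensional ℝ V] {π : V →L[ℝ] Eu n} {f : Eu n → V} {U : Set (Eu n)} {x : Eu n}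

/-- The trace on continuous endomorphisms. -/
def traceCLM (V : Type*) [NormedAddCommGroup V] [InnerProductSpace ℝ V]
    [FiniteDimensional ℝ V] : (V →L[ℝ] V) →L[ℝ] ℝ :=
  LinearMap.toContinuousLinearMap
    ((LinearMap.trace ℝ V).comp (ContinuousLinearMap.coeLM ℝ))

theorem normSecondFund_nonneg (f : Eu n → V) (x : Eu n) : 0 ≤ normSecondFund f x :=
  Real.sqrt_nonneg _

theorem traceCLM_apply {ι : Type*} [Fintype ι] (b : OrthonormalBasis ι ℝ V) (A : V →L[ℝ] V) :
    traceCLM V A = ∑ d, inner ℝ (b d) (A (b d)) :=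
  LinearMap.trace_eq_sum_inner A.toLinearMap b

/-- The projection onto the tangent space along the kernel of `π`. -/
def obliqueProj (π : V →L[ℝ] Eu n) (f : Eu n → V) (x : Eu n) : V →L[ℝ] V :=
  (fderiv ℝ f x).comp π

/-- The functional `a ↦ tr(L ∘ ∂_a P)`; it is the tangential derivative of the logarithm of the
volume density. -/
def slope (π : V →L[ℝ] Eu n) (f : Eu n → V) (x : Eu n) : V →L[ℝ] ℝ :=
  ((traceCLM V).comp (ContinuousLinearMap.compL ℝ V V V (obliqueProj π f x))).comp (shape π f x)

theorem slope_apply (a : V) :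
    slope π f x a = traceCLM V ((obliqueProj π f x).comp (shape π f x a)) := rfl

/-- The trace of `L ∘ ∇H`. -/
def traceGradMeanCurv (π : V →L[ℝ] Eu n) (f : Eu n → V) (x : Eu n) : ℝ :=
  ∑ i, inner ℝ (frame f x i) (obliqueProj π f x (covMeanCurv f x (frameCoord f x i)))

namespace IsGraphOver

variable (hf : IsGraphOver π f U) (hx : x ∈ U)
include hf hx

theorem contDiffAt_obliqueProj : ContDiffAt ℝ ∞ (obliqueProj π f) x :=
  (hf.contDiffAt_fderiv hx).clm_comp contDiffAt_const

theorem contDiffAt_slope : ContDiffAt ℝ ∞ (slope π f) x :=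
  (contDiffAt_const.clm_comp ((ContinuousLinearMap.contDiff _).contDiffAt.comp x
    (hf.contDiffAt_obliqueProj hx))).clm_comp (hf.contDiffAt_shape hx)

theorem tangentProj_obliqueProj (v : V) :
    tangentProj f x (obliqueProj π f x v) = obliqueProj π f x v :=
  tangentProj_fderiv f x _

theorem obliqueProj_tangentProj (v : V) :
    obliqueProj π f x (tangentProj f x v) = tangentProj f x v := hf.fderiv_proj hx v

/-- The kernel of `L = df ∘ π` contains the fixed space `ker π`, so the derivative of `L` only sees
`L v`. On that tangent vector the formula is the derivative of `L P = P`. -/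
theorem tD_obliqueProj (a v : V) : tD π f (obliqueProj π f) x a v =
    shape π f x a (obliqueProj π f x v) -
      obliqueProj π f x (shape π f x a (obliqueProj π f x v)) := by
  have hL : DifferentiableAt ℝ (obliqueProj π f) x :=
    (hf.contDiffAt_obliqueProj hx).differentiableAt (by simp)
  have hP := hf.differentiableAt_tangentProj hx
  have hd : DifferentiableAt ℝ (fderiv ℝ f) x :=
    (hf.contDiffAt_fderiv hx).differentiableAt (by simp)
  have h1 : ∀ v, tD π f (obliqueProj π f) x a v =
      tD π f (obliqueProj π f) x a (obliqueProj π f x v) := by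
    intro v
    have e1 : tD π f (obliqueProj π f) x a = (tD π f (fderiv ℝ f) x a).comp π := by
      have := tD_clm_comp (π := π) (f := f) hd (differentiableAt_const (x := x) π) a
      rw [tD_const] at this
      simp only [ContinuousLinearMap.comp_zero, zero_apply, add_zero] at this
      exact this
    rw [e1]
    simp only [ContinuousLinearMap.comp_apply, obliqueProj, hf.proj_fderiv hx]
  have h2 : ∀ v, tD π f (obliqueProj π f) x a (tangentProj f x v) +
      obliqueProj π f x (shape π f x a v) = shape π f x a v := by
    intro v
    have e1 : (fun y => obliqueProj π f y (tangentProj f y v)) =ᶠ[𝓝 x]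
        fun y => tangentProj f y v :=
      (hf.eventually_mem hx).mono fun y hy => hf.obliqueProj_tangentProj hy v
    have e2 := congrArg (fun L => L a) (tD_congr (π := π) (f := f) e1)
    rw [tD_clm_apply hL (hP.clm_apply (differentiableAt_const v)), tD_clm_const hP] at e2
    exact e2
  have h3 := h2 (obliqueProj π f x v)
  rw [hf.tangentProj_obliqueProj hx] at h3
  rw [h1]
  exact eq_sub_of_add_eq h3

theorem tD_slope_apply (d a : V) : tD π f (slope π f) x d a =
    traceCLM V ((tD π f (obliqueProj π f) x d).comp (shape π f x a)) +
      traceCLM V ((obliqueProj π f x).comp (tD π f (shape π f) x d a)) := by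
  have hL : DifferentiableAt ℝ (obliqueProj π f) x :=
    (hf.contDiffAt_obliqueProj hx).differentiableAt (by simp)
  have hSa := (hf.differentiableAt_shape hx).clm_apply (differentiableAt_const a)
  have hs : DifferentiableAt ℝ (slope π f) x :=
    (hf.contDiffAt_slope hx).differentiableAt (by simp)
  rw [← tD_clm_const hs]
  change tD π f (fun y => traceCLM V ((obliqueProj π f y).comp (shape π f y a))) x d = _
  rw [tD_const_clm _ (hL.clm_comp hSa), tD_clm_comp hL hSa, map_add,
    tD_clm_const (hf.differentiableAt_shape hx)]

section Principal

variable (hflat : HasFlatNormalBundle f U) {b : OrthonormalBasis (Fin n ⊕ Fin m) ℝ V}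
  {lam : Fin n → V} (hb : IsPrincipalBasis (tangentProj f x) (shape π f x) b lam)
include hflat hb

theorem obliqueProj_inl (k : Fin n) : obliqueProj π f x (b (.inl k)) = b (.inl k) := by
  rw [← hb.proj_inl k, hf.obliqueProj_tangentProj hx]

theorem inner_normal_obliqueProj {v : V} (hv : tangentProj f x v = 0) (w : V) :
    inner ℝ v (obliqueProj π f x w) = (0 : ℝ) := by
  rw [← hf.tangentProj_obliqueProj hx, ← tangentProj_symm, hv, inner_zero_left]

theorem slope_inl (k : Fin n) :
    slope π f x (b (.inl k)) = inner ℝ (b (.inl k)) (obliqueProj π f x (lam k)) := by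
  have h := hf.isFlatShape hx hflat
  rw [slope_apply, traceCLM_apply b, Fintype.sum_sum_type, Finset.sum_eq_single k]
  · simp [hb.apply_inl_self h, hf.inner_normal_obliqueProj hx hflat hb (hb.proj_inr _)]
  · intro j _ hj
    simp [hb.apply_inl_inl h, hj.symm]
  · simp

theorem slope_inr (α : Fin m) : slope π f x (b (.inr α)) = 0 := by
  have h := hf.isFlatShape hx hflat
  rw [slope_apply, hb.apply_inr h]
  simp

theorem traceGradMeanCurv_eq : traceGradMeanCurv π f x = ∑ j, inner ℝ (b (.inl j))
    (obliqueProj π f x (tD π f (meanCurv f) x (b (.inl j)) -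
      tangentProj f x (tD π f (meanCurv f) x (b (.inl j))))) := by
  rw [traceGradMeanCurv]
  simp only [hf.covMeanCurv_frame hx hflat]
  exact (hf.orthonormal_frame hx).sum_inner_eq (orthonormal_inl hb)
    (hf.tangentProj_eq_sum_frame hx) (hf.tangentProj_eq_sum_inl hx hflat hb)
    (ContinuousLinearMap.id ℝ V) ((obliqueProj π f x).comp
      (tD π f (meanCurv f) x - (tangentProj f x).comp (tD π f (meanCurv f) x)))

/-- The product rule applied to `tr(L Q)` gives two traces. In a principal basis `L ∘ Q (e k)` has
one diagonal entry, so the derivative of `L` contributes exactly `|lam k|² - slope²` (`h1`); without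
flatness mixed entries would remain. The derivative of `Q` contributes `-2 |lam k|²` and, by
Codazzi, the trace of `L ∘ ∇H` (`h2`, `h3`). -/
theorem sum_tD_slope_principal : ∑ d, tD π f (slope π f) x (b d) (b d) =
    - ∑ i, ‖lam i‖ ^ 2 - ∑ d, slope π f x (b d) ^ 2 + traceGradMeanCurv π f x := by
  have h := hf.isFlatShape hx hflat
  have hR := hf.isShapeDeriv hx
  have hN : ∀ {v : V}, tangentProj f x v = 0 → ∀ w, inner ℝ v (obliqueProj π f x w) = (0 : ℝ) :=
    fun hv w => hf.inner_normal_obliqueProj hx hflat hb hv w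
  have hLP : ∀ v, tangentProj f x (obliqueProj π f x v) = obliqueProj π f x v :=
    hf.tangentProj_obliqueProj hx
  have h1 : ∀ k, traceCLM V ((tD π f (obliqueProj π f) x (b (.inl k))).comp
      (shape π f x (b (.inl k)))) = ‖lam k‖ ^ 2 - slope π f x (b (.inl k)) ^ 2 := by
    intro k
    rw [traceCLM_apply b, Fintype.sum_sum_type, Finset.sum_eq_single k, hf.slope_inl hx hflat hb]
    · simp only [ContinuousLinearMap.comp_apply, hf.tD_obliqueProj hx, hb.apply_inl_self h]
      have e1 : shape π f x (b (.inl k)) (obliqueProj π f x (lam k)) =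
          inner ℝ (b (.inl k)) (obliqueProj π f x (lam k)) • lam k := by
        rw [hb.apply_inl, hN (hb.proj_lam k), zero_smul, add_zero]
      have e2 : ∀ α, inner ℝ (b (.inr α)) (shape π f x (b (.inl k))
          (obliqueProj π f x (shape π f x (b (.inl k)) (b (.inr α)))) -
          obliqueProj π f x (shape π f x (b (.inl k))
          (obliqueProj π f x (shape π f x (b (.inl k)) (b (.inr α)))))) =
          inner ℝ (lam k) (b (.inr α)) * inner ℝ (b (.inr α)) (lam k) := by
        intro α
        rw [inner_sub_right, hN (hb.proj_inr α), hb.apply_inl_normal h k (hb.proj_inr α), map_smul,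
          hf.obliqueProj_inl hx hflat hb, map_smul, hb.apply_inl_self h, inner_smul_right, sub_zero]
      simp only [e2]
      rw [hb.sum_inr_inner_mul h (hb.proj_lam k), e1, map_smul, inner_sub_right, inner_smul_right,
        inner_smul_right, real_inner_comm (lam k) (b (.inl k)), hb.inner_lam_inl h,
        real_inner_self_eq_norm_sq]
      ring
    · intro j _ hj
      simp [hb.apply_inl_inl h, hj.symm]
    · simp
  have h2 : ∀ k, traceCLM V ((obliqueProj π f x).comp
      (tD π f (shape π f) x (b (.inl k)) (b (.inl k)))) = -2 * ‖lam k‖ ^ 2 +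
      ∑ j, inner ℝ (b (.inl j)) (obliqueProj π f x
        (IsPrincipalBasis.covShape (tangentProj f x) (tD π f (shape π f) x) b k k j)) := by
    intro k
    rw [traceCLM_apply b, Fintype.sum_sum_type]
    simp only [ContinuousLinearMap.comp_apply, hN (hb.proj_inr _), Finset.sum_const_zero, add_zero]
    have e1 : ∀ j, obliqueProj π f x (tD π f (shape π f) x (b (.inl k)) (b (.inl k)) (b (.inl j))) =
        (if k = j then (-2 * ‖lam k‖ ^ 2) • b (.inl k) else 0) + obliqueProj π f x
          (IsPrincipalBasis.covShape (tangentProj f x) (tD π f (shape π f) x) b k k j) := by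
      intro j
      rw [IsPrincipalBasis.covShape, map_sub, hf.obliqueProj_tangentProj hx, hb.proj_deriv h hR,
        real_inner_self_eq_norm_sq]
      split_ifs
      · module
      · simp
    simp only [e1, inner_add_right, Finset.sum_add_distrib]
    congr 1
    rw [Finset.sum_eq_single k]
    · rw [if_pos rfl, inner_smul_right, IsPrincipalBasis.inner_inl_inl, if_pos rfl, mul_one]
    · intro j _ hj
      rw [if_neg hj.symm, inner_zero_right]
    · simp
  have h3 : traceGradMeanCurv π f x = ∑ k, ∑ j, inner ℝ (b (.inl j)) (obliqueProj π f x
        (IsPrincipalBasis.covShape (tangentProj f x) (tD π f (shape π f) x) b k k j)) := by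
    rw [hf.traceGradMeanCurv_eq hx hflat hb, Finset.sum_comm]
    refine Finset.sum_congr rfl fun j _ => ?_
    rw [hf.normal_tD_meanCurv hx hflat hb, map_sum, inner_sum]
  have h4 : ∀ α, tD π f (slope π f) x (b (.inr α)) = 0 := by
    intro α
    rw [← tD_proj, hb.proj_inr, map_zero]
  rw [Fintype.sum_sum_type, Fintype.sum_sum_type]
  simp only [h4, hf.tD_slope_apply hx, h1, h2, hf.slope_inr hx hflat hb, zero_apply, h3,
    Finset.sum_add_distrib, Finset.sum_sub_distrib, ← Finset.mul_sum]
  simp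
  ring

end Principal

theorem sum_sq_functional {ι ι' : Type*} [Fintype ι] [Fintype ι'] (b : OrthonormalBasis ι ℝ V)
    (b' : OrthonormalBasis ι' ℝ V) (s t : V →L[ℝ] ℝ) :
    ∑ d, s (b d) * t (b d) = ∑ d, s (b' d) * t (b' d) :=
  b.sum_bilin_eq_sum_bilin b' (LinearMap.mk₂ ℝ (fun a c => s a * t c) (by simp [add_mul])
    (by simp [mul_assoc]) (by simp [mul_add]) (by simp [mul_left_comm]))

/-- The divergence of the logarithmic gradient of the volume density. -/
theorem sum_tD_slope (hflat : HasFlatNormalBundle f U) {ι : Type*} [Fintype ι]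
    (b : OrthonormalBasis ι ℝ V) : ∑ d, tD π f (slope π f) x (b d) (b d) =
    - normSecondFund f x ^ 2 - ∑ d, slope π f x (b d) ^ 2 + traceGradMeanCurv π f x := by
  obtain ⟨m, b', lam, hb⟩ := hf.exists_principalBasis hx hflat
  have h1 : ∑ d, tD π f (slope π f) x (b d) (b d) = ∑ d, tD π f (slope π f) x (b' d) (b' d) :=
    b.sum_bilin_eq_sum_bilin b' (LinearMap.mk₂ ℝ (fun a b => tD π f (slope π f) x a b) (by simp)
      (by simp) (by simp) (by simp))
  simp only [h1, hf.sum_tD_slope_principal hx hflat hb, hf.sq_normSecondFund hx hflat hb, sq]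
  rw [hf.sum_sq_functional hx b b']

theorem neg_sum_inner_le :
    -(∑ i, ∑ j, inner ℝ (secondFund f x (frameCoord f x i) (frameCoord f x j))
        (covCovMeanCurv f x (frameCoord f x i) (frameCoord f x j))) ≤
      normSecondFund f x * K₂ f x := by
  rw [K₂]
  split_ifs with h
  · calc _ = normSecondFund f x * (-((∑ i, ∑ j,
          inner ℝ (secondFund f x (frameCoord f x i) (frameCoord f x j))
          (covCovMeanCurv f x (frameCoord f x i) (frameCoord f x j))) / normSecondFund f x)) := by
          field_simp
      _ ≤ _ := by gcongr; exact le_max_left _ _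
  · have h0 : normSecondFund f x = 0 := le_antisymm (not_lt.1 h) (Real.sqrt_nonneg _)
    have h1 : ∑ i, ∑ j, ‖secondFund f x (frameCoord f x i) (frameCoord f x j)‖ ^ 2 = 0 := by
      rw [normSecondFund, Real.sqrt_eq_zero (by positivity)] at h0
      exact h0
    have h2 : ∀ i j, secondFund f x (frameCoord f x i) (frameCoord f x j) = 0 := by
      intro i j
      rw [Finset.sum_eq_zero_iff_of_nonneg (fun _ _ => by positivity)] at h1
      have h3 := h1 i (Finset.mem_univ i)
      rw [Finset.sum_eq_zero_iff_of_nonneg (fun _ _ => by positivity)] at h3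
      simpa using h3 j (Finset.mem_univ j)
    simp [h2]

/-- Simons' inequality, combined with a Kato-type inequality. -/
theorem simons_inequality (hflat : HasFlatNormalBundle f U) {κ C : ℝ} (hκ : 0 ≤ κ)
    (hC : ∀ h : Fin n → Fin n → Fin n → V, (∀ k i j, h k i j = h i k j) →
      (∀ k i j, h k i j = h k j i) → (1 + κ) * ∑ k, ∑ i, ‖h k i i‖ ^ 2 ≤
        ∑ k, ∑ i, ∑ j, ‖h k i j‖ ^ 2 + C * ∑ j, ‖∑ k, h k k j‖ ^ 2)
    {v : ℝ} (hv0 : 0 < v) (hv : normSecondFund f x ^ 2 ≤ v) {ι : Type*} [Fintype ι]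
    (b : OrthonormalBasis ι ℝ V) :
    (1 + κ) * ((∑ d, tD π f (fun y => normSecondFund f y ^ 2) x (b d) ^ 2) / (4 * v)) ≤
      2⁻¹ * ∑ d, tD π f (tD π f (fun y => normSecondFund f y ^ 2)) x (b d) (b d) +
      normSecondFund f x * K₂ f x + ‖meanCurv f x‖ * normSecondFund f x ^ 3 +
      (normSecondFund f x ^ 2) ^ 2 + C * normCovMeanCurv f x ^ 2 := by
  have h := hf.isFlatShape hx hflat
  have hR := hf.isShapeDeriv hx
  obtain ⟨m, b', lam, hb⟩ := hf.exists_principalBasis hx hflat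
  have e1 : ∑ d, tD π f (tD π f (fun y => normSecondFund f y ^ 2)) x (b d) (b d) =
      ∑ d, tD π f (tD π f (fun y => normSecondFund f y ^ 2)) x (b' d) (b' d) :=
    b.sum_bilin_eq_sum_bilin b' (LinearMap.mk₂ ℝ
      (fun a c => tD π f (tD π f (fun y => normSecondFund f y ^ 2)) x a c) (by simp)
      (by simp) (by simp) (by simp))
  have e2 : ∑ d, tD π f (fun y => normSecondFund f y ^ 2) x (b d) ^ 2 =
      ∑ k, tD π f (fun y => normSecondFund f y ^ 2) x (b' (.inl k)) ^ 2 := by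
    simp only [sq (tD _ _ _ _ _)]
    rw [hf.sum_sq_functional hx b b', Fintype.sum_sum_type]
    have : ∀ α, tD π f (fun y => normSecondFund f y ^ 2) x (b' (.inr α)) = 0 := by
      intro α
      rw [← tD_proj, hb.proj_inr, map_zero]
    simp [this]
  rw [e1, e2, hf.laplacian_sq_normSecondFund hx hflat hb]
  set hh := IsPrincipalBasis.covShape (tangentProj f x) (tD π f (shape π f) x) b' with hhh
  have hF := hf.sq_normSecondFund hx hflat hb
  have k1 := hC hh (hb.covShape_swap_left h hR) (hb.covShape_swap_right h hR)
  have k2 : ∑ j, ‖∑ k, hh k k j‖ ^ 2 = normCovMeanCurv f x ^ 2 := by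
    rw [hf.sq_normCovMeanCurv hx hflat hb]
    simp only [hf.normal_tD_meanCurv hx hflat hb]
    rfl
  -- Since `∂_k |A|² = 2 Σ ⟨lam i, h k i i⟩`, Cauchy–Schwarz needs only the components `h k i i`,
  -- precisely those in the Kato inequality. The larger `v` replaces `|A|²` to permit division where
  -- `A` vanishes.
  have k3 : (∑ k, tD π f (fun y => normSecondFund f y ^ 2) x (b' (.inl k)) ^ 2) / (4 * v) ≤
      ∑ k, ∑ i, ‖hh k i i‖ ^ 2 := by
    rw [div_le_iff₀ (by positivity), Finset.sum_mul]
    refine Finset.sum_le_sum fun k _ => ?_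
    rw [hf.tD_sq_normSecondFund_inl hx hflat hb]
    have c1 : |∑ i, inner ℝ (lam i) (hh k i i)| ≤ ∑ i, ‖lam i‖ * ‖hh k i i‖ :=
      (Finset.abs_sum_le_sum_abs _ _).trans
        (Finset.sum_le_sum fun i _ => abs_real_inner_le_norm _ _)
    have c2 : (∑ i, inner ℝ (lam i) (hh k i i)) ^ 2 ≤
        (∑ i, ‖lam i‖ ^ 2) * ∑ i, ‖hh k i i‖ ^ 2 := by
      rw [← sq_abs]
      refine le_trans (by gcongr) (Finset.sum_mul_sq_le_sq_mul_sq _ _ _)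
    calc _ = 4 * (∑ i, inner ℝ (lam i) (hh k i i)) ^ 2 := by ring
      _ ≤ 4 * (v * ∑ i, ‖hh k i i‖ ^ 2) := by
        gcongr
        refine c2.trans ?_
        gcongr
        exact hF ▸ hv
      _ = _ := by ring
  have k4 := hf.neg_sum_inner_le hx
  have hlam : ∀ i, ‖lam i‖ ≤ normSecondFund f x := fun i => by
    refine (abs_le_of_sq_le_sq' ?_ (normSecondFund_nonneg f x)).2
    rw [hF]
    exact Finset.single_le_sum (f := fun i => ‖lam i‖ ^ 2) (fun i _ => by positivity)
      (Finset.mem_univ i)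
  have k5 : -(‖meanCurv f x‖ * normSecondFund f x ^ 3) ≤
      ∑ i, inner ℝ (meanCurv f x) (lam i) * ‖lam i‖ ^ 2 := by
    calc -(‖meanCurv f x‖ * normSecondFund f x ^ 3) =
        ∑ i, -(‖meanCurv f x‖ * normSecondFund f x * ‖lam i‖ ^ 2) := by
          rw [Finset.sum_neg_distrib, ← Finset.mul_sum, ← hF]; ring
      _ ≤ _ := by
        refine Finset.sum_le_sum fun i _ => ?_
        rw [← neg_mul]
        gcongr
        have c1 := neg_le_of_abs_le (abs_real_inner_le_norm (meanCurv f x) (lam i))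
        refine le_trans ?_ c1
        gcongr
        exact hlam i
  have k6 : ∑ k, ∑ i, inner ℝ (lam k) (lam i) ^ 2 ≤ (normSecondFund f x ^ 2) ^ 2 := by
    rw [hF, sq (∑ i, ‖lam i‖ ^ 2), Finset.sum_mul_sum]
    refine Finset.sum_le_sum fun k _ => Finset.sum_le_sum fun i _ => ?_
    rw [← sq_abs, ← mul_pow]
    gcongr
    exact abs_real_inner_le_norm _ _
  have k7 := mul_le_mul_of_nonneg_left k3 (by linarith : 0 ≤ 1 + κ)
  rw [k2] at k1
  linarith

end IsGraphOver

end Slope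
end FlatNormalGraph



/-! ### Volume density and the divergence theorem -/

namespace FlatNormalGraph

noncomputable section Divergence

section Det

variable {E : Type*} [NormedAddCommGroup E] [InnerProductSpace ℝ E] [FiniteDimensional ℝ E]

theorem det_eq_sum_perm {ι : Type*} [Fintype ι] [DecidableEq ι] (b : OrthonormalBasis ι ℝ E)
    (A : E →L[ℝ] E) : A.det = (Matrix.of fun i j => inner ℝ (b i) (A (b j))).det := by
  rw [ContinuousLinearMap.det, ← LinearMap.det_toMatrix b.toBasis]
  congr 1
  ext i j
  simp [LinearMap.toMatrix_apply, b.repr_apply_apply]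

theorem contDiff_det {N : WithTop ℕ∞} : ContDiff ℝ N fun A : E →L[ℝ] E => A.det := by
  have h : (fun A : E →L[ℝ] E => A.det) = fun A => (Matrix.of fun i j =>
      inner ℝ (stdOrthonormalBasis ℝ E i) (A (stdOrthonormalBasis ℝ E j))).det :=
    funext fun A => det_eq_sum_perm _ A
  rw [h]
  simp only [Matrix.det_apply, Matrix.of_apply]
  refine ContDiff.sum fun σ _ => ContDiff.const_smul _ (contDiff_prod fun i _ => ?_)
  exact contDiff_const.inner ℝ (contDiff_id.clm_apply contDiff_const)

/-- The determinant is smooth, so its derivative is found along lines from the expansion `det(1 +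
tM) = 1 + t tr M + O(t²)`. -/
theorem hasFDerivAt_det_id :
    HasFDerivAt (fun A : E →L[ℝ] E => A.det) (traceCLM E) (ContinuousLinearMap.id ℝ E) := by
  have h1 : DifferentiableAt ℝ (fun A : E →L[ℝ] E => A.det) (ContinuousLinearMap.id ℝ E) :=
    contDiff_det.contDiffAt.differentiableAt one_ne_zero
  have h2 : fderiv ℝ (fun A : E →L[ℝ] E => A.det) (ContinuousLinearMap.id ℝ E) = traceCLM E := by
    ext B
    set b := stdOrthonormalBasis ℝ E
    set M := Matrix.of fun i j => inner ℝ (b i) (B (b j)) with hM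
    have e1 : HasDerivAt (fun t : ℝ => ContinuousLinearMap.id ℝ E + t • B) B 0 := by
      simpa using ((hasDerivAt_id (0 : ℝ)).smul_const B).const_add (ContinuousLinearMap.id ℝ E)
    have e2 : HasDerivAt (fun t : ℝ => (ContinuousLinearMap.id ℝ E + t • B).det)
        (fderiv ℝ (fun A : E →L[ℝ] E => A.det) (ContinuousLinearMap.id ℝ E) B) 0 := by
      have h3 : HasFDerivAt (fun A : E →L[ℝ] E => A.det)
          (fderiv ℝ (fun A : E →L[ℝ] E => A.det) (ContinuousLinearMap.id ℝ E))
          (ContinuousLinearMap.id ℝ E + (0 : ℝ) • B) := by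
        simpa using h1.hasFDerivAt
      exact h3.comp_hasDerivAt (0 : ℝ) e1
    have e3 : (fun t : ℝ => (ContinuousLinearMap.id ℝ E + t • B).det) = fun t : ℝ =>
        1 + M.trace * t + ((Matrix.det (1 + (Polynomial.X : Polynomial ℝ) •
          M.map Polynomial.C)).divX.divX).eval t * t ^ 2 := by
      funext t
      rw [det_eq_sum_perm b, ← Matrix.det_one_add_smul]
      congr 1
      ext i j
      simp [hM, inner_add_right, inner_smul_right, Matrix.one_apply,
        orthonormal_iff_ite.1 b.orthonormal]
    have e4 : HasDerivAt (fun t : ℝ =>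
        1 + M.trace * t + ((Matrix.det (1 + (Polynomial.X : Polynomial ℝ) •
          M.map Polynomial.C)).divX.divX).eval t * t ^ 2) M.trace 0 := by
      have c1 := (Polynomial.hasDerivAt (Matrix.det (1 + (Polynomial.X : Polynomial ℝ) •
          M.map Polynomial.C)).divX.divX (0 : ℝ)).mul (hasDerivAt_pow 2 (0 : ℝ))
      have c2 := ((hasDerivAt_id (0 : ℝ)).const_mul M.trace).const_add (1 : ℝ)
      exact (c2.fun_add c1).congr_deriv (by simp)
    rw [e3] at e2
    rw [e2.unique e4, traceCLM_apply b, Matrix.trace]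
    rfl
  rw [← h2]
  exact h1.hasFDerivAt

theorem traceCLM_comp_comm (A B : E →L[ℝ] E) : traceCLM E (A.comp B) = traceCLM E (B.comp A) :=
  LinearMap.trace_mul_comm ℝ A.toLinearMap B.toLinearMap

theorem traceCLM_comp_comm' {F : Type*} [NormedAddCommGroup F] [InnerProductSpace ℝ F]
    [FiniteDimensional ℝ F] (A : E →L[ℝ] F) (B : F →L[ℝ] E) :
    traceCLM F (A.comp B) = traceCLM E (B.comp A) :=
  LinearMap.trace_comp_comm' B.toLinearMap A.toLinearMap

theorem traceCLM_adjoint [CompleteSpace E] (A : E →L[ℝ] E) :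
    traceCLM E A.adjoint = traceCLM E A := by
  rw [traceCLM_apply (stdOrthonormalBasis ℝ E), traceCLM_apply (stdOrthonormalBasis ℝ E)]
  refine Finset.sum_congr rfl fun i _ => ?_
  rw [ContinuousLinearMap.adjoint_inner_right, real_inner_comm]

end Det

variable {n : ℕ} {V : Type*} [NormedAddCommGroup V] [InnerProductSpace ℝ V]
  [FiniteDimensional ℝ V] {π : V →L[ℝ] Eu n} {f : Eu n → V} {U : Set (Eu n)} {x : Eu n}

/-- The volume density of the parametrization. -/
def volDensity (f : Eu n → V) (x : Eu n) : ℝ := (fderiv ℝ f x).toLinearMap.normDet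

theorem volDensity_sq [CompleteSpace V] (f : Eu n → V) (x : Eu n) :
    volDensity f x ^ 2 = ((fderiv ℝ f x).adjoint.comp (fderiv ℝ f x)).det :=
  (fderiv ℝ f x).normDet_sq

theorem volDensity_nonneg (f : Eu n → V) (x : Eu n) : 0 ≤ volDensity f x :=
  LinearMap.normDet_nonneg _

namespace IsGraphOver

variable (hf : IsGraphOver π f U) (hx : x ∈ U)
include hf hx

theorem volDensity_pos : 0 < volDensity f x := by
  refine lt_of_le_of_ne (volDensity_nonneg f x) (Ne.symm fun h => ?_)
  rw [volDensity, LinearMap.normDet_eq_zero_iff_ker_ne_bot] at h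
  exact h (LinearMap.ker_eq_bot.2 (hf.fderiv_injective hx))

theorem contDiffAt_volDensity : ContDiffAt ℝ ∞ (volDensity f) x := by
  have := FiniteDimensional.complete ℝ V
  have h1 : volDensity f = fun y => √(((fderiv ℝ f y).adjoint.comp (fderiv ℝ f y)).det) := by
    funext y
    rw [← volDensity_sq, Real.sqrt_sq (volDensity_nonneg f y)]
  rw [h1]
  refine ContDiffAt.sqrt ?_ ?_
  · exact contDiff_det.contDiffAt.comp x
      ((hf.contDiffAt_fderiv hx).adjoint.clm_comp (hf.contDiffAt_fderiv hx))
  · rw [← volDensity_sq]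
    exact (pow_pos (hf.volDensity_pos hx) 2).ne'

/-- Jacobi's formula for the volume density. -/
theorem fderiv_volDensity (u : Eu n) : fderiv ℝ (volDensity f) x u =
    volDensity f x * traceCLM (Eu n) ((π.comp (tangentProj f x)).comp
      (fderiv ℝ (fderiv ℝ f) x u)) := by
  have := FiniteDimensional.complete ℝ V
  have hd : DifferentiableAt ℝ (fderiv ℝ f) x :=
    (hf.contDiffAt_fderiv hx).differentiableAt (by simp)
  have had : DifferentiableAt ℝ (fun y => (fderiv ℝ f y).adjoint) x :=
    ((hf.contDiffAt_fderiv hx).adjoint).differentiableAt (by simp)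
  set D := fderiv ℝ f x
  set D' := fderiv ℝ (fderiv ℝ f) x u
  set G : Eu n → Eu n →L[ℝ] Eu n := fun y => (fderiv ℝ f y).adjoint.comp (fderiv ℝ f y) with hG
  -- the left inverse of `df`
  set K : V →L[ℝ] Eu n := π.comp (tangentProj f x) with hK
  have hKD : K.comp D = ContinuousLinearMap.id ℝ (Eu n) := by
    ext1 v
    simp only [hK, ContinuousLinearMap.comp_apply]
    rw [tangentProj_fderiv, hf.proj_fderiv hx]
    rfl
  have hDK : D.comp K = tangentProj f x := by
    ext1 v
    exact hf.fderiv_proj hx v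
  have hDP : D.adjoint.comp (tangentProj f x) = D.adjoint := by
    ext1 v
    refine ext_inner_right ℝ fun w => ?_
    rw [ContinuousLinearMap.comp_apply, ContinuousLinearMap.adjoint_inner_left,
      ContinuousLinearMap.adjoint_inner_left, tangentProj_symm, tangentProj_fderiv]
  -- the inverse of `G x`
  set R : Eu n →L[ℝ] Eu n := K.comp K.adjoint with hR
  have hKD' : D.adjoint.comp K.adjoint = ContinuousLinearMap.id ℝ (Eu n) := by
    rw [← ContinuousLinearMap.adjoint_comp, hKD]
    exact ContinuousLinearMap.adjoint_id
  have hRG : (G x).comp R = ContinuousLinearMap.id ℝ (Eu n) := by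
    have : (G x).comp R = D.adjoint.comp ((D.comp K).comp K.adjoint) := rfl
    rw [this, hDK, ← ContinuousLinearMap.comp_assoc, hDP, hKD']
  have hKR : R.comp D.adjoint = K := by
    have e1 : K.adjoint.comp D.adjoint = tangentProj f x := by
      rw [← ContinuousLinearMap.adjoint_comp, hDK]
      refine (ContinuousLinearMap.ext fun v => ext_inner_right ℝ fun w => ?_)
      rw [ContinuousLinearMap.adjoint_inner_left, tangentProj_symm]
    rw [hR, ContinuousLinearMap.comp_assoc, e1]
    ext1 v
    simp only [hK, ContinuousLinearMap.comp_apply, tangentProj_proj]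
  have hRG' : R.comp (G x) = ContinuousLinearMap.id ℝ (Eu n) := by
    have : R.comp (G x) = (R.comp D.adjoint).comp D := rfl
    rw [this, hKR, hKD]
  -- Factoring out the constant `det (G x)` leaves a determinant that is differentiated only at the
  -- identity.
  have hdet : ∀ y, volDensity f y ^ 2 = (G x).det * (R.comp (G y)).det := by
    intro y
    rw [volDensity_sq]
    have e1 : (G x).comp (R.comp (G y)) = G y := by
      rw [← ContinuousLinearMap.comp_assoc, hRG, ContinuousLinearMap.id_comp]
    have e2 : ((G x).comp (R.comp (G y))).det = (G x).det * (R.comp (G y)).det :=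
      LinearMap.det_comp _ _
    rw [← e2, e1]
  have hGd : DifferentiableAt ℝ G x := had.clm_comp hd
  have hRGd : DifferentiableAt ℝ (fun y => R.comp (G y)) x :=
    (differentiableAt_const R).clm_comp hGd
  have hfd : fderiv ℝ (fun y => (R.comp (G y)).det) x u =
      traceCLM (Eu n) (R.comp (fderiv ℝ G x u)) := by
    have e1 : HasFDerivAt (fun A : Eu n →L[ℝ] Eu n => A.det) (traceCLM (Eu n)) (R.comp (G x)) := by
      rw [hRG']; exact hasFDerivAt_det_id
    have e2 := (e1.comp x hRGd.hasFDerivAt).fderiv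
    have e3 : fderiv ℝ (fun y => R.comp (G y)) x u = R.comp (fderiv ℝ G x u) := by
      rw [fderiv_clm_comp (differentiableAt_const R) hGd]
      simp
    have e4 := congrArg (fun L => L u) e2
    simp only [ContinuousLinearMap.comp_apply, e3] at e4
    exact e4
  have hGu : fderiv ℝ G x u = D.adjoint.comp D' + (D.adjoint.comp D').adjoint := by
    have e1 : fderiv ℝ (fun y => (fderiv ℝ f y).adjoint) x u = D'.adjoint := by
      ext1 v
      refine ext_inner_right ℝ fun w => ?_
      have c1 : (fun y => inner ℝ ((fderiv ℝ f y).adjoint v) w) =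
          fun y => inner ℝ v (fderiv ℝ f y w) :=
        funext fun y => ContinuousLinearMap.adjoint_inner_left _ _ _
      have c2 := congrArg (fun g => fderiv ℝ g x u) c1
      rw [fderiv_inner_apply ℝ (had.clm_apply (differentiableAt_const v)) (differentiableAt_const w),
        fderiv_inner_apply ℝ (differentiableAt_const v) (hd.clm_apply (differentiableAt_const w)),
        fderiv_clm_apply had (differentiableAt_const v),
        fderiv_clm_apply hd (differentiableAt_const w)] at c2
      rw [ContinuousLinearMap.adjoint_inner_left]
      simpa using c2
    rw [hG, fderiv_clm_comp had hd]
    simp [e1, ContinuousLinearMap.adjoint_comp]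
    rfl
  have hRs : R.adjoint = R := by
    rw [hR, ContinuousLinearMap.adjoint_comp, ContinuousLinearMap.adjoint_adjoint]
  -- The two terms of the product rule for `G` are adjoint to each other and have equal traces
  -- against the self-adjoint `R`.
  have htr : traceCLM (Eu n) (R.comp (fderiv ℝ G x u)) = 2 * traceCLM (Eu n) (K.comp D') := by
    have e1 : R.comp (D.adjoint.comp D') = K.comp D' := by
      rw [← ContinuousLinearMap.comp_assoc, hKR]
    have e2 : R.comp (D.adjoint.comp D').adjoint = ((D.adjoint.comp D').comp R).adjoint := by
      rw [ContinuousLinearMap.adjoint_comp (D.adjoint.comp D') R, hRs]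
    rw [hGu, ContinuousLinearMap.comp_add, map_add, e2, traceCLM_adjoint,
      traceCLM_comp_comm (D.adjoint.comp D') R, e1]
    ring
  have hJd : DifferentiableAt ℝ (volDensity f) x :=
    (hf.contDiffAt_volDensity hx).differentiableAt (by simp)
  have h1 : fderiv ℝ (fun y => volDensity f y ^ 2) x u =
      2 * volDensity f x * fderiv ℝ (volDensity f) x u := by
    have e1 := (hJd.hasFDerivAt.pow 2).fderiv
    rw [e1]
    simp
  have h2 : fderiv ℝ (fun y => volDensity f y ^ 2) x u =
      (G x).det * fderiv ℝ (fun y => (R.comp (G y)).det) x u := by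
    simp only [hdet]
    rw [fderiv_const_mul]
    · rfl
    · exact (contDiff_det.contDiffAt (n := 1)).differentiableAt (by simp) |>.comp x hRGd
  have h3 : (G x).det = volDensity f x ^ 2 := (volDensity_sq f x).symm
  have hJ := hf.volDensity_pos hx
  rw [h1, hfd, htr, h3] at h2
  have h4 : 2 * volDensity f x * fderiv ℝ (volDensity f) x u =
      2 * volDensity f x * (volDensity f x * traceCLM (Eu n) (K.comp D')) := by
    rw [h2]; ring
  exact mul_left_cancel₀ (by positivity) h4

theorem slope_proj (a : V) : slope π f x (tangentProj f x a) = slope π f x a := by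
  rw [slope_apply, slope_apply, shape, tD_proj]

/-- The logarithmic derivative of the volume density along a tangent vector. -/
theorem fderiv_volDensity_tangent {T : V} (hT : tangentProj f x T = T) :
    fderiv ℝ (volDensity f) x (π T) = - (volDensity f x * slope π f x T) := by
  have h1 : traceCLM (Eu n) ((π.comp (tangentProj f x)).comp (fderiv ℝ (fderiv ℝ f) x (π T))) =
      traceCLM V ((tD π f (obliqueProj π f) x T).comp (tangentProj f x)) := by
    rw [traceCLM_comp_comm']
    congr 1
    have hd : DifferentiableAt ℝ (fderiv ℝ f) x :=
      (hf.contDiffAt_fderiv hx).differentiableAt (by simp)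
    have := tD_clm_comp (π := π) (f := f) hd (differentiableAt_const (x := x) π) T
    rw [tD_const] at this
    simp only [ContinuousLinearMap.comp_zero, zero_apply, add_zero] at this
    have e2 : tD π f (obliqueProj π f) x T = (tD π f (fderiv ℝ f) x T).comp π := this
    rw [e2, tD_apply, hT, ContinuousLinearMap.comp_assoc]
  have h2 : (tD π f (obliqueProj π f) x T).comp (tangentProj f x) =
      (shape π f x T).comp (tangentProj f x) -
        (obliqueProj π f x).comp ((shape π f x T).comp (tangentProj f x)) := by
    ext1 v
    simp only [ContinuousLinearMap.comp_apply, hf.tD_obliqueProj hx, sub_apply,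
      hf.obliqueProj_tangentProj hx]
  -- `Q T` maps tangent vectors to normal ones, so its tangential block has no trace.
  have h3 : traceCLM V ((shape π f x T).comp (tangentProj f x)) = 0 := by
    have e1 : (shape π f x T).comp (tangentProj f x) =
        ((shape π f x T).comp (tangentProj f x)).comp (tangentProj f x) := by
      ext1 v
      simp only [ContinuousLinearMap.comp_apply, tangentProj_proj]
    rw [e1, traceCLM_comp_comm]
    have e2 : (tangentProj f x).comp ((shape π f x T).comp (tangentProj f x)) = 0 := by
      ext1 v
      have := hf.shape_swap hx T (tangentProj f x v)
      rw [tangentProj_proj] at this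
      simpa using this
    rw [e2, map_zero]
  have h4 : traceCLM V ((obliqueProj π f x).comp ((shape π f x T).comp (tangentProj f x))) =
      slope π f x T := by
    rw [← ContinuousLinearMap.comp_assoc, traceCLM_comp_comm, ← ContinuousLinearMap.comp_assoc,
      slope_apply]
    congr 2
    ext1 v
    exact hf.tangentProj_obliqueProj hx v
  rw [hf.fderiv_volDensity hx, h1, h2, map_sub, h3, h4]
  ring

/-- The divergence of `J • π T` in the parameter domain is `J` times the tangential divergence of
`T`. -/
theorem trace_fderiv_volDensity_smul {T : Eu n → V} (hT : DifferentiableAt ℝ T x)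
    (hTP : ∀ y ∈ U, tangentProj f y (T y) = T y) :
    traceCLM (Eu n) (fderiv ℝ (fun y => volDensity f y • π (T y)) x) =
      volDensity f x * traceCLM V (tD π f T x) := by
  have hJd : DifferentiableAt ℝ (volDensity f) x :=
    (hf.contDiffAt_volDensity hx).differentiableAt (by simp)
  have hP := hf.differentiableAt_tangentProj hx
  have h1 : fderiv ℝ (fun y => volDensity f y • π (T y)) x =
      volDensity f x • π.comp (fderiv ℝ T x) +
        (fderiv ℝ (volDensity f) x).smulRight (π (T x)) := by
    have e := π.hasFDerivAt.comp x hT.hasFDerivAt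
    exact (hJd.hasFDerivAt.smul e).fderiv
  have h2 : traceCLM (Eu n) ((fderiv ℝ (volDensity f) x).smulRight (π (T x))) =
      fderiv ℝ (volDensity f) x (π (T x)) := by
    rw [traceCLM_apply (EuclideanSpace.basisFun (Fin n) ℝ)]
    conv_rhs => rw [← (EuclideanSpace.basisFun (Fin n) ℝ).sum_repr' (π (T x)), map_sum]
    refine Finset.sum_congr rfl fun i _ => ?_
    simp [inner_smul_right, mul_comm]
  -- Differentiating `P T = T` splits off a term whose trace is `slope T`; this cancels the
  -- derivative of the density in the final sum.
  have h3 : (fderiv ℝ T x).comp π = (shape π f x (T x)).comp (obliqueProj π f x) +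
      (tangentProj f x).comp ((fderiv ℝ T x).comp π) := by
    ext1 v
    have e1 : (fun y => tangentProj f y (T y)) =ᶠ[𝓝 x] T :=
      (hf.eventually_mem hx).mono fun y hy => hTP y hy
    have e2 := congrArg (fun L => L (π v)) (e1.fderiv_eq (𝕜 := ℝ))
    rw [fderiv_clm_apply hP hT] at e2
    have e3 : fderiv ℝ (tangentProj f) x (π v) (T x) =
        shape π f x (T x) (obliqueProj π f x v) := by
      rw [← hf.tangentProj_obliqueProj hx v, hf.shape_comm hx, hTP x hx, shape, tD_apply,
        hf.tangentProj_obliqueProj hx, obliqueProj, ContinuousLinearMap.comp_apply,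
        hf.proj_fderiv hx]
    simp only [ContinuousLinearMap.comp_apply, add_apply] at e2 ⊢
    rw [← e3]
    exact e2.symm.trans (add_comm _ _)
  have h4 : traceCLM V ((fderiv ℝ T x).comp π) = slope π f x (T x) + traceCLM V (tD π f T x) := by
    rw [h3, map_add, traceCLM_comp_comm, ← slope_apply, traceCLM_comp_comm (tangentProj f x)]
    rfl
  rw [h1, map_add, map_smul, h2, traceCLM_comp_comm', h4,
    hf.fderiv_volDensity_tangent hx (hTP x hx), smul_eq_mul]
  ring

omit hx in
/-- The divergence theorem for compactly supported tangential covector fields. -/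
theorem integral_volDensity_mul_divergence {ι : Type*} [Fintype ι] (b : OrthonormalBasis ι ℝ V)
    {α : Eu n → V →L[ℝ] ℝ} (hα : ∀ y ∈ U, ContDiffAt ℝ 1 α y) (hc : HasCompactSupport α)
    (hs : tsupport α ⊆ U) (hαP : ∀ y ∈ U, ∀ v, α y (tangentProj f y v) = α y v) :
    ∫ y, volDensity f y * ∑ d, tD π f α y (b d) (b d) = 0 := by
  -- This is the vector field dual to `α`; it is tangential because `α` ignores normal components.
  set T : Eu n → V := fun y => ∑ d, α y (b d) • b d with hT
  set X : Eu n → Eu n := fun y => volDensity f y • π (T y) with hX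
  have hT0 : ∀ y, α y = 0 → T y = 0 := fun y hy => by simp [hT, hy]
  have hXs : Function.support X ⊆ Function.support α := by
    intro y hy h
    exact hy (by simp [hX, hT0 y h])
  have hXt : tsupport X ⊆ tsupport α := closure_mono hXs
  have hTd : ∀ y ∈ U, ContDiffAt ℝ 1 T y := fun y hy =>
    ContDiffAt.sum fun d _ => ((hα y hy).clm_apply contDiffAt_const).smul contDiffAt_const
  have hXc : HasCompactSupport X := hc.mono' (hXs.trans subset_closure)
  have hXd : ContDiff ℝ 1 X := by
    rw [contDiff_iff_contDiffAt]
    intro y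
    by_cases hy : y ∈ tsupport X
    · have hyU := hs (hXt hy)
      exact ((hf.contDiffAt_volDensity hyU).of_le (by simp)).smul
        (π.contDiff.contDiffAt.comp y (hTd y hyU))
    · exact (contDiffAt_const (c := (0 : Eu n))).congr_of_eventuallyEq
        (notMem_tsupport_iff_eventuallyEq.1 hy)
  have hTP : ∀ y ∈ U, tangentProj f y (T y) = T y := by
    intro y hy
    have hin : ∀ w, inner ℝ (T y) w = α y w := by
      intro w
      conv_rhs => rw [← b.sum_repr' w, map_sum]
      simp [hT, sum_inner, inner_smul_left, mul_comm]
    refine ext_inner_right ℝ fun w => ?_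
    rw [tangentProj_symm, hin, hin, hαP y hy]
  have hpt : ∀ y, traceCLM (Eu n) (fderiv ℝ X y) =
      volDensity f y * ∑ d, tD π f α y (b d) (b d) := by
    intro y
    by_cases hy : y ∈ tsupport α
    · have hyU := hs hy
      have hαd : DifferentiableAt ℝ α y := (hα y hyU).differentiableAt (by simp)
      rw [hX, hf.trace_fderiv_volDensity_smul hyU ((hTd y hyU).differentiableAt (by simp)) hTP,
        traceCLM_apply b]
      congr 1
      refine Finset.sum_congr rfl fun d _ => ?_
      have e1 : tD π f T y (b d) = ∑ e, tD π f α y (b d) (b e) • b e := by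
        have c1 : ∀ e ∈ Finset.univ, DifferentiableAt ℝ (fun y => α y (b e) • b e) y := fun e _ =>
          (hαd.clm_apply (differentiableAt_const _)).fun_smul (differentiableAt_const _)
        rw [hT, tD_sum c1]
        refine Finset.sum_congr rfl fun e _ => ?_
        rw [tD_smul (hαd.clm_apply (differentiableAt_const _)) (differentiableAt_const _),
          tD_clm_const hαd, tD_const]
        simp
      classical
      rw [e1, inner_sum, Finset.sum_eq_single d]
      · simp [inner_smul_right]
      · intro e _ he
        simp [inner_smul_right, b.inner_eq_zero he.symm]
      · simp
    · have e1 : fderiv ℝ α y = 0 := by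
        rw [(notMem_tsupport_iff_eventuallyEq.1 hy).fderiv_eq]
        exact fderiv_const_apply _
      have e2 : fderiv ℝ X y = 0 := by
        rw [(notMem_tsupport_iff_eventuallyEq.1 fun h => hy (hXt h)).fderiv_eq]
        exact fderiv_const_apply _
      simp [e2, tD, e1]
  simp only [← hpt, traceCLM_apply (EuclideanSpace.basisFun (Fin n) ℝ)]
  have hcont : Continuous (fderiv ℝ X) := hXd.continuous_fderiv (by simp)
  have hint : ∀ u w : Eu n, Integrable fun y => inner ℝ w (fderiv ℝ X y u) := by
    intro u w
    refine Continuous.integrable_of_hasCompactSupport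
      (continuous_const.inner (hcont.clm_apply continuous_const)) ?_
    refine (hXc.fderiv ℝ).mono' fun y hy => subset_closure fun h => hy ?_
    simp [h]
  rw [integral_finsetSum _ fun i _ => hint _ _]
  refine Finset.sum_eq_zero fun i _ => ?_
  set e := EuclideanSpace.basisFun (Fin n) ℝ i
  have hg : Differentiable ℝ fun y => inner ℝ e (X y) :=
    (differentiable_const e).inner ℝ (hXd.differentiable (by simp))
  have hge : ∀ y, fderiv ℝ (fun y => inner ℝ e (X y)) y e = inner ℝ e (fderiv ℝ X y e) := by
    intro y
    rw [fderiv_inner_apply ℝ (differentiableAt_const _) (hXd.differentiable (by simp) y)]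
    simp
  have hgi : Integrable fun y => inner ℝ e (X y) :=
    Continuous.integrable_of_hasCompactSupport (continuous_const.inner hXd.continuous)
      (hXc.mono' fun y hy => subset_closure fun h => hy (by simp [h]))
  -- Integration by parts against the constant function `1` says that the integral of a partial
  -- derivative vanishes.
  have := integral_mul_fderiv_eq_neg_fderiv_mul_of_integrable (μ := volume) (v := e)
    (f := fun _ : Eu n => (1 : ℝ)) (g := fun y => inner ℝ e (X y)) (by simp)
    (by simpa [hge] using hint e e) (by simpa using hgi)
    (fun y _ => differentiableAt_const _) (fun y _ => hg y)
  simpa [hge] using this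

end IsGraphOver

end Divergence
end FlatNormalGraph



/-! ### The area formula for graphs -/

namespace FlatNormalGraph

noncomputable section AreaFormula

open scoped NNReal ENNReal

/-- A local comparison of two measures up to constants close to one gives a global one. -/
theorem measure_le_of_locally_le {E : Type*} [TopologicalSpace E] [SecondCountableTopology E]
    [MeasurableSpace E] [OpensMeasurableSpace E] {μ ν : Measure E} {U : Set E} (k : ℕ)
    (h : ∀ r : ℝ≥0, 1 < r → ∀ x ∈ U, ∃ W ∈ 𝓝 x, ∀ s ⊆ W ∩ U, MeasurableSet s →
      μ s ≤ (r : ℝ≥0∞) ^ k * ν s)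
    {s : Set E} (hs : MeasurableSet s) (hsU : s ⊆ U) : μ s ≤ ν s := by
  have h1 : ∀ r : ℝ≥0, 1 < r → μ s ≤ (r : ℝ≥0∞) ^ k * ν s := by
    intro r hr
    choose! W hW hWs using h r hr
    -- The Lindelöf property gives countably many good neighbourhoods; they are made disjoint so
    -- that both measures add up.
    obtain ⟨t, htU, htc, ht⟩ := TopologicalSpace.countable_cover_nhdsWithin
      (f := fun x => interior (W x)) (s := U)
      fun x hx => mem_nhdsWithin_of_mem_nhds (interior_mem_nhds.2 (hW x hx))
    rcases t.eq_empty_or_nonempty with rfl | hne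
    · have : s = ∅ := Set.subset_empty_iff.1 (hsU.trans (by simpa using ht))
      simp [this]
    obtain ⟨e, rfl⟩ := htc.exists_eq_range hne
    set D : ℕ → Set E := disjointed fun i => interior (W (e i))
    have hDm : ∀ i, MeasurableSet (s ∩ D i) := fun i =>
      hs.inter (MeasurableSet.disjointed (fun i => isOpen_interior.measurableSet) i)
    have hsD : s = ⋃ i, s ∩ D i := by
      rw [← Set.inter_iUnion, iUnion_disjointed, Set.left_eq_inter]
      exact hsU.trans (by simpa using ht)
    have hdisj : Pairwise (Function.onFun Disjoint fun i => s ∩ D i) := fun i j hij =>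
      (disjoint_disjointed _ hij).mono Set.inter_subset_right Set.inter_subset_right
    rw [hsD, measure_iUnion hdisj hDm, measure_iUnion hdisj hDm, ← ENNReal.tsum_mul_left]
    refine ENNReal.tsum_le_tsum fun i => ?_
    exact hWs _ (htU ⟨i, rfl⟩) _
      (fun y hy => ⟨interior_subset (disjointed_subset _ i hy.2), hsU hy.1⟩) (hDm i)
  have h2 : Filter.Tendsto (fun r : ℝ≥0 => (r : ℝ≥0∞) ^ k * ν s) (𝓝[>] 1) (𝓝 (1 ^ k * ν s)) := by
    refine ENNReal.Tendsto.mul_const ?_ (by simp)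
    refine Filter.Tendsto.mono_left ?_ nhdsWithin_le_nhds
    exact ((ENNReal.continuous_pow k).comp ENNReal.continuous_coe).tendsto' 1 _ (by simp)
  rw [one_pow, one_mul] at h2
  exact ge_of_tendsto h2 (Filter.eventually_of_mem self_mem_nhdsWithin fun r hr => h1 r hr)

/-- The distance bound makes `f ∘ g⁻¹` well defined and `r`-Lipschitz on `g '' s`, for any choice of
inverse. -/
theorem euclideanHausdorffMeasure_image_le {X Y Z : Type*} [Nonempty X] [MetricSpace Y]
    [MeasurableSpace Y] [BorelSpace Y] [MetricSpace Z] [MeasurableSpace Z] [BorelSpace Z]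
    {f : X → Y} {g : X → Z} {s : Set X} {r : ℝ≥0} (n : ℕ)
    (h : ∀ y ∈ s, ∀ z ∈ s, dist (f y) (f z) ≤ r * dist (g y) (g z)) :
    μHE[n] (f '' s) ≤ (r : ℝ≥0∞) ^ n * μHE[n] (g '' s) := by
  set i := Function.invFunOn g s
  have hi : ∀ y ∈ s, i (g y) ∈ s ∧ g (i (g y)) = g y := fun y hy =>
    ⟨Function.invFunOn_mem ⟨y, hy, rfl⟩, Function.invFunOn_eq ⟨y, hy, rfl⟩⟩
  have himg : f '' s = (f ∘ i) '' (g '' s) := by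
    rw [Set.image_image]
    refine Set.image_congr fun y hy => ?_
    have := h y hy _ (hi y hy).1
    rw [(hi y hy).2, dist_self, mul_zero] at this
    exact dist_le_zero.1 this
  have hlip : LipschitzOnWith r (f ∘ i) (g '' s) := by
    refine LipschitzOnWith.of_dist_le_mul ?_
    rintro _ ⟨y, hy, rfl⟩ _ ⟨z, hz, rfl⟩
    have := h _ (hi y hy).1 _ (hi z hz).1
    rwa [(hi y hy).2, (hi z hz).2] at this
  rw [himg, Measure.euclideanHausdorffMeasure_def, Measure.euclideanHausdorffMeasure_def,
    Measure.smul_apply, Measure.smul_apply, ENNReal.smul_def, ENNReal.smul_def, smul_eq_mul,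
    smul_eq_mul, mul_left_comm]
  have := hlip.hausdorffMeasure_image_le (d := n) (by positivity)
  rw [ENNReal.rpow_natCast] at this
  gcongr

variable {n : ℕ} {V : Type*} [NormedAddCommGroup V] [InnerProductSpace ℝ V]
  [FiniteDimensional ℝ V] {π : V →L[ℝ] Eu n} {f : Eu n → V} {U : Set (Eu n)} {x : Eu n}

theorem measurable_volDensity (f : Eu n → V) : Measurable (volDensity f) := by
  borelize V
  have := FiniteDimensional.complete ℝ V
  have h1 : volDensity f = fun y => √(((fderiv ℝ f y).adjoint.comp (fderiv ℝ f y)).det) := by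
    funext y
    rw [← volDensity_sq, Real.sqrt_sq (volDensity_nonneg f y)]
  rw [h1]
  have h2 : Continuous fun A : Eu n →L[ℝ] V => √((A.adjoint.comp A).det) :=
    Real.continuous_sqrt.comp ((contDiff_det (N := 0)).continuous.comp
      (ContinuousLinearMap.adjoint.continuous.clm_comp continuous_id))
  exact h2.measurable.comp (measurable_fderiv ℝ f)

namespace IsGraphOver

variable (hf : IsGraphOver π f U)
include hf

/-- Strict differentiability makes the error of linearization a small multiple of `‖y - z‖`, and the
left inverse `π` of `df` bounds this by `‖df (y - z)‖`. Thus `f` is nearly isometric to its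
linearization. -/
theorem exists_nhds_dist_le (hx : x ∈ U) {r : ℝ≥0} (hr : 1 < r) : ∃ W ∈ 𝓝 x, ∀ y ∈ W, ∀ z ∈ W,
    dist (f y) (f z) ≤ r * dist (fderiv ℝ f x y) (fderiv ℝ f x z) ∧
    dist (fderiv ℝ f x y) (fderiv ℝ f x z) ≤ r * dist (f y) (f z) := by
  have hs : HasStrictFDerivAt f (fderiv ℝ f x) x :=
    (hf.contDiffAt hx).hasStrictFDerivAt (by simp)
  set L := fderiv ℝ f x
  -- `‖v‖ ≤ M ‖L v‖`
  set M := ‖π‖ + 1 with hM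
  have hMpos : 0 < M := by positivity
  have hLM : ∀ v, ‖v‖ ≤ M * ‖L v‖ := fun v => by
    calc ‖v‖ = ‖π (L v)‖ := by rw [hf.proj_fderiv hx]
      _ ≤ ‖π‖ * ‖L v‖ := π.le_opNorm _
      _ ≤ M * ‖L v‖ := by gcongr; simp [hM]
  have hr' : (1 : ℝ) < r := hr
  set c : ℝ := (1 - (r : ℝ)⁻¹) / M with hc
  have hrinv : (r : ℝ)⁻¹ < 1 := inv_lt_one_of_one_lt₀ hr'
  have hc0 : 0 < c := div_pos (by linarith) hMpos
  have hcr : (1 - (r : ℝ)⁻¹) ≤ r - 1 := by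
    have : (r : ℝ)⁻¹ * r = 1 := inv_mul_cancel₀ (by linarith)
    nlinarith [sq_nonneg ((r : ℝ) - 1)]
  obtain ⟨W, hW, hWc⟩ := hs.approximates_deriv_on_nhds (c := ⟨c, hc0.le⟩) (Or.inr hc0)
  refine ⟨W, hW, fun y hy z hz => ?_⟩
  have h1 : ‖f y - f z - L (y - z)‖ ≤ (1 - (r : ℝ)⁻¹) * ‖L (y - z)‖ := by
    refine (hWc y hy z hz).trans ?_
    calc c * ‖y - z‖ ≤ c * (M * ‖L (y - z)‖) := by gcongr; exact hLM _
      _ = _ := by rw [hc]; field_simp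
  rw [dist_eq_norm, dist_eq_norm, ← map_sub]
  have h2 : ‖f y - f z‖ ≤ ‖f y - f z - L (y - z)‖ + ‖L (y - z)‖ := by
    simpa using norm_add_le (f y - f z - L (y - z)) (L (y - z))
  have h3 : ‖L (y - z)‖ ≤ ‖f y - f z‖ + ‖f y - f z - L (y - z)‖ := by
    have := norm_sub_le (f y - f z) (f y - f z - L (y - z))
    rwa [sub_sub_cancel] at this
  constructor
  · nlinarith [norm_nonneg (L (y - z))]
  · have : (r : ℝ)⁻¹ * ‖L (y - z)‖ ≤ ‖f y - f z‖ := by linarith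
    rwa [inv_mul_le_iff₀ (by linarith)] at this

variable [MeasurableSpace V] [BorelSpace V]

/-- The area formula. -/
theorem map_euclideanHausdorffMeasure : ((μHE[n] : Measure V).restrict (f '' U)).map π =
    (volume.restrict U).withDensity fun y => ENNReal.ofReal (volDensity f y) := by
  set ρ := ((μHE[n] : Measure V).restrict (f '' U)).map π
  set ν := (volume.restrict U).withDensity fun y => ENNReal.ofReal (volDensity f y)
  have hJ : Measurable fun y => ENNReal.ofReal (volDensity f y) :=
    (measurable_volDensity f).ennreal_ofReal
  have hUm : MeasurableSet U := hf.isOpen.measurableSet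
  have hρ : ∀ s, MeasurableSet s → ρ s = μHE[n] (f '' (s ∩ U)) := by
    intro s hs
    rw [Measure.map_apply π.measurable hs, Measure.restrict_apply (π.measurable hs)]
    congr 1
    ext v
    constructor
    · rintro ⟨hv, y, hy, rfl⟩
      rw [Set.mem_preimage, hf.proj y hy] at hv
      exact ⟨y, ⟨hv, hy⟩, rfl⟩
    · rintro ⟨y, ⟨hys, hy⟩, rfl⟩
      exact ⟨by rwa [Set.mem_preimage, hf.proj y hy], y, hy, rfl⟩
  have hν : ∀ s, MeasurableSet s → ν s = ∫⁻ y in s ∩ U, ENNReal.ofReal (volDensity f y) := by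
    intro s hs
    rw [withDensity_apply _ hs, Measure.restrict_restrict hs]
  -- Of the `n + 1` factors `r`, `n` come from comparing `f` with its linearization at `x`, and one
  -- from freezing the density at `x`.
  have key : ∀ r : ℝ≥0, 1 < r → ∀ x ∈ U, ∃ W ∈ 𝓝 x, ∀ s ⊆ W ∩ U, MeasurableSet s →
      ρ s ≤ (r : ℝ≥0∞) ^ (n + 1) * ν s ∧ ν s ≤ (r : ℝ≥0∞) ^ (n + 1) * ρ s := by
    intro r hr x hx
    have hr' : (1 : ℝ) < r := hr
    obtain ⟨W, hW, hWd⟩ := hf.exists_nhds_dist_le hx hr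
    have hJ0 := hf.volDensity_pos hx
    have hJc := (hf.contDiffAt_volDensity hx).continuousAt
    have e1 : ∀ᶠ y in 𝓝 x, volDensity f y < r * volDensity f x :=
      hJc.eventually_lt continuousAt_const (by nlinarith)
    have e2 : ∀ᶠ y in 𝓝 x, volDensity f x < r * volDensity f y :=
      continuousAt_const.eventually_lt (continuousAt_const.mul hJc) (by nlinarith)
    refine ⟨W ∩ {y | volDensity f y < r * volDensity f x ∧ volDensity f x < r * volDensity f y},
      Filter.inter_mem hW (e1.and e2), fun s hs hsm => ?_⟩
    have hsU : s ∩ U = s := Set.inter_eq_left.2 fun y hy => (hs hy).2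
    have hlin : μHE[n] (fderiv ℝ f x '' s) = ENNReal.ofReal (volDensity f x) * volume s := by
      have := (fderiv ℝ f x).toLinearMap.euclideanHausdorffMeasure_image_eq_normDet_mul_volume s
      rwa [finrank_euclideanSpace_fin] at this
    have hcoe : ∀ y, ENNReal.ofReal (r * volDensity f y) =
        (r : ℝ≥0∞) * ENNReal.ofReal (volDensity f y) := fun y => by
      rw [ENNReal.ofReal_mul (by positivity), ENNReal.ofReal_coe_nnreal]
    have a1 : ENNReal.ofReal (volDensity f x) * volume s ≤ r * ν s := by
      rw [hν s hsm, hsU, ← lintegral_const_mul _ hJ, ← setLIntegral_const]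
      refine setLIntegral_mono (hJ.const_mul _) fun y hy => ?_
      rw [← hcoe]
      exact ENNReal.ofReal_le_ofReal (hs hy).1.2.2.le
    have a2 : ν s ≤ r * (ENNReal.ofReal (volDensity f x) * volume s) := by
      rw [hν s hsm, hsU, ← mul_assoc, ← hcoe, ← setLIntegral_const]
      refine setLIntegral_mono measurable_const fun y hy => ?_
      exact ENNReal.ofReal_le_ofReal (hs hy).1.2.1.le
    have b1 := euclideanHausdorffMeasure_image_le (f := f) (g := fderiv ℝ f x) (s := s) n
      fun y hy z hz => (hWd y (hs hy).1.1 z (hs hz).1.1).1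
    have b2 := euclideanHausdorffMeasure_image_le (f := fderiv ℝ f x) (g := f) (s := s) n
      fun y hy z hz => (hWd y (hs hy).1.1 z (hs hz).1.1).2
    rw [hlin] at b1 b2
    rw [hρ s hsm, hsU, pow_succ, mul_assoc, mul_assoc]
    refine ⟨b1.trans (mul_le_mul' le_rfl a1), a2.trans ?_⟩
    rw [mul_left_comm ((r : ℝ≥0∞) ^ n)]
    exact mul_le_mul' le_rfl b2
  refine Measure.ext fun s hs => ?_
  have hsU : MeasurableSet (s ∩ U) := hs.inter hUm
  have r1 : ρ s = ρ (s ∩ U) := by rw [hρ s hs, hρ _ hsU, Set.inter_assoc, Set.inter_self]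
  have r2 : ν s = ν (s ∩ U) := by rw [hν s hs, hν _ hsU, Set.inter_assoc, Set.inter_self]
  rw [r1, r2]
  refine le_antisymm ?_ ?_
  · refine measure_le_of_locally_le (n + 1) (fun r hr x hx => ?_) hsU Set.inter_subset_right
    obtain ⟨W, hW, h⟩ := key r hr x hx
    exact ⟨W, hW, fun s h1 h2 => (h s h1 h2).1⟩
  · refine measure_le_of_locally_le (n + 1) (fun r hr x hx => ?_) hsU Set.inter_subset_right
    obtain ⟨W, hW, h⟩ := key r hr x hx
    exact ⟨W, hW, fun s h1 h2 => (h s h1 h2).2⟩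

theorem integrableOn_image_iff {F : Eu n → ℝ}
    (hF : AEStronglyMeasurable F (volume.restrict U)) :
    IntegrableOn (fun v => F (π v)) (f '' U) μHE[n] ↔
      IntegrableOn (fun y => volDensity f y * F y) U := by
  have h1 : AEStronglyMeasurable F (((μHE[n] : Measure V).restrict (f '' U)).map π) := by
    rw [hf.map_euclideanHausdorffMeasure]
    exact hF.mono_ac (withDensity_absolutelyContinuous _ _)
  rw [IntegrableOn, ← Function.comp_def F π,
    ← integrable_map_measure h1 π.measurable.aemeasurable, hf.map_euclideanHausdorffMeasure,
    integrable_withDensity_iff_integrable_smul' (measurable_volDensity f).ennreal_ofReal (by simp)]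
  simp only [ENNReal.toReal_ofReal (volDensity_nonneg f _), smul_eq_mul]
  rfl

theorem integral_image_eq {F : Eu n → ℝ}
    (hF : AEStronglyMeasurable F (volume.restrict U)) :
    ∫ v in f '' U, F (π v) ∂μHE[n] = ∫ y in U, volDensity f y * F y := by
  have h1 : AEStronglyMeasurable F (((μHE[n] : Measure V).restrict (f '' U)).map π) := by
    rw [hf.map_euclideanHausdorffMeasure]
    exact hF.mono_ac (withDensity_absolutelyContinuous _ _)
  rw [← integral_map π.measurable.aemeasurable h1, hf.map_euclideanHausdorffMeasure,
    integral_withDensity_eq_integral_toReal_smul (measurable_volDensity f).ennreal_ofReal (by simp)]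
  simp only [ENNReal.toReal_ofReal (volDensity_nonneg f _), smul_eq_mul]

end IsGraphOver

end AreaFormula
end FlatNormalGraph



/-! ### Continuity of the curvature quantities -/

namespace FlatNormalGraph

noncomputable section Continuity

variable {n : ℕ} {V : Type*} [NormedAddCommGroup V] [InnerProductSpace ℝ V]
  [FiniteDimensional ℝ V] {π : V →L[ℝ] Eu n} {f : Eu n → V} {U : Set (Eu n)} {x : Eu n}

/-- The contraction `⟨A, ∇∇H⟩`. -/
def hessPairing (f : Eu n → V) (x : Eu n) : ℝ :=
  ∑ i, ∑ j, inner ℝ (secondFund f x (frameCoord f x i) (frameCoord f x j))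
    (covCovMeanCurv f x (frameCoord f x i) (frameCoord f x j))

theorem tD_rpow_const {u : Eu n → ℝ} {r : ℝ} (hu : DifferentiableAt ℝ u x)
    (h : u x ≠ 0 ∨ 1 ≤ r) (a : V) :
    tD π f (fun y => u y ^ r) x a = r * u x ^ (r - 1) * tD π f u x a := by
  rw [tD_apply, (hu.hasFDerivAt.rpow_const h).fderiv]
  rfl

theorem norm_secondFund_frame_le (f : Eu n → V) (x : Eu n) (i j : Fin n) :
    ‖secondFund f x (frameCoord f x i) (frameCoord f x j)‖ ≤ normSecondFund f x := by
  rw [normSecondFund]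
  refine Real.le_sqrt_of_sq_le ?_
  refine le_trans ?_ (Finset.single_le_sum (f := fun i => ∑ j, ‖secondFund f x (frameCoord f x i)
    (frameCoord f x j)‖ ^ 2) (fun _ _ => Finset.sum_nonneg fun _ _ => by positivity)
    (Finset.mem_univ i))
  exact Finset.single_le_sum (f := fun j => ‖secondFund f x (frameCoord f x i)
    (frameCoord f x j)‖ ^ 2) (fun _ _ => by positivity) (Finset.mem_univ j)

/-- `K₂` may jump at zeros of `A`, but the product `|A| K₂` that enters Simons' inequality is
continuous. -/
theorem normSecondFund_mul_K₂ (f : Eu n → V) (x : Eu n) :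
    normSecondFund f x * K₂ f x = max (-hessPairing f x) 0 := by
  rw [K₂]
  split_ifs with h
  · rw [mul_max_of_nonneg _ _ h.le, mul_zero, mul_neg, mul_div_cancel₀ _ h.ne']
    rfl
  · have h0 : normSecondFund f x = 0 := le_antisymm (not_lt.1 h) (Real.sqrt_nonneg _)
    have h2 : ∀ i j, secondFund f x (frameCoord f x i) (frameCoord f x j) = 0 := fun i j =>
      norm_le_zero_iff.1 ((norm_secondFund_frame_le f x i j).trans_eq h0)
    simp [hessPairing, h2]

theorem K₂_nonneg (f : Eu n → V) (x : Eu n) : 0 ≤ K₂ f x := by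
  rw [K₂]
  split_ifs
  exacts [le_max_right _ _, le_rfl]

theorem normCovMeanCurv_nonneg (f : Eu n → V) (x : Eu n) : 0 ≤ normCovMeanCurv f x :=
  Real.sqrt_nonneg _

theorem normGrad_nonneg (f : Eu n → V) (φ : Eu n → ℝ) (x : Eu n) : 0 ≤ normGrad f φ x :=
  Real.sqrt_nonneg _

namespace IsGraphOver

variable (hf : IsGraphOver π f U) (hx : x ∈ U)
include hf hx

theorem continuousAt_tD {G : Type*} [NormedAddCommGroup G] [NormedSpace ℝ G] {u : Eu n → G}
    (hu : ContDiffAt ℝ 1 u x) : ContinuousAt (tD π f u) x :=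
  (hu.fderiv_right (m := 0) (by simp)).continuousAt.clm_comp
    (continuousAt_const.clm_comp (hf.contDiffAt_tangentProj hx).continuousAt)

theorem continuousAt_normGrad {φ : Eu n → ℝ} (hφ : ContDiffAt ℝ 1 φ x)
    (hflat : HasFlatNormalBundle f U) : ContinuousAt (normGrad f φ) x := by
  have h1 : normGrad f φ =ᶠ[𝓝 x]
      fun y => √(∑ d, tD π f φ y (stdOrthonormalBasis ℝ V d) ^ 2) :=
    (hf.eventually_mem hx).mono fun y hy => by
      beta_reduce
      rw [← hf.sq_normGrad hy hflat, Real.sqrt_sq (normGrad_nonneg f φ y)]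
  refine ContinuousAt.congr ?_ h1.symm
  refine ContinuousAt.sqrt (tendsto_finsetSum _ fun d _ => ?_)
  exact ((hf.continuousAt_tD hx hφ).clm_apply continuousAt_const).pow 2

theorem continuousAt_normSecondFund (hflat : HasFlatNormalBundle f U) :
    ContinuousAt (normSecondFund f) x := by
  have h1 : normSecondFund f = fun y => √(normSecondFund f y ^ 2) :=
    funext fun y => (Real.sqrt_sq (normSecondFund_nonneg f y)).symm
  rw [h1]
  exact (hf.contDiffAt_sq_normSecondFund hx hflat).continuousAt.sqrt

/-- This trades the Gram–Schmidt frame for projections of a fixed basis, which depend smoothly on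
the point. -/
theorem sum_inner_frame_frame {W : Type*} [NormedAddCommGroup W] [InnerProductSpace ℝ W]
    {ι : Type*} [Fintype ι] (b : OrthonormalBasis ι ℝ V) (S T : V →L[ℝ] V →L[ℝ] W) :
    ∑ i, ∑ j, inner ℝ (S (frame f x i) (frame f x j)) (T (frame f x i) (frame f x j)) =
      ∑ a, ∑ c, inner ℝ (S (tangentProj f x (b a)) (tangentProj f x (b c)))
        (T (tangentProj f x (b a)) (tangentProj f x (b c))) := by
  have key : ∀ S T : V →L[ℝ] W, ∑ j, inner ℝ (S (frame f x j)) (T (frame f x j)) =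
      ∑ c, inner ℝ (S (tangentProj f x (b c))) (T (tangentProj f x (b c))) := fun S T => by
    have := b.sum_bilin_eq (tangentProj f x) (frame f x) (hf.orthonormal_frame hx)
      (hf.tangentProj_eq_sum_frame hx)
      (LinearMap.mk₂ ℝ (fun a c => inner ℝ (S a) (T c)) (by simp [inner_add_left])
        (by simp [inner_smul_left]) (by simp [inner_add_right]) (by simp [inner_smul_right]))
    exact this.symm
  calc _ = ∑ i, ∑ c, inner ℝ (S (frame f x i) (tangentProj f x (b c)))
        (T (frame f x i) (tangentProj f x (b c))) :=
        Finset.sum_congr rfl fun i _ => key (S (frame f x i)) (T (frame f x i))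
    _ = ∑ c, ∑ i, inner ℝ (S.flip (tangentProj f x (b c)) (frame f x i))
        (T.flip (tangentProj f x (b c)) (frame f x i)) := Finset.sum_comm
    _ = ∑ c, ∑ a, inner ℝ (S.flip (tangentProj f x (b c)) (tangentProj f x (b a)))
        (T.flip (tangentProj f x (b c)) (tangentProj f x (b a))) :=
        Finset.sum_congr rfl fun c _ =>
          key (S.flip (tangentProj f x (b c))) (T.flip (tangentProj f x (b c)))
    _ = _ := Finset.sum_comm

variable (hflat : HasFlatNormalBundle f U)
include hflat

theorem contDiffAt_tD_meanCurv : ContDiffAt ℝ ∞ (tD π f (meanCurv f)) x :=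
  hf.contDiffAt_tD hx (hf.contDiffAt_meanCurv hx hflat)

theorem continuousAt_hessMeanCurv : ContinuousAt (hessMeanCurv π f) x := by
  have h1 := (hf.contDiffAt_tD_meanCurv hx hflat)
  have h2 := hf.contDiffAt_tD hx h1
  refine ContinuousAt.clm_comp ?_ (h2.continuousAt.sub (ContinuousAt.clm_comp ?_
    (hf.contDiffAt_shape hx).continuousAt))
  · exact (ContinuousLinearMap.continuous _).continuousAt.comp
      (continuousAt_const.sub (hf.contDiffAt_tangentProj hx).continuousAt)
  · exact (ContinuousLinearMap.continuous _).continuousAt.comp h1.continuousAt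

theorem continuousAt_hessPairing : ContinuousAt (hessPairing f) x := by
  have h1 : hessPairing f =ᶠ[𝓝 x] fun y => ∑ a, ∑ c,
      inner ℝ (shape π f y (tangentProj f y (stdOrthonormalBasis ℝ V a))
        (tangentProj f y (stdOrthonormalBasis ℝ V c)))
        (hessMeanCurv π f y (tangentProj f y (stdOrthonormalBasis ℝ V a))
        (tangentProj f y (stdOrthonormalBasis ℝ V c))) :=
    (hf.eventually_mem hx).mono fun y hy => by
      beta_reduce
      rw [hessPairing, ← hf.sum_inner_frame_frame hy]
      simp only [hf.secondFund_frame hy, hf.covCovMeanCurv_frame hy hflat]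
  refine ContinuousAt.congr ?_ h1.symm
  have hP : ∀ v, ContinuousAt (fun y => tangentProj f y v) x := fun v =>
    (hf.contDiffAt_tangentProj hx).continuousAt.clm_apply continuousAt_const
  refine tendsto_finsetSum _ fun a _ => tendsto_finsetSum _ fun c _ => ?_
  exact ((((hf.contDiffAt_shape hx).continuousAt.clm_apply (hP _)).clm_apply (hP _)).inner
    (((hf.continuousAt_hessMeanCurv hx hflat).clm_apply (hP _)).clm_apply (hP _)))

theorem continuousAt_normCovMeanCurv : ContinuousAt (normCovMeanCurv f) x := by
  have h1 : normCovMeanCurv f =ᶠ[𝓝 x] fun y => √(∑ c,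
      ‖tD π f (meanCurv f) y (stdOrthonormalBasis ℝ V c) -
        tangentProj f y (tD π f (meanCurv f) y (stdOrthonormalBasis ℝ V c))‖ ^ 2) :=
    (hf.eventually_mem hx).mono fun y hy => by
      beta_reduce
      set N := tD π f (meanCurv f) y - (tangentProj f y).comp (tD π f (meanCurv f) y) with hN
      have := (stdOrthonormalBasis ℝ V).sum_bilin_eq (tangentProj f y) (frame f y)
        (hf.orthonormal_frame hy) (hf.tangentProj_eq_sum_frame hy)
        (LinearMap.mk₂ ℝ (fun a c => inner ℝ (N a) (N c)) (by simp [inner_add_left])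
        (by simp [inner_smul_left]) (by simp [inner_add_right]) (by simp [inner_smul_right]))
      simp only [LinearMap.mk₂_apply, hN, sub_apply, ContinuousLinearMap.comp_apply,
        tD_proj, real_inner_self_eq_norm_sq] at this
      rw [normCovMeanCurv, this]
      simp only [hf.covMeanCurv_frame hy hflat]
  refine ContinuousAt.congr ?_ h1.symm
  have hH : ∀ v, ContinuousAt (fun y => tD π f (meanCurv f) y v) x := fun v =>
    (hf.contDiffAt_tD_meanCurv hx hflat).continuousAt.clm_apply continuousAt_const
  refine ContinuousAt.sqrt (tendsto_finsetSum _ fun d _ => ?_)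
  exact (((hH _).sub ((hf.contDiffAt_tangentProj hx).continuousAt.clm_apply (hH _))).norm).pow 2

/-- Solving `sum_tD_slope` for the trace expresses it by smooth fields and a fixed basis. -/
theorem continuousAt_traceGradMeanCurv : ContinuousAt (traceGradMeanCurv π f) x := by
  have h1 : traceGradMeanCurv π f =ᶠ[𝓝 x] fun y =>
      ∑ d, tD π f (slope π f) y (stdOrthonormalBasis ℝ V d) (stdOrthonormalBasis ℝ V d) +
        normSecondFund f y ^ 2 + ∑ d, slope π f y (stdOrthonormalBasis ℝ V d) ^ 2 :=
    (hf.eventually_mem hx).mono fun y hy => by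
      beta_reduce
      rw [hf.sum_tD_slope hy hflat]
      ring
  refine ContinuousAt.congr ?_ h1.symm
  refine ((tendsto_finsetSum _ fun d _ => ?_).add
    ((hf.continuousAt_normSecondFund hx hflat).pow 2)).add (tendsto_finsetSum _ fun d _ => ?_)
  · exact ((hf.contDiffAt_tD hx (hf.contDiffAt_slope hx)).continuousAt.clm_apply
      continuousAt_const).clm_apply continuousAt_const
  · exact ((hf.contDiffAt_slope hx).continuousAt.clm_apply continuousAt_const).pow 2

/-- The factor `|A|` from Cauchy–Schwarz cancels the denominator. Hence `K₂` has a continuous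
majorant over `U`, which gives integrability although `K₂` may be discontinuous. -/
theorem K₂_le : K₂ f x ≤ (n : ℝ) ^ 2 * ‖hessMeanCurv π f x‖ := by
  rw [K₂]
  split_ifs with h
  · refine max_le ?_ (by positivity)
    rw [← neg_div, div_le_iff₀ h]
    have hn : ∀ i, ‖frame f x i‖ = 1 := (hf.orthonormal_frame hx).1
    calc -(∑ i, ∑ j, inner ℝ (secondFund f x (frameCoord f x i) (frameCoord f x j))
          (covCovMeanCurv f x (frameCoord f x i) (frameCoord f x j)))
        = ∑ i, ∑ j, -inner ℝ (secondFund f x (frameCoord f x i) (frameCoord f x j))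
          (covCovMeanCurv f x (frameCoord f x i) (frameCoord f x j)) := by
          simp only [Finset.sum_neg_distrib]
      _ ≤ ∑ _i : Fin n, ∑ _j : Fin n, normSecondFund f x * ‖hessMeanCurv π f x‖ := by
          refine Finset.sum_le_sum fun i _ => Finset.sum_le_sum fun j _ => ?_
          refine (neg_le_abs _).trans ((abs_real_inner_le_norm _ _).trans ?_)
          rw [hf.covCovMeanCurv_frame hx hflat]
          have := (hessMeanCurv π f x).le_opNorm₂ (frame f x i) (frame f x j)
          rw [hn, hn, mul_one, mul_one] at this
          exact mul_le_mul (norm_secondFund_frame_le f x i j) this (norm_nonneg _)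
            (normSecondFund_nonneg f x)
      _ = (n : ℝ) ^ 2 * ‖hessMeanCurv π f x‖ * normSecondFund f x := by
          simp only [Finset.sum_const, Finset.card_univ, Fintype.card_fin, nsmul_eq_mul]
          ring
  · positivity

end IsGraphOver

end Continuity

/-! ### Integrating pointwise inequalities -/

noncomputable section Integration

variable {n : ℕ} {V : Type*} [NormedAddCommGroup V] [InnerProductSpace ℝ V]
  [FiniteDimensional ℝ V] {π : V →L[ℝ] Eu n} {f : Eu n → V} {U K : Set (Eu n)}

namespace IsGraphOver

variable (hf : IsGraphOver π f U)
include hf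

theorem integrable_volDensity_mul (hK : IsCompact K) (hKU : K ⊆ U) {g : Eu n → ℝ}
    (hg : ContinuousOn g U) (hg0 : ∀ y ∉ K, g y = 0) :
    Integrable fun y => volDensity f y * g y := by
  have hK0 : ∀ y ∉ K, volDensity f y * g y = 0 := fun y hy => by rw [hg0 y hy, mul_zero]
  refine Continuous.integrable_of_hasCompactSupport ?_ (HasCompactSupport.intro hK hK0)
  rw [continuous_iff_continuousAt]
  intro y
  by_cases hy : y ∈ K
  · exact (hf.contDiffAt_volDensity (hKU hy)).continuousAt.mul
      (hg.continuousAt (hf.isOpen.mem_nhds (hKU hy)))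
  · refine continuousAt_const.congr (f := fun _ => (0 : ℝ)) ?_
    filter_upwards [hK.isClosed.isOpen_compl.mem_nhds hy] with z hz using (hK0 z hz).symm

/-- An integral inequality that follows from a pointwise one up to a divergence. -/
theorem integral_le_of_add_divergence_le (hK : IsCompact K) (hKU : K ⊆ U) {ι : Type*} [Fintype ι]
    (b : OrthonormalBasis ι ℝ V) {α : Eu n → V →L[ℝ] ℝ} (hα : ∀ y ∈ U, ContDiffAt ℝ 1 α y)
    (hα0 : ∀ y ∉ K, α y = 0) (hαP : ∀ y ∈ U, ∀ v, α y (tangentProj f y v) = α y v)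
    {g h : Eu n → ℝ} (hg : ContinuousOn g U) (hg0 : ∀ y ∉ K, g y = 0) (hh : ContinuousOn h U)
    (hh0 : ∀ y ∉ K, h y = 0) (hle : ∀ y ∈ K, g y + ∑ d, tD π f α y (b d) (b d) ≤ h y) :
    ∫ y, volDensity f y * g y ≤ ∫ y, volDensity f y * h y := by
  have hs : tsupport α ⊆ K := closure_minimal
    (fun y hy => by_contra fun h => hy (hα0 y h)) hK.isClosed
  have hdiv := hf.integral_volDensity_mul_divergence b hα
    (HasCompactSupport.intro hK hα0) (hs.trans hKU) hαP
  have hd0 : ∀ y ∉ K, ∑ d, tD π f α y (b d) (b d) = 0 := by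
    intro y hy
    have e1 : fderiv ℝ α y = 0 := by
      rw [(notMem_tsupport_iff_eventuallyEq.1 fun h => hy (hs h)).fderiv_eq]
      exact fderiv_const_apply _
    simp [tD, e1]
  have hdc : ContinuousOn (fun y => ∑ d, tD π f α y (b d) (b d)) U := by
    refine continuousOn_finsetSum _ fun d _ y hy => ContinuousAt.continuousWithinAt ?_
    exact ((hf.continuousAt_tD hy (hα y hy)).clm_apply continuousAt_const).clm_apply
      continuousAt_const
  have i1 := hf.integrable_volDensity_mul hK hKU hg hg0
  have i2 := hf.integrable_volDensity_mul hK hKU hh hh0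
  have i3 := hf.integrable_volDensity_mul hK hKU hdc hd0
  calc ∫ y, volDensity f y * g y
      = ∫ y, (volDensity f y * g y + volDensity f y * ∑ d, tD π f α y (b d) (b d)) := by
        rw [integral_add i1 i3, hdiv, add_zero]
    _ ≤ _ := by
        refine integral_mono (i1.add i3) i2 fun y => ?_
        by_cases hy : y ∈ K
        · rw [← mul_add]
          exact mul_le_mul_of_nonneg_left (hle y hy) (volDensity_nonneg f y)
        · simp [hg0 y hy, hh0 y hy, hd0 y hy]

end IsGraphOver

end Integration

end FlatNormalGraph



/-! ### The integrated stability and Simons inequalities -/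

namespace FlatNormalGraph

noncomputable section IntegralEstimate

/-- With `X = (q+1)xc` and `Y = pvy` the left side is a sum of terms `(cs)(X + Y) - v(cs)²`, at most
`(X + Y)²/(4v)`. Young's inequality then separates `X` from `Y`, losing only `1 + τ` on the critical
term. -/
theorem weighted_square_le {ι : Type*} [Fintype ι] {v c q p τ : ℝ} (s x y : ι → ℝ) (hv : 0 < v)
    (hτ : 0 < τ) :
    (∑ d, (q + 1) * x d * c ^ 2 * s d + ∑ d, v * p * c * y d * s d) - v * c ^ 2 * ∑ d, s d ^ 2 ≤
      (1 + τ) * (q + 1) ^ 2 * ((∑ d, x d ^ 2) / (4 * v)) * c ^ 2 +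
        (1 + τ⁻¹) * (p ^ 2 / 4) * v * ∑ d, y d ^ 2 := by
  rw [Finset.mul_sum, ← Finset.sum_add_distrib, ← Finset.sum_sub_distrib, Finset.sum_div,
    Finset.mul_sum, Finset.sum_mul, Finset.mul_sum, ← Finset.sum_add_distrib]
  refine Finset.sum_le_sum fun d _ => ?_
  set X := (q + 1) * x d * c
  set Y := p * v * y d
  have h1 : 0 ≤ (τ * X - Y) ^ 2 * τ⁻¹ := by positivity
  have h2 : (τ * X - Y) ^ 2 * τ⁻¹ = τ * X ^ 2 - 2 * X * Y + τ⁻¹ * Y ^ 2 := by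
    field_simp
    ring
  have h3 : 0 ≤ (2 * v * (c * s d) - (X + Y)) ^ 2 := sq_nonneg _
  have h4 : (1 + τ) * (q + 1) ^ 2 * (x d ^ 2 / (4 * v)) * c ^ 2 + (1 + τ⁻¹) * (p ^ 2 / 4) * v * y d ^ 2
      = ((1 + τ) * X ^ 2 + (1 + τ⁻¹) * Y ^ 2) / (4 * v) := by
    simp only [X, Y]
    field_simp
  have h5 : (q + 1) * x d * c ^ 2 * s d + v * p * c * y d * s d - v * c ^ 2 * s d ^ 2 =
      (c * s d) * (X + Y) - v * (c * s d) ^ 2 := by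
    simp only [X, Y]
    ring
  rw [h4, h5, le_div_iff₀ (by positivity)]
  nlinarith

theorem weighted_inner_le {ι : Type*} [Fintype ι] {v c p ε : ℝ} (x y : ι → ℝ) (hv : 0 < v)
    (hε : 0 < ε) : -(p / 2 * c * ∑ d, x d * y d) ≤
      ε * ((∑ d, x d ^ 2) / (4 * v)) * c ^ 2 + p ^ 2 / (4 * ε) * v * ∑ d, y d ^ 2 := by
  rw [Finset.mul_sum, ← Finset.sum_neg_distrib, Finset.sum_div,
    Finset.mul_sum, Finset.sum_mul, Finset.mul_sum, ← Finset.sum_add_distrib]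
  refine Finset.sum_le_sum fun d _ => ?_
  have h1 : 0 ≤ (ε * c * x d + p * v * y d) ^ 2 := sq_nonneg _
  have h2 : ε * (x d ^ 2 / (4 * v)) * c ^ 2 + p ^ 2 / (4 * ε) * v * y d ^ 2 =
      ((ε * c * x d) ^ 2 + (p * v * y d) ^ 2) / (4 * v * ε) := by field_simp
  rw [h2, le_div_iff₀ (by positivity)]
  nlinarith

variable {n : ℕ} {V : Type*} [NormedAddCommGroup V] [InnerProductSpace ℝ V]
  [FiniteDimensional ℝ V] {π : V →L[ℝ] Eu n} {f : Eu n → V} {U : Set (Eu n)} {x : Eu n}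

theorem tD_rpow_mul_rpow {v φ : Eu n → ℝ} {r p : ℝ} (hv : DifferentiableAt ℝ v x) (hv0 : v x ≠ 0)
    (hφ : DifferentiableAt ℝ φ x) (hp : 1 ≤ p) (a : V) :
    tD π f (fun y => v y ^ r * φ y ^ p) x a =
      r * v x ^ (r - 1) * tD π f v x a * φ x ^ p + v x ^ r * (p * φ x ^ (p - 1) * tD π f φ x a) := by
  rw [tD_mul (hv.rpow_const (Or.inl hv0)) (hφ.rpow_const (Or.inr hp)),
    tD_rpow_const hv (Or.inl hv0), tD_rpow_const hφ (Or.inr hp)]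

namespace IsGraphOver

variable (hf : IsGraphOver π f U) (hflat : HasFlatNormalBundle f U) {φ : Eu n → ℝ}
  (hφ : ContDiff ℝ ∞ φ) (hφc : HasCompactSupport φ) (hφU : tsupport φ ⊆ U) (hφ0 : ∀ y, 0 ≤ φ y)
  {ι : Type*} [Fintype ι] (b : OrthonormalBasis ι ℝ V) {δ q p : ℝ} (hδ : 0 < δ) (hp : 2 < p)
include hf hflat hφ hφc hφU hφ0 hδ hp

/-- The stability-type inequality obtained from the parallel form. -/
theorem integral_stability {τ : ℝ} (hτ : 0 < τ) :
    ∫ y, volDensity f y *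
        (normSecondFund f y ^ 2 * (normSecondFund f y ^ 2 + δ) ^ (q + 1) * φ y ^ p) ≤
      ∫ y, volDensity f y *
        (max (traceGradMeanCurv π f y) 0 * (normSecondFund f y ^ 2 + δ) ^ (q + 1) * φ y ^ p +
          (1 + τ) * (q + 1) ^ 2 * ((normSecondFund f y ^ 2 + δ) ^ q *
            ((∑ d, tD π f (fun y => normSecondFund f y ^ 2) y (b d) ^ 2) /
              (4 * (normSecondFund f y ^ 2 + δ))) * φ y ^ p) +
          (1 + τ⁻¹) * (p ^ 2 / 4) * ((normSecondFund f y ^ 2 + δ) ^ (q + 1) * φ y ^ (p - 2) *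
            normGrad f φ y ^ 2)) := by
  set F : Eu n → ℝ := fun y => normSecondFund f y ^ 2 with hF
  set v : Eu n → ℝ := fun y => F y + δ with hv
  -- Positivity of `δ` keeps `v` away from zero, so that all its real powers are smooth across the
  -- zeros of `A`.
  have hv0 : ∀ y, 0 < v y := fun y => by positivity
  have hFd : ∀ y ∈ U, ContDiffAt ℝ ∞ F y := fun y hy => hf.contDiffAt_sq_normSecondFund hy hflat
  have hvd : ∀ y ∈ U, ContDiffAt ℝ ∞ v y := fun y hy => (hFd y hy).add contDiffAt_const
  have hvr : ∀ y ∈ U, ∀ r : ℝ, ContDiffAt ℝ ∞ (fun y => v y ^ r) y := fun y hy r =>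
    (hvd y hy).rpow contDiffAt_const (hv0 y).ne'
  have hφp : ContDiff ℝ 1 fun y => φ y ^ p :=
    (hφ.of_le (by simp)).rpow_const_of_le (by norm_num; linarith)
  have hφ' : ∀ y ∉ tsupport φ, φ y = 0 := fun y hy => image_eq_zero_of_notMem_tsupport hy
  have hp0 : p ≠ 0 := by linarith
  have hp2 : p - 2 ≠ 0 := by linarith
  have hcont : ∀ {g : Eu n → ℝ}, (∀ y ∈ U, ContinuousAt g y) → ContinuousOn g U := fun h y hy =>
    (h y hy).continuousWithinAt
  have hφq : Continuous fun y => φ y ^ (p - 2) :=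
    hφ.continuous.rpow_const fun y => Or.inr (by linarith)
  have hα : ∀ y ∈ U, ContDiffAt ℝ 1 (fun y => (v y ^ (q + 1) * φ y ^ p) • slope π f y) y :=
    fun y hy => (((hvr y hy _).of_le (by simp)).mul hφp.contDiffAt).smul
      ((hf.contDiffAt_slope hy).of_le (by simp))
  refine hf.integral_le_of_add_divergence_le hφc hφU b hα ?_ ?_ ?_ ?_ ?_ ?_ ?_
  · intro y hy
    simp [hφ' y hy, hp0]
  · intro y hy w
    simp [hf.slope_proj hy]
  · exact hcont fun y hy => ((hFd y hy).continuousAt.mul (hvr y hy _).continuousAt).mul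
      hφp.continuous.continuousAt
  · intro y hy
    simp [hφ' y hy, hp0]
  · refine hcont fun y hy => ?_
    have c1 := (hvr y hy q).continuousAt
    have c2 := (hvr y hy (q + 1)).continuousAt
    have c3 := hf.continuousAt_normGrad hy (hφ.contDiffAt.of_le (by simp)) hflat
    have c4 := hf.continuousAt_traceGradMeanCurv hy hflat
    have c5 : ContinuousAt (fun y => ∑ d, tD π f F y (b d) ^ 2) y :=
      tendsto_finsetSum _ fun d _ => ((hf.continuousAt_tD hy
        ((hFd y hy).of_le (by simp))).clm_apply continuousAt_const).pow 2
    have c6 : ContinuousAt (fun y => (∑ d, tD π f F y (b d) ^ 2) / (4 * v y)) y :=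
      c5.div (continuousAt_const.mul (hvd y hy).continuousAt) (by have := hv0 y; positivity)
    have c7 := hφp.continuous.continuousAt (x := y)
    have c8 := hφq.continuousAt (x := y)
    exact ((((c4.max continuousAt_const).mul c2).mul c7).add
      (continuousAt_const.mul ((c1.mul c6).mul c7))).add
      (continuousAt_const.mul ((c2.mul c8).mul (c3.pow 2)))
  · intro y hy
    simp [hφ' y hy, hp0, hp2]
  · intro y hy
    have hyU := hφU hy
    have hvy := hv0 y
    have d1 : DifferentiableAt ℝ v y := (hvd y hyU).differentiableAt (by simp)
    have d2 : DifferentiableAt ℝ φ y := hφ.contDiffAt.differentiableAt (by simp)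
    have d3 : DifferentiableAt ℝ (slope π f) y :=
      (hf.contDiffAt_slope hyU).differentiableAt (by simp)
    have dF : DifferentiableAt ℝ F y := (hFd y hyU).differentiableAt (by simp)
    have d4 : DifferentiableAt ℝ (fun y => v y ^ (q + 1) * φ y ^ p) y :=
      (d1.rpow_const (Or.inl hvy.ne')).mul (d2.rpow_const (Or.inr (by linarith)))
    have e1 : ∀ a, tD π f v y a = tD π f F y a := fun a => by
      rw [hv, tD_add dF (differentiableAt_const δ), tD_const]
      simp
    have e2 : ∀ d, tD π f (fun y => (v y ^ (q + 1) * φ y ^ p) • slope π f y) y (b d) (b d) =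
        ((q + 1) * v y ^ q * tD π f F y (b d) * φ y ^ p +
          v y ^ (q + 1) * (p * φ y ^ (p - 1) * tD π f φ y (b d))) * slope π f y (b d) +
        v y ^ (q + 1) * φ y ^ p * tD π f (slope π f) y (b d) (b d) := fun d => by
      rw [tD_smul d4 d3, tD_rpow_mul_rpow d1 hvy.ne' d2 (by linarith), e1, add_sub_cancel_right]
      rfl
    have e3 : φ y ^ p = φ y ^ (p - 2) * φ y ^ 2 := by
      rw [← Real.rpow_natCast, ← Real.rpow_add_of_nonneg (hφ0 y) (by linarith) (by norm_num)]
      norm_num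
    have e4 : φ y ^ (p - 1) = φ y ^ (p - 2) * φ y := by
      rw [← Real.rpow_add_one' (hφ0 y) (by linarith)]
      ring_nf
    have e5 : v y ^ (q + 1) = v y ^ q * v y := Real.rpow_add_one hvy.ne' q
    have e6 := hf.sum_tD_slope hyU hflat b
    have e7 := hf.sq_normGrad hyU hflat b φ
    have hB : 0 ≤ φ y ^ (p - 2) := Real.rpow_nonneg (hφ0 y) _
    have hA : 0 < v y ^ q := Real.rpow_pos_of_pos hvy q
    have key := weighted_square_le (q := q) (p := p) (c := φ y) (fun d => slope π f y (b d))
      (fun d => tD π f F y (b d)) (fun d => tD π f φ y (b d)) hvy hτ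
    -- The negative square of `slope` in its divergence is what allows the cross terms with `∇|A|²`
    -- and `∇φ` to be absorbed.
    have key2 := mul_le_mul_of_nonneg_left key (mul_nonneg hA.le hB)
    have key3 := mul_le_mul_of_nonneg_left (le_max_left (traceGradMeanCurv π f y) 0)
      (by positivity : 0 ≤ v y ^ q * v y * φ y ^ (p - 2) * φ y ^ 2)
    have e8 : ∑ d, tD π f (fun y => (v y ^ (q + 1) * φ y ^ p) • slope π f y) y (b d) (b d) =
        v y ^ q * φ y ^ (p - 2) * (∑ d, (q + 1) * tD π f F y (b d) * φ y ^ 2 * slope π f y (b d) +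
          ∑ d, v y * p * φ y * tD π f φ y (b d) * slope π f y (b d)) +
        v y ^ q * v y * φ y ^ (p - 2) * φ y ^ 2 *
          ∑ d, tD π f (slope π f) y (b d) (b d) := by
      rw [← Finset.sum_add_distrib, Finset.mul_sum, Finset.mul_sum, ← Finset.sum_add_distrib]
      refine Finset.sum_congr rfl fun d _ => ?_
      rw [e2, e3, e4, e5]
      ring
    rw [e8, e6, e7, e3, e5]
    change F y * (v y ^ q * v y) * (φ y ^ (p - 2) * φ y ^ 2) + (_ + v y ^ q * v y * φ y ^ (p - 2) *
      φ y ^ 2 * (-F y - _ + _)) ≤ _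
    linarith

/-- The integrated Simons inequality. -/
theorem integral_simons {κ C ε : ℝ} (hκ : 0 ≤ κ)
    (hC : ∀ h : Fin n → Fin n → Fin n → V, (∀ k i j, h k i j = h i k j) →
      (∀ k i j, h k i j = h k j i) → (1 + κ) * ∑ k, ∑ i, ‖h k i i‖ ^ 2 ≤
        ∑ k, ∑ i, ∑ j, ‖h k i j‖ ^ 2 + C * ∑ j, ‖∑ k, h k k j‖ ^ 2) (hε : 0 < ε) :
    ∫ y, volDensity f y * ((1 + κ + 2 * q - ε) * ((normSecondFund f y ^ 2 + δ) ^ q *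
            ((∑ d, tD π f (fun y => normSecondFund f y ^ 2) y (b d) ^ 2) /
              (4 * (normSecondFund f y ^ 2 + δ))) * φ y ^ p)) ≤
      ∫ y, volDensity f y *
        ((normSecondFund f y * K₂ f y + ‖meanCurv f y‖ * normSecondFund f y ^ 3 +
          (normSecondFund f y ^ 2) ^ 2 + C * normCovMeanCurv f y ^ 2) *
            (normSecondFund f y ^ 2 + δ) ^ q * φ y ^ p +
          p ^ 2 / (4 * ε) * ((normSecondFund f y ^ 2 + δ) ^ (q + 1) * φ y ^ (p - 2) *
            normGrad f φ y ^ 2)) := by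
  set F : Eu n → ℝ := fun y => normSecondFund f y ^ 2 with hF
  set v : Eu n → ℝ := fun y => F y + δ with hv
  have hv0 : ∀ y, 0 < v y := fun y => by positivity
  have hFd : ∀ y ∈ U, ContDiffAt ℝ ∞ F y := fun y hy => hf.contDiffAt_sq_normSecondFund hy hflat
  have hvd : ∀ y ∈ U, ContDiffAt ℝ ∞ v y := fun y hy => (hFd y hy).add contDiffAt_const
  have hvr : ∀ y ∈ U, ∀ r : ℝ, ContDiffAt ℝ ∞ (fun y => v y ^ r) y := fun y hy r =>
    (hvd y hy).rpow contDiffAt_const (hv0 y).ne'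
  have hφp : ContDiff ℝ 1 fun y => φ y ^ p :=
    (hφ.of_le (by simp)).rpow_const_of_le (by norm_num; linarith)
  have hφ' : ∀ y ∉ tsupport φ, φ y = 0 := fun y hy => image_eq_zero_of_notMem_tsupport hy
  have hp0 : p ≠ 0 := by linarith
  have hp2 : p - 2 ≠ 0 := by linarith
  have hcont : ∀ {g : Eu n → ℝ}, (∀ y ∈ U, ContinuousAt g y) → ContinuousOn g U := fun h y hy =>
    (h y hy).continuousWithinAt
  have hφq : Continuous fun y => φ y ^ (p - 2) :=
    hφ.continuous.rpow_const fun y => Or.inr (by linarith)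
  -- The factor `-2⁻¹` makes the divergence of this field cancel the term `½Δ|A|²` of Simons'
  -- inequality.
  have hα : ∀ y ∈ U, ContDiffAt ℝ 1 (fun y => (-2⁻¹ * (v y ^ q * φ y ^ p)) • tD π f F y) y :=
    fun y hy => (contDiffAt_const.mul (((hvr y hy _).of_le (by simp)).mul hφp.contDiffAt)).smul
      ((hf.contDiffAt_tD hy (hFd y hy)).of_le (by simp))
  have hD : ∀ y ∈ U, ContinuousAt (fun y => (∑ d, tD π f F y (b d) ^ 2) / (4 * v y)) y := by
    intro y hy
    have c5 : ContinuousAt (fun y => ∑ d, tD π f F y (b d) ^ 2) y :=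
      tendsto_finsetSum _ fun d _ => ((hf.continuousAt_tD hy
        ((hFd y hy).of_le (by simp))).clm_apply continuousAt_const).pow 2
    exact c5.div (continuousAt_const.mul (hvd y hy).continuousAt) (by have := hv0 y; positivity)
  refine hf.integral_le_of_add_divergence_le hφc hφU b hα ?_ ?_ ?_ ?_ ?_ ?_ ?_
  · intro y hy
    simp [hφ' y hy, hp0]
  · intro y hy w
    simp [tD_proj]
  · exact hcont fun y hy => continuousAt_const.mul (((hvr y hy _).continuousAt.mul (hD y hy)).mul
      hφp.continuous.continuousAt)
  · intro y hy
    simp [hφ' y hy, hp0]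
  · refine hcont fun y hy => ?_
    have c1 := (hvr y hy q).continuousAt
    have c2 := (hvr y hy (q + 1)).continuousAt
    have c3 := hf.continuousAt_normGrad hy (hφ.contDiffAt.of_le (by simp)) hflat
    have c4 : ContinuousAt (fun y => normSecondFund f y * K₂ f y) y := by
      simp only [normSecondFund_mul_K₂]
      exact (hf.continuousAt_hessPairing hy hflat).neg.max continuousAt_const
    have c5 := hf.continuousAt_normSecondFund hy hflat
    have c6 := (hf.contDiffAt_meanCurv hy hflat).continuousAt.norm
    have c7 := hφp.continuous.continuousAt (x := y)
    have c8 := hφq.continuousAt (x := y)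
    have c9 := hf.continuousAt_normCovMeanCurv hy hflat
    exact ((((((c4.add (c6.mul (c5.pow 3))).add ((c5.pow 2).pow 2)).add
      (continuousAt_const.mul (c9.pow 2))).mul c1).mul c7)).add
      (continuousAt_const.mul ((c2.mul c8).mul (c3.pow 2)))
  · intro y hy
    simp [hφ' y hy, hp0, hp2]
  · intro y hy
    have hyU := hφU hy
    have hvy := hv0 y
    have d1 : DifferentiableAt ℝ v y := (hvd y hyU).differentiableAt (by simp)
    have d2 : DifferentiableAt ℝ φ y := hφ.contDiffAt.differentiableAt (by simp)
    have d3 : DifferentiableAt ℝ (tD π f F) y :=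
      (hf.contDiffAt_tD hyU (hFd y hyU)).differentiableAt (by simp)
    have dF : DifferentiableAt ℝ F y := (hFd y hyU).differentiableAt (by simp)
    have d4 : DifferentiableAt ℝ (fun y => v y ^ q * φ y ^ p) y :=
      (d1.rpow_const (Or.inl hvy.ne')).mul (d2.rpow_const (Or.inr (by linarith)))
    have e1 : ∀ a, tD π f v y a = tD π f F y a := fun a => by
      rw [hv, tD_add dF (differentiableAt_const δ), tD_const]
      simp
    have e5' : v y ^ (q - 1) = v y ^ q / v y := Real.rpow_sub_one hvy.ne' q
    have e2 : ∀ d, tD π f (fun y => (-2⁻¹ * (v y ^ q * φ y ^ p)) • tD π f F y) y (b d) (b d) =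
        -2⁻¹ * (q * (v y ^ q / v y) * tD π f F y (b d) * φ y ^ p +
          v y ^ q * (p * φ y ^ (p - 1) * tD π f φ y (b d))) * tD π f F y (b d) +
        -2⁻¹ * (v y ^ q * φ y ^ p) * tD π f (tD π f F) y (b d) (b d) := fun d => by
      have d5 : DifferentiableAt ℝ (fun y => -2⁻¹ * (v y ^ q * φ y ^ p)) y := d4.const_mul _
      rw [tD_smul d5 d3, tD_mul (differentiableAt_const _) d4,
        tD_rpow_mul_rpow d1 hvy.ne' d2 (by linarith), e1, e5', tD_const]
      simp
    have e3 : φ y ^ p = φ y ^ (p - 2) * φ y ^ 2 := by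
      rw [← Real.rpow_natCast, ← Real.rpow_add_of_nonneg (hφ0 y) (by linarith) (by norm_num)]
      norm_num
    have e4 : φ y ^ (p - 1) = φ y ^ (p - 2) * φ y := by
      rw [← Real.rpow_add_one' (hφ0 y) (by linarith)]
      ring_nf
    have e5 : v y ^ (q + 1) = v y ^ q * v y := Real.rpow_add_one hvy.ne' q
    have e7 := hf.sq_normGrad hyU hflat b φ
    have hB : 0 ≤ φ y ^ (p - 2) := Real.rpow_nonneg (hφ0 y) _
    have hA : 0 < v y ^ q := Real.rpow_pos_of_pos hvy q
    have hsim := hf.simons_inequality hyU hflat hκ hC hvy (by simp [hv, hF, hδ.le]) b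
    have key := weighted_inner_le (p := p) (c := φ y)
      (fun d => tD π f F y (b d)) (fun d => tD π f φ y (b d)) hvy hε
    have key2 := mul_le_mul_of_nonneg_left key (mul_nonneg hA.le hB)
    have key3 := mul_le_mul_of_nonneg_left hsim
      (by positivity : 0 ≤ v y ^ q * φ y ^ (p - 2) * φ y ^ 2)
    -- Differentiating `v ^ q` yields the additional `2 * q` copies of the gradient term, since
    -- `q/(2v) = 2q/(4v)`.
    have e8 : ∑ d, tD π f (fun y => (-2⁻¹ * (v y ^ q * φ y ^ p)) • tD π f F y) y (b d) (b d) =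
        - (2 * q * (v y ^ q * φ y ^ (p - 2) * φ y ^ 2 *
          ((∑ d, tD π f F y (b d) ^ 2) / (4 * v y)))) -
        v y ^ q * φ y ^ (p - 2) * (p / 2 * φ y * ∑ d, tD π f F y (b d) * tD π f φ y (b d)) -
        v y ^ q * φ y ^ (p - 2) * φ y ^ 2 *
          (2⁻¹ * ∑ d, tD π f (tD π f F) y (b d) (b d)) := by
      rw [Finset.sum_div]
      simp only [Finset.mul_sum]
      rw [← Finset.sum_neg_distrib, ← Finset.sum_sub_distrib, ← Finset.sum_sub_distrib]
      refine Finset.sum_congr rfl fun d _ => ?_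
      rw [e2, e3, e4]
      field_simp
      ring
    rw [e8, e7, e3, e5]
    linarith

end IsGraphOver

end IntegralEstimate

end FlatNormalGraph



/-! ### Absorption and Young inequalities -/

namespace FlatNormalGraph

section Young

/-- Inserting the bound for `Y` into the one for `X` returns `X` with factor `(1 + τ)m/(s - ε)`,
which is below `1` for small `τ` and `ε` as `m < s`. -/
theorem exists_absorption_constant {m s a : ℝ} (hm : 0 < m) (hs : m < s) (ha : 0 ≤ a) :
    ∃ C₀ : ℝ, 0 ≤ C₀ ∧ ∀ X Y T W Z : ℝ, 0 ≤ T → 0 ≤ W → 0 ≤ Z →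
      (∀ τ > 0, X ≤ T + (1 + τ) * m * Y + (1 + τ⁻¹) * a * Z) →
      (∀ ε > 0, (s - ε) * Y ≤ X + W + a / ε * Z) → X ≤ C₀ * (T + W + Z) := by
  -- With `τ = ε/m` the factor becomes `(m + ε)/(s - ε)`, and `ε = (s - m)/4` keeps it below `1`.
  set ε := (s - m) / 4 with hε
  have hε0 : 0 < ε := by linarith
  set τ := ε / m with hτ
  have hτ0 : 0 < τ := by positivity
  have hτm : (1 + τ) * m = m + ε := by rw [hτ]; field_simp
  have hsε : 0 < s - ε := by linarith
  set θ := (m + ε) / (s - ε) with hθ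
  have hθ1 : θ < 1 := by rw [hθ, div_lt_one hsε]; linarith
  have hθ0 : 0 < θ := by positivity
  have hc : 0 ≤ (1 + τ⁻¹) * a := by positivity
  have hd : 0 ≤ a / ε := by positivity
  refine ⟨(1 + (1 + τ⁻¹) * a + a / ε) / (1 - θ),
    div_nonneg (by linarith) (by linarith), fun X Y T W Z hT hW hZ h1 h2 => ?_⟩
  have h1' := h1 τ hτ0
  have h2' := mul_le_mul_of_nonneg_left (h2 ε hε0) hθ0.le
  have h3 : θ * ((s - ε) * Y) = (m + ε) * Y := by rw [hθ]; field_simp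
  rw [hτm] at h1'
  rw [h3] at h2'
  rw [div_mul_eq_mul_div, le_div_iff₀ (by linarith)]
  have h4 : θ * W ≤ W := by nlinarith
  have h5 : θ * (a / ε * Z) ≤ a / ε * Z := by
    have : 0 ≤ a / ε * Z := by positivity
    nlinarith
  have h6 : 0 ≤ ((1 + τ⁻¹) * a + a / ε) * (T + W) := by positivity
  nlinarith

/-- Either `w ≤ η v^(N-a)`, and the first term suffices, or `v` is bounded by a power of `w`, and
the second does. -/
theorem exists_young_constant {a N η : ℝ} (ha : 0 ≤ a) (haN : a < N) (hη : 0 < η) :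
    ∃ C : ℝ, 0 ≤ C ∧ ∀ v w : ℝ, 0 ≤ v → 0 ≤ w → v ^ a * w ≤ η * v ^ N + C * w ^ (N / (N - a)) := by
  have hNa : 0 < N - a := by linarith
  refine ⟨(η⁻¹) ^ (a / (N - a)), by positivity, fun v w hv hw => ?_⟩
  have hr : 0 ≤ (η⁻¹) ^ (a / (N - a)) * w ^ (N / (N - a)) := by positivity
  have hl : 0 ≤ η * v ^ N := by positivity
  by_cases h : w ≤ η * v ^ (N - a)
  · have : v ^ a * (η * v ^ (N - a)) = η * v ^ N := by
      rw [mul_left_comm, ← Real.rpow_add_of_nonneg hv ha hNa.le]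
      ring_nf
    have h2 := mul_le_mul_of_nonneg_left h (Real.rpow_nonneg hv a)
    linarith
  · push Not at h
    have h1 : v ^ (N - a) ≤ η⁻¹ * w := by
      rw [inv_mul_eq_div, le_div_iff₀ hη]
      linarith
    have h2 : v ^ a ≤ (η⁻¹ * w) ^ (a / (N - a)) := by
      have := Real.rpow_le_rpow (by positivity) h1 (div_nonneg ha hNa.le)
      rwa [← Real.rpow_mul hv, mul_div_cancel₀ _ hNa.ne'] at this
    have h3 : w ^ (N / (N - a)) = w ^ (a / (N - a)) * w := by
      rw [← Real.rpow_add_one' hw (by positivity)]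
      congr 1
      field_simp
      ring
    rw [Real.mul_rpow (by positivity) hw] at h2
    have h4 := mul_le_mul_of_nonneg_right h2 hw
    rw [h3, ← mul_assoc]
    linarith

/-- Each lower-order term is a power of `v` below `q + 2` times a curvature quantity. The exponents
`q + 1`, `q + 1/2`, `q + 3/2` and `q` are conjugate to the powers of `k₁`, `k₂`, `h` and `d` in the
conclusion. Each of the five terms, including the one with `g`, receives `η/5`. -/
theorem exists_pointwise_constant {q C η : ℝ} (hq : 0 ≤ q) (hC : 0 ≤ C) (hη : 0 < η) :
    ∃ C₁ : ℝ, 0 ≤ C₁ ∧ ∀ v A k₁ k₂ h d g c : ℝ, 0 < v → 0 ≤ A → A ^ 2 ≤ v → 0 ≤ k₁ → 0 ≤ k₂ →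
      0 ≤ h → 0 ≤ d → 0 ≤ g → 0 ≤ c →
      k₁ * v ^ (q + 1) * c ^ (2 * q + 4) +
        (A * k₂ + h * A ^ 3 + C * d ^ 2) * v ^ q * c ^ (2 * q + 4) +
        v ^ (q + 1) * c ^ (2 * q + 4 - 2) * g ^ 2 ≤
      η * (v ^ (q + 2) * c ^ (2 * q + 4)) + C₁ * (g ^ (2 * q + 4) + (h ^ (2 * q + 4) +
        d ^ ((2 * q + 4) / 2) + k₁ ^ ((2 * q + 4) / 2) + k₂ ^ ((2 * q + 4) / 3)) *
          c ^ (2 * q + 4)) := by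
  obtain ⟨c₁, hc₁, y₁⟩ := exists_young_constant (a := q + 1) (N := q + 2) (η := η / 5)
    (by linarith) (by linarith) (by linarith)
  obtain ⟨c₂, hc₂, y₂⟩ := exists_young_constant (a := q + 2⁻¹) (N := q + 2) (η := η / 5)
    (by linarith) (by linarith) (by linarith)
  obtain ⟨c₃, hc₃, y₃⟩ := exists_young_constant (a := q + 3 / 2) (N := q + 2) (η := η / 5)
    (by linarith) (by linarith) (by linarith)
  obtain ⟨c₄, hc₄, y₄⟩ := exists_young_constant (a := q) (N := q + 2) (η := η / (5 * (C + 1)))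
    hq (by linarith) (by positivity)
  refine ⟨c₁ + c₂ + c₃ + C * c₄, by positivity, ?_⟩
  intro v A k₁ k₂ h d g c hv hA hAv hk₁ hk₂ hh hd hg hc
  have z₁ := y₁ v k₁ hv.le hk₁
  have z₂ := y₂ v k₂ hv.le hk₂
  have z₃ := y₃ v h hv.le hh
  have z₄ := y₄ v (d ^ 2) hv.le (by positivity)
  -- Here Young's inequality is applied to `v c²` and `g²`, because this term carries only the power
  -- `2q + 2` of `c`.
  have z₅ := y₁ (v * c ^ 2) (g ^ 2) (by positivity) (by positivity)
  have x₁ : (q + 2) / (q + 2 - (q + 1)) = (2 * q + 4) / 2 := by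
    rw [div_eq_div_iff (by linarith) (by norm_num)]; ring
  have x₂ : (q + 2) / (q + 2 - (q + 2⁻¹)) = (2 * q + 4) / 3 := by
    rw [div_eq_div_iff (by linarith) (by norm_num)]; ring
  have x₃ : (q + 2) / (q + 2 - (q + 3 / 2)) = 2 * q + 4 := by
    rw [div_eq_iff (by linarith)]; ring
  have x₄ : (d ^ 2) ^ ((q + 2) / (q + 2 - q)) = d ^ ((2 * q + 4) / 2) := by
    rw [← Real.rpow_natCast, ← Real.rpow_mul hd]
    congr 1
    field_simp
    ring
  have x₅ : (g ^ 2) ^ ((2 * q + 4) / 2) = g ^ (2 * q + 4) := by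
    rw [← Real.rpow_natCast, ← Real.rpow_mul hg]
    congr 1
    push_cast
    ring
  have hcp : ∀ r : ℝ, (c ^ 2) ^ r = c ^ (2 * r) := fun r => by
    rw [← Real.rpow_natCast, ← Real.rpow_mul hc]
    norm_num
  rw [x₁] at z₁ z₅
  rw [x₂] at z₂
  rw [x₃] at z₃
  rw [x₄] at z₄
  rw [x₅, Real.mul_rpow hv.le (by positivity), Real.mul_rpow hv.le (by positivity), hcp, hcp] at z₅
  have e₁ : 2 * (q + 1) = 2 * q + 4 - 2 := by ring
  have e₂ : 2 * (q + 2) = 2 * q + 4 := by ring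
  rw [e₁, e₂] at z₅
  have hsq : A ≤ v ^ (2⁻¹ : ℝ) := by
    rw [← one_div, ← Real.sqrt_eq_rpow]
    exact Real.le_sqrt_of_sq_le hAv
  have hA1 : A * v ^ q ≤ v ^ (q + 2⁻¹) := by
    rw [Real.rpow_add hv, mul_comm]
    gcongr
  have hA3 : A ^ 3 * v ^ q ≤ v ^ (q + 3 / 2) := by
    have : v ^ (q + 3 / 2) = v ^ q * (v ^ (2⁻¹ : ℝ)) ^ 3 := by
      rw [← Real.rpow_natCast, ← Real.rpow_mul hv.le, ← Real.rpow_add hv]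
      norm_num
    rw [this, mul_comm]
    gcongr
  set P := c ^ (2 * q + 4)
  have hP : 0 ≤ P := Real.rpow_nonneg hc _
  set B := v ^ (q + 2)
  have hB : 0 ≤ B := Real.rpow_nonneg hv.le _
  have t₁ := mul_le_mul_of_nonneg_right z₁ hP
  have t₂ := mul_le_mul_of_nonneg_right
    ((mul_le_mul_of_nonneg_right hA1 hk₂).trans z₂) hP
  have t₃ := mul_le_mul_of_nonneg_right
    ((mul_le_mul_of_nonneg_right hA3 hh).trans z₃) hP
  have t₄ := mul_le_mul_of_nonneg_right (mul_le_mul_of_nonneg_left z₄ hC) hP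
  have t₅ : C * (η / (5 * (C + 1)) * B) ≤ η / 5 * B := by
    have : C * (η / (5 * (C + 1)) * B) = C / (C + 1) * (η / 5 * B) := by field_simp
    rw [this]
    refine mul_le_of_le_one_left (by positivity) ?_
    rw [div_le_one (by positivity)]
    linarith
  have t₆ := mul_le_mul_of_nonneg_right t₅ hP
  set G := g ^ (2 * q + 4)
  set a₁ := h ^ (2 * q + 4)
  set a₂ := d ^ ((2 * q + 4) / 2)
  set a₃ := k₁ ^ ((2 * q + 4) / 2)
  set a₄ := k₂ ^ ((2 * q + 4) / 3)
  have hG : 0 ≤ G := Real.rpow_nonneg hg _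
  have ha₁ : 0 ≤ a₁ * P := mul_nonneg (Real.rpow_nonneg hh _) hP
  have ha₂ : 0 ≤ a₂ * P := mul_nonneg (Real.rpow_nonneg hd _) hP
  have ha₃ : 0 ≤ a₃ * P := mul_nonneg (Real.rpow_nonneg hk₁ _) hP
  have ha₄ : 0 ≤ a₄ * P := mul_nonneg (Real.rpow_nonneg hk₂ _) hP
  have hCc : 0 ≤ C * c₄ := mul_nonneg hC hc₄
  have u₁ : 0 ≤ c₁ * (a₁ * P + a₂ * P + a₄ * P) := by positivity
  have u₂ : 0 ≤ c₂ * (G + a₁ * P + a₂ * P + a₃ * P) := by positivity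
  have u₃ : 0 ≤ c₃ * (G + a₂ * P + a₃ * P + a₄ * P) := by positivity
  have u₄ : 0 ≤ C * c₄ * (G + a₁ * P + a₃ * P + a₄ * P) := by positivity
  linarith

end Young

end FlatNormalGraph



/-! ### The energy estimate in the parameter domain -/

namespace FlatNormalGraph

noncomputable section Energy

variable {n : ℕ} {V : Type*} [NormedAddCommGroup V] [InnerProductSpace ℝ V]
  [FiniteDimensional ℝ V] {π : V →L[ℝ] Eu n} {f : Eu n → V} {U : Set (Eu n)} {x : Eu n}

/-- The integrand that controls the `p`-th power of the second fundamental form. -/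
def curvEnergy (π : V →L[ℝ] Eu n) (f : Eu n → V) (φ : Eu n → ℝ) (p : ℝ) (y : Eu n) : ℝ :=
  normGrad f φ y ^ p + (‖meanCurv f y‖ ^ p + normCovMeanCurv f y ^ (p / 2) +
    max (traceGradMeanCurv π f y) 0 ^ (p / 2) + K₂ f y ^ (p / 3)) * φ y ^ p

theorem curvEnergy_nonneg {φ : Eu n → ℝ} (hφ0 : ∀ y, 0 ≤ φ y) (p : ℝ) (y : Eu n) :
    0 ≤ curvEnergy π f φ p y := by
  have h1 := normGrad_nonneg f φ y
  have h2 := normCovMeanCurv_nonneg f y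
  have h3 := K₂_nonneg f y
  have h4 := hφ0 y
  have h5 : 0 ≤ max (traceGradMeanCurv π f y) 0 := le_max_right _ _
  rw [curvEnergy]
  positivity

theorem normGrad_eq_zero {φ : Eu n → ℝ} {y : Eu n} (hy : y ∉ tsupport φ) : normGrad f φ y = 0 := by
  have : fderiv ℝ φ y = 0 := by
    rw [(notMem_tsupport_iff_eventuallyEq.1 hy).fderiv_eq]
    exact fderiv_const_apply _
  simp [normGrad, this]

theorem curvEnergy_eq_zero {φ : Eu n → ℝ} {p : ℝ} (hp : p ≠ 0) {y : Eu n} (hy : y ∉ tsupport φ) :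
    curvEnergy π f φ p y = 0 := by
  simp [curvEnergy, normGrad_eq_zero hy, image_eq_zero_of_notMem_tsupport hy, hp]

/-- Division by zero is zero, so the case distinction is automatic; measurability of `K₂` follows
from this form. -/
theorem K₂_eq_max (f : Eu n → V) (x : Eu n) :
    K₂ f x = max (-(hessPairing f x / normSecondFund f x)) 0 := by
  rw [K₂]
  split_ifs with h
  · rfl
  · have h0 : normSecondFund f x = 0 := le_antisymm (not_lt.1 h) (normSecondFund_nonneg f x)
    simp [h0]

namespace IsGraphOver

variable (hf : IsGraphOver π f U) (hflat : HasFlatNormalBundle f U)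
include hf hflat

theorem aemeasurable_K₂ : AEMeasurable (K₂ f) (volume.restrict U) := by
  have hm : MeasurableSet U := hf.isOpen.measurableSet
  have h1 : AEMeasurable (hessPairing f) (volume.restrict U) :=
    ContinuousOn.aemeasurable (fun y hy =>
      (hf.continuousAt_hessPairing hy hflat).continuousWithinAt) hm
  have h2 : AEMeasurable (normSecondFund f) (volume.restrict U) :=
    ContinuousOn.aemeasurable (fun y hy =>
      (hf.continuousAt_normSecondFund hy hflat).continuousWithinAt) hm
  have h3 : K₂ f = fun x => max (-(hessPairing f x / normSecondFund f x)) 0 :=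
    funext (K₂_eq_max f)
  rw [h3]
  exact (h1.div h2).neg.max aemeasurable_const

variable {φ : Eu n → ℝ} (hφ : ContDiff ℝ ∞ φ)
include hφ

theorem aemeasurable_curvEnergy (p : ℝ) :
    AEMeasurable (curvEnergy π f φ p) (volume.restrict U) := by
  have hm : MeasurableSet U := hf.isOpen.measurableSet
  have hc : ∀ {g : Eu n → ℝ}, (∀ y ∈ U, ContinuousAt g y) → AEMeasurable g (volume.restrict U) :=
    fun h => ContinuousOn.aemeasurable (fun y hy => (h y hy).continuousWithinAt) hm
  have h1 := hc fun y hy => hf.continuousAt_normGrad hy (hφ.contDiffAt.of_le (by simp)) hflat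
  have h2 := hc fun y hy => (hf.contDiffAt_meanCurv hy hflat).continuousAt.norm
  have h3 := hc fun y hy => hf.continuousAt_normCovMeanCurv hy hflat
  have h4 := hc fun y hy => (hf.continuousAt_traceGradMeanCurv hy hflat).max
    (continuousAt_const (y := (0 : ℝ)))
  have h5 := hf.aemeasurable_K₂ hflat
  have h6 : AEMeasurable φ (volume.restrict U) := hφ.continuous.measurable.aemeasurable
  exact (h1.pow_const p).add (((((h2.pow_const p).add (h3.pow_const _)).add
    (h4.pow_const _)).add (h5.pow_const _)).mul (h6.pow_const p))

variable (hφc : HasCompactSupport φ) (hφU : tsupport φ ⊆ U) (hφ0 : ∀ y, 0 ≤ φ y)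
include hφc hφU hφ0

/-- The energy is measurable and lies below the function obtained by replacing `K₂` with the
majorant of `K₂_le`, which is continuous on `U` and vanishes off the support of `φ`. -/
theorem integrable_curvEnergy {p : ℝ} (hp : 0 < p) :
    Integrable fun y => volDensity f y * curvEnergy π f φ p y := by
  have hm : MeasurableSet U := hf.isOpen.measurableSet
  set R : Eu n → ℝ := fun y => normGrad f φ y ^ p + (‖meanCurv f y‖ ^ p +
    normCovMeanCurv f y ^ (p / 2) + max (traceGradMeanCurv π f y) 0 ^ (p / 2) +
      ((n : ℝ) ^ 2 * ‖hessMeanCurv π f y‖) ^ (p / 3)) * φ y ^ p with hR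
  have hRc : ContinuousOn R U := by
    intro y hy
    refine ContinuousAt.continuousWithinAt ?_
    have c1 := hf.continuousAt_normGrad hy (hφ.contDiffAt.of_le (by simp)) hflat
    have c2 := (hf.contDiffAt_meanCurv hy hflat).continuousAt.norm
    have c3 := hf.continuousAt_normCovMeanCurv hy hflat
    have c4 := (hf.continuousAt_traceGradMeanCurv hy hflat).max
      (continuousAt_const (y := (0 : ℝ)))
    have c5 : ContinuousAt (fun y => (n : ℝ) ^ 2 * ‖hessMeanCurv π f y‖) y :=
      continuousAt_const.mul ((continuous_norm (E := V →L[ℝ] V →L[ℝ] V)).continuousAt.comp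
        (hf.continuousAt_hessMeanCurv hy hflat))
    have c6 := hφ.continuous.continuousAt (x := y)
    exact (c1.rpow_const (Or.inr hp.le)).add (((((c2.rpow_const (Or.inr hp.le)).add
      (c3.rpow_const (Or.inr (by positivity)))).add (c4.rpow_const (Or.inr (by positivity)))).add
      (c5.rpow_const (Or.inr (by positivity)))).mul (c6.rpow_const (Or.inr hp.le)))
  have hR0 : ∀ y ∉ tsupport φ, R y = 0 := fun y hy => by
    simp [hR, normGrad_eq_zero hy, image_eq_zero_of_notMem_tsupport hy, hp.ne']
  refine (hf.integrable_volDensity_mul hφc hφU hRc hR0).mono' ?_ (ae_of_all _ fun y => ?_)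
  · have e1 : (fun y => volDensity f y * curvEnergy π f φ p y) =
        U.indicator fun y => volDensity f y * curvEnergy π f φ p y := by
      refine (Set.indicator_eq_self.2 fun y hy => ?_).symm
      by_contra hyU
      exact hy (by simp [curvEnergy_eq_zero hp.ne' fun h => hyU (hφU h)])
    rw [e1, aestronglyMeasurable_indicator_iff hm]
    exact ((measurable_volDensity f).aemeasurable.mul
      (hf.aemeasurable_curvEnergy hflat hφ p)).aestronglyMeasurable
  · rw [Real.norm_of_nonneg (mul_nonneg (volDensity_nonneg f y) (curvEnergy_nonneg hφ0 p y))]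
    refine mul_le_mul_of_nonneg_left ?_ (volDensity_nonneg f y)
    by_cases hy : y ∈ tsupport φ
    · have h1 := hf.K₂_le (hφU hy) hflat
      have h2 := K₂_nonneg f y
      have h3 := hφ0 y
      simp only [curvEnergy, hR]
      gcongr
    · rw [curvEnergy_eq_zero hp.ne' hy, hR0 y hy]

end IsGraphOver

theorem exists_energy_constant (n : ℕ) (hn : 1 ≤ n) {q : ℝ} (hq : 0 ≤ q) (hqn : q ^ 2 * n < 2) :
    ∃ C : ℝ, 0 < C ∧ ∀ (V : Type) [NormedAddCommGroup V] [InnerProductSpace ℝ V]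
      [FiniteDimensional ℝ V] (π : V →L[ℝ] Eu n) (f : Eu n → V) (U : Set (Eu n)),
      IsGraphOver π f U → HasFlatNormalBundle f U → ∀ φ : Eu n → ℝ, ContDiff ℝ ∞ φ →
      HasCompactSupport φ → tsupport φ ⊆ U → (∀ y, 0 ≤ φ y) →
      ∫ y, volDensity f y * (normSecondFund f y ^ (2 * q + 4) * φ y ^ (2 * q + 4)) ≤
        C * ∫ y, volDensity f y * curvEnergy π f φ (2 * q + 4) y := by
  have hn0 : (0 : ℝ) < n := by exact_mod_cast hn
  -- This is where the range of `p` is used: `κ < 2/n` is what the Kato inequality needs, and `q² <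
  -- κ` is the absorption condition `(q + 1)² < 1 + κ + 2q`.
  obtain ⟨κ, hκ1, hκ2⟩ : ∃ κ : ℝ, q ^ 2 < κ ∧ κ < 2 / n :=
    exists_between (by rwa [lt_div_iff₀ hn0])
  have hκ0 : 0 ≤ κ := (sq_nonneg q).trans hκ1.le
  obtain ⟨C, hC0, hC⟩ := exists_kato_constant n κ hκ0 (by rwa [← lt_div_iff₀ hn0])
  obtain ⟨C₀, hC₀, habs⟩ := exists_absorption_constant (m := (q + 1) ^ 2) (s := 1 + κ + 2 * q)
    (a := (2 * q + 4) ^ 2 / 4) (by positivity) (by nlinarith) (by positivity)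
  -- This `η` satisfies `C₀ η ≤ 1/2`, so at most half of the top-order integral appears on the right
  -- and can be absorbed.
  obtain ⟨C₁, hC₁, hpt⟩ := exists_pointwise_constant (η := (2 * (C₀ + 1))⁻¹) hq hC0 (by positivity)
  refine ⟨2 * C₀ * C₁ + 1, by positivity, ?_⟩
  intro V _ _ _ π f U hf hflat φ hφ hφc hφU hφ0
  set p := 2 * q + 4 with hp
  have hp4 : 2 < p := by linarith
  have hp0 : 0 < p := by linarith
  set b := stdOrthonormalBasis ℝ V
  set F : Eu n → ℝ := fun y => normSecondFund f y ^ 2 with hF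
  have hF0 : ∀ y, 0 ≤ F y := fun y => sq_nonneg _
  have hFd : ∀ y ∈ U, ContDiffAt ℝ ∞ F y := fun y hy => hf.contDiffAt_sq_normSecondFund hy hflat
  have hφ' : ∀ y ∉ tsupport φ, φ y = 0 := fun y hy => image_eq_zero_of_notMem_tsupport hy
  have hJ0 := volDensity_nonneg f
  have hint : ∀ {g : Eu n → ℝ}, (∀ y ∈ U, ContinuousAt g y) → (∀ y ∉ tsupport φ, g y = 0) →
      Integrable fun y => volDensity f y * g y := fun h h0 =>
    hf.integrable_volDensity_mul hφc hφU (fun y hy => (h y hy).continuousWithinAt) h0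
  have cφ : ∀ r : ℝ, 0 ≤ r → ∀ y, ContinuousAt (fun y => φ y ^ r) y := fun r hr y =>
    hφ.continuous.continuousAt.rpow_const (Or.inr hr)
  have cA : ∀ y ∈ U, ContinuousAt (normSecondFund f) y := fun y hy =>
    hf.continuousAt_normSecondFund hy hflat
  set N₀ := ∫ y, volDensity f y * curvEnergy π f φ p y with hN₀
  have hN₀0 : 0 ≤ N₀ := integral_nonneg fun y => mul_nonneg (hJ0 y) (curvEnergy_nonneg hφ0 p y)
  have iR := hf.integrable_curvEnergy hflat hφ hφc hφU hφ0 hp0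
  -- This value at `δ = 1` bounds the error integrals uniformly for `δ ≤ 1`.
  set M := ∫ y, volDensity f y * ((F y + 1) ^ (q + 1) * φ y ^ p) with hM
  have iM : Integrable fun y => volDensity f y * ((F y + 1) ^ (q + 1) * φ y ^ p) :=
    hint (fun y hy => (((hFd y hy).continuousAt.add continuousAt_const).rpow_const
      (Or.inr (by positivity))).mul (cφ p hp0.le y)) fun y hy => by simp [hφ' y hy, hp0.ne']
  have hM0 : 0 ≤ M := integral_nonneg fun y => by
    have := hJ0 y
    have := hF0 y
    have := hφ0 y
    positivity
  set E₀ := ∫ y, volDensity f y * (normSecondFund f y ^ p * φ y ^ p) with hE₀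
  have key : ∀ δ : ℝ, 0 < δ → δ ≤ 1 → E₀ ≤ 2 * C₀ * C₁ * N₀ + 2 * δ * M := by
    intro δ hδ hδ1
    have hv0 : ∀ y, 0 < F y + δ := fun y => by have := hF0 y; positivity
    have cv : ∀ r : ℝ, ∀ y ∈ U, ContinuousAt (fun y => (F y + δ) ^ r) y := fun r y hy =>
      ((hFd y hy).continuousAt.add continuousAt_const).rpow_const (Or.inl (hv0 y).ne')
    have cg : ∀ y ∈ U, ContinuousAt (normGrad f φ) y := fun y hy =>
      hf.continuousAt_normGrad hy (hφ.contDiffAt.of_le (by simp)) hflat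
    have iX : Integrable fun y => volDensity f y * (F y * (F y + δ) ^ (q + 1) * φ y ^ p) :=
      hint (fun y hy => ((hFd y hy).continuousAt.mul (cv _ y hy)).mul (cφ p hp0.le y))
        fun y hy => by simp [hφ' y hy, hp0.ne']
    have iT : Integrable fun y => volDensity f y *
        (max (traceGradMeanCurv π f y) 0 * (F y + δ) ^ (q + 1) * φ y ^ p) :=
      hint (fun y hy => (((hf.continuousAt_traceGradMeanCurv hy hflat).max
        continuousAt_const).mul (cv _ y hy)).mul (cφ p hp0.le y))
        fun y hy => by simp [hφ' y hy, hp0.ne']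
    have iY : Integrable fun y => volDensity f y * ((F y + δ) ^ q *
        ((∑ d, tD π f F y (b d) ^ 2) / (4 * (F y + δ))) * φ y ^ p) := by
      refine hint (fun y hy => ((cv _ y hy).mul ?_).mul (cφ p hp0.le y))
        fun y hy => by simp [hφ' y hy, hp0.ne']
      refine ContinuousAt.div (tendsto_finsetSum _ fun d _ => ((hf.continuousAt_tD hy
        ((hFd y hy).of_le (by simp))).clm_apply continuousAt_const).pow 2)
        (continuousAt_const.mul ((hFd y hy).continuousAt.add continuousAt_const))
        (by have := hv0 y; positivity)
    have iZ : Integrable fun y => volDensity f y *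
        ((F y + δ) ^ (q + 1) * φ y ^ (p - 2) * normGrad f φ y ^ 2) :=
      hint (fun y hy => ((cv _ y hy).mul (cφ _ (by linarith) y)).mul ((cg y hy).pow 2))
        fun y hy => by simp [normGrad_eq_zero hy]
    have iW : Integrable fun y => volDensity f y *
        ((normSecondFund f y * K₂ f y + ‖meanCurv f y‖ * normSecondFund f y ^ 3 +
          C * normCovMeanCurv f y ^ 2) * (F y + δ) ^ q * φ y ^ p) := by
      refine hint (fun y hy => ((((?_ : ContinuousAt _ _).add
        ((hf.contDiffAt_meanCurv hy hflat).continuousAt.norm.mul ((cA y hy).pow 3))).add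
        (continuousAt_const.mul ((hf.continuousAt_normCovMeanCurv hy hflat).pow 2))).mul
        (cv _ y hy)).mul (cφ p hp0.le y)) fun y hy => by simp [hφ' y hy, hp0.ne']
      simp only [normSecondFund_mul_K₂]
      exact (hf.continuousAt_hessPairing hy hflat).neg.max continuousAt_const
    have iS : Integrable fun y => volDensity f y * ((F y + δ) ^ (q + 2) * φ y ^ p) :=
      hint (fun y hy => (cv _ y hy).mul (cφ p hp0.le y)) fun y hy => by simp [hφ' y hy, hp0.ne']
    have iS' : Integrable fun y => volDensity f y * ((F y + δ) ^ (q + 1) * φ y ^ p) :=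
      hint (fun y hy => (cv _ y hy).mul (cφ p hp0.le y)) fun y hy => by simp [hφ' y hy, hp0.ne']
    have hT : 0 ≤ ∫ y, volDensity f y *
        (max (traceGradMeanCurv π f y) 0 * (F y + δ) ^ (q + 1) * φ y ^ p) :=
      integral_nonneg fun y => by
        have := hJ0 y
        have := hv0 y
        have := hφ0 y
        positivity
    have hW : 0 ≤ ∫ y, volDensity f y *
        ((normSecondFund f y * K₂ f y + ‖meanCurv f y‖ * normSecondFund f y ^ 3 +
          C * normCovMeanCurv f y ^ 2) * (F y + δ) ^ q * φ y ^ p) :=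
      integral_nonneg fun y => by
        have := hJ0 y
        have := hv0 y
        have := hφ0 y
        have := normSecondFund_nonneg f y
        have := K₂_nonneg f y
        positivity
    have hZ : 0 ≤ ∫ y, volDensity f y *
        ((F y + δ) ^ (q + 1) * φ y ^ (p - 2) * normGrad f φ y ^ 2) :=
      integral_nonneg fun y => by
        have := hJ0 y
        have := hv0 y
        have := hφ0 y
        positivity
    have hX := habs (∫ y, volDensity f y * (F y * (F y + δ) ^ (q + 1) * φ y ^ p))
      (∫ y, volDensity f y * ((F y + δ) ^ q *
        ((∑ d, tD π f F y (b d) ^ 2) / (4 * (F y + δ))) * φ y ^ p)) _ _ _ hT hW hZ ?_ ?_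
    · have hQ : (∫ y, volDensity f y *
          (max (traceGradMeanCurv π f y) 0 * (F y + δ) ^ (q + 1) * φ y ^ p)) +
          (∫ y, volDensity f y *
          ((normSecondFund f y * K₂ f y + ‖meanCurv f y‖ * normSecondFund f y ^ 3 +
          C * normCovMeanCurv f y ^ 2) * (F y + δ) ^ q * φ y ^ p)) +
          (∫ y, volDensity f y * ((F y + δ) ^ (q + 1) * φ y ^ (p - 2) * normGrad f φ y ^ 2)) ≤
          (2 * (C₀ + 1))⁻¹ * (∫ y, volDensity f y * ((F y + δ) ^ (q + 2) * φ y ^ p)) +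
          C₁ * N₀ := by
        rw [← integral_add iT iW, ← integral_add (iT.fun_add iW) iZ, ← integral_const_mul, hN₀,
          ← integral_const_mul, ← integral_add (iS.const_mul _) (iR.const_mul _)]
        refine integral_mono ((iT.fun_add iW).fun_add iZ) ((iS.const_mul _).fun_add (iR.const_mul _))
          fun y => ?_
        have := hpt (F y + δ) (normSecondFund f y) (max (traceGradMeanCurv π f y) 0) (K₂ f y)
          ‖meanCurv f y‖ (normCovMeanCurv f y) (normGrad f φ y) (φ y) (hv0 y)
          (normSecondFund_nonneg f y) (by simp [hF, hδ.le]) (le_max_right _ _) (K₂_nonneg f y)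
          (norm_nonneg _) (normCovMeanCurv_nonneg f y) (normGrad_nonneg f φ y) (hφ0 y)
        have := mul_le_mul_of_nonneg_left this (hJ0 y)
        simp only [curvEnergy]
        linarith
      -- Writing `v = |A|² + δ` in one factor, the top-order integral is `X` plus an error of order
      -- `δ`.
      have hS : (∫ y, volDensity f y * ((F y + δ) ^ (q + 2) * φ y ^ p)) =
          (∫ y, volDensity f y * (F y * (F y + δ) ^ (q + 1) * φ y ^ p)) +
          δ * ∫ y, volDensity f y * ((F y + δ) ^ (q + 1) * φ y ^ p) := by
        rw [← integral_const_mul, ← integral_add iX (iS'.const_mul _)]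
        refine integral_congr_ae (ae_of_all _ fun y => ?_)
        have : (F y + δ) ^ (q + 2) = (F y + δ) ^ (q + 1) * (F y + δ) := by
          rw [← Real.rpow_add_one (hv0 y).ne']
          ring_nf
        simp only [this]
        ring
      have hS' : (∫ y, volDensity f y * ((F y + δ) ^ (q + 1) * φ y ^ p)) ≤ M := by
        refine integral_mono iS' iM fun y => ?_
        have h1 := hφ0 y
        have h2 := hF0 y
        exact mul_le_mul_of_nonneg_left (by gcongr) (hJ0 y)
      have iE : Integrable fun y => volDensity f y * (normSecondFund f y ^ p * φ y ^ p) :=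
        hint (fun y hy => ((cA y hy).rpow_const (Or.inr hp0.le)).mul (cφ p hp0.le y))
          fun y hy => by simp [hφ' y hy, hp0.ne']
      have hE : E₀ ≤ ∫ y, volDensity f y * ((F y + δ) ^ (q + 2) * φ y ^ p) := by
        refine integral_mono iE iS fun y => mul_le_mul_of_nonneg_left ?_ (hJ0 y)
        have h1 := hφ0 y
        have h2 := hF0 y
        have h3 : normSecondFund f y ^ p = F y ^ (q + 2) := by
          simp only [hF]
          rw [← Real.rpow_natCast, ← Real.rpow_mul (normSecondFund_nonneg f y)]
          congr 1
          push_cast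
          ring
        rw [h3]
        gcongr
        linarith
      set S := ∫ y, volDensity f y * ((F y + δ) ^ (q + 2) * φ y ^ p)
      have hS0 : 0 ≤ S := integral_nonneg fun y => by
        have := hJ0 y
        have := hv0 y
        have := hφ0 y
        positivity
      have h1 : C₀ * ((2 * (C₀ + 1))⁻¹ * S) ≤ 2⁻¹ * S := by
        rw [← mul_assoc]
        refine mul_le_mul_of_nonneg_right ?_ hS0
        rw [← div_eq_mul_inv, div_le_iff₀ (by positivity)]
        linarith
      have h2 := mul_le_mul_of_nonneg_left hQ hC₀
      have h3 := mul_le_mul_of_nonneg_left hS' hδ.le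
      rw [mul_add] at h2
      linarith
    · intro τ hτ
      have := hf.integral_stability hflat hφ hφc hφU hφ0 b (q := q) hδ hp4 hτ
      refine this.trans_eq ?_
      rw [← integral_const_mul, ← integral_const_mul, ← integral_add iT (iY.const_mul _),
        ← integral_add (iT.fun_add (iY.const_mul _)) (iZ.const_mul _)]
      refine integral_congr_ae (ae_of_all _ fun y => ?_)
      simp only [hF]
      ring
    · intro ε hε
      have h1 := hf.integral_simons hflat hφ hφc hφU hφ0 b (q := q) hδ hp4 hκ0 (hC V) hε
      rw [← integral_const_mul, ← integral_const_mul, ← integral_add iX iW,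
        ← integral_add (iX.fun_add iW) (iZ.const_mul _)]
      have h2 : (∫ y, (1 + κ + 2 * q - ε) * (volDensity f y * ((F y + δ) ^ q *
          ((∑ d, tD π f F y (b d) ^ 2) / (4 * (F y + δ))) * φ y ^ p))) =
          ∫ y, volDensity f y * ((1 + κ + 2 * q - ε) * ((F y + δ) ^ q *
          ((∑ d, tD π f F y (b d) ^ 2) / (4 * (F y + δ))) * φ y ^ p)) :=
        integral_congr_ae (ae_of_all _ fun y => mul_left_comm _ _ _)
      rw [h2]
      refine h1.trans (integral_mono_of_nonneg (ae_of_all _ fun y => ?_)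
        ((iX.fun_add iW).fun_add (iZ.const_mul _)) (ae_of_all _ fun y => ?_))
      · have := hJ0 y
        have := hv0 y
        have := hφ0 y
        have := normSecondFund_nonneg f y
        have := K₂_nonneg f y
        positivity
      · have e1 : (F y + δ) ^ (q + 1) = (F y + δ) ^ q * (F y + δ) :=
          Real.rpow_add_one (hv0 y).ne' q
        -- The quartic term of Simons' inequality is compared with the integrand of `X` through
        -- `|A|⁴ ≤ |A|² v`.
        have e2 : 0 ≤ volDensity f y * (F y * δ * (F y + δ) ^ q * φ y ^ p) := by
          have := hJ0 y
          have := hv0 y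
          have := hφ0 y
          have := hF0 y
          positivity
        have e3 : normSecondFund f y ^ 2 = F y := rfl
        have e4 : p ^ 2 / (4 * ε) = p ^ 2 / 4 / ε := by rw [div_div]
        simp only [e1, e3, e4]
        linarith
  -- Neither side of the limiting inequality involves `δ`, so it suffices that `2 δ M` can be made
  -- arbitrarily small.
  have hlim : E₀ ≤ 2 * C₀ * C₁ * N₀ := by
    refine le_of_forall_pos_le_add fun ε hε => ?_
    have h1 : 0 < ε / (2 * M + 1) := by positivity
    refine (key (min 1 (ε / (2 * M + 1))) (lt_min one_pos h1) (min_le_left _ _)).trans ?_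
    have h2 : min 1 (ε / (2 * M + 1)) * (2 * M) ≤ ε / (2 * M + 1) * (2 * M) := by
      gcongr
      exact min_le_right _ _
    have h3 : ε / (2 * M + 1) * (2 * M) ≤ ε := by
      rw [div_mul_eq_mul_div, div_le_iff₀ (by positivity)]
      nlinarith
    linarith
  linarith

end Energy

end FlatNormalGraph



/-! ### Graphs and the quantity `K₁` -/

namespace FlatNormalGraph

noncomputable section Graph

variable {n k : ℕ}

/-- The projection of `ℝⁿ × ℝᵏ` onto the parameter space. -/
def paramProj (n k : ℕ) : WithLp 2 (Eu n × Eu k) →L[ℝ] Eu n :=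
  (ContinuousLinearMap.fst ℝ (Eu n) (Eu k)).comp
    (WithLp.prodContinuousLinearEquiv 2 ℝ (Eu n) (Eu k)).toContinuousLinearMap

theorem paramProj_apply (v : WithLp 2 (Eu n × Eu k)) : paramProj n k v = v.fst := rfl

theorem isGraphOver_graphMap {ψ : Eu n → Eu k} {U : Set (Eu n)} (hU : IsOpen U)
    (hψ : ContDiffOn ℝ ∞ ψ U) : IsGraphOver (paramProj n k) (graphMap ψ) U where
  isOpen := hU
  contDiffOn := (WithLp.prodContinuousLinearEquiv 2 ℝ (Eu n) (Eu k)).symm.contDiff.comp_contDiffOn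
    (contDiffOn_id.prodMk hψ)
  proj _ _ := rfl

variable {f : Eu n → WithLp 2 (Eu n × Eu k)} {U : Set (Eu n)} {x : Eu n}

/-- The projection to `ℝⁿ` is injective on tangent spaces, so it maps the frame to independent
vectors. -/
theorem starΩ_ne_zero (hf : IsGraphOver (paramProj n k) f U) (hx : x ∈ U) : starΩ f x ≠ 0 := by
  rw [starΩ, Ω]
  have h1 : LinearIndependent ℝ (Matrix.of fun i j => (frame f x j).fst i).col := by
    rw [Fintype.linearIndependent_iff]
    intro g hg
    have h2 : paramProj n k (∑ j, g j • frame f x j) = 0 := by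
      rw [map_sum]
      ext i
      have := congrFun hg i
      simpa [paramProj_apply] using this
    have h3 : ∑ j, g j • frame f x j = 0 := by
      have h4 := hf.fderiv_proj hx (∑ j, g j • frame f x j)
      have h5 : tangentProj f x (∑ j, g j • frame f x j) = ∑ j, g j • frame f x j := by
        simp [map_sum, hf.tangentProj_frame hx]
      rw [h5, h2, map_zero] at h4
      exact h4.symm
    exact Fintype.linearIndependent_iff.1 (hf.orthonormal_frame hx).linearIndependent g h3
  rw [Matrix.linearIndependent_cols_iff_isUnit, Matrix.isUnit_iff_isUnit_det] at h1
  exact h1.ne_zero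

/-- This is Cramer's rule. The projections of `u` and of the tangent vector `L u` to `ℝⁿ` agree, so
replacing column `i` by that of `u` multiplies the determinant by the coefficient of `L u` along the
`i`-th frame vector. -/
theorem K₁_eq (hf : IsGraphOver (paramProj n k) f U) (hx : x ∈ U) :
    K₁ f x = max (traceGradMeanCurv (paramProj n k) f x) 0 := by
  rw [K₁, traceGradMeanCurv, inv_mul_eq_div]
  congr 1
  rw [div_eq_iff (starΩ_ne_zero hf hx), Finset.sum_mul]
  refine Finset.sum_congr rfl fun i _ => ?_
  set u := covMeanCurv f x (frameCoord f x i)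
  set A : Matrix (Fin n) (Fin n) ℝ := Matrix.of fun i j => (frame f x j).fst i with hA
  have h1 : u.fst = ∑ j, inner ℝ (frame f x j) (obliqueProj (paramProj n k) f x u) •
      (frame f x j).fst := by
    have e1 := hf.tangentProj_eq_sum_frame hx (obliqueProj (paramProj n k) f x u)
    rw [hf.tangentProj_obliqueProj hx] at e1
    have e2 := congrArg (paramProj n k) e1
    rw [map_sum] at e2
    have e3 : paramProj n k (obliqueProj (paramProj n k) f x u) = u.fst := hf.proj_fderiv hx _
    rw [e3] at e2
    simpa only [map_smul, paramProj_apply] using e2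
  have h2 : Ω (Function.update (frame f x) i u) = (A.updateCol i fun l => ∑ j,
      inner ℝ (frame f x j) (obliqueProj (paramProj n k) f x u) • A l j).det := by
    rw [Ω]
    congr 1
    ext l j
    rcases eq_or_ne j i with rfl | hj
    · simp [h1, hA]
    · simp [hj, hA]
  rw [h2, Matrix.det_updateCol_sum]
  rfl

end Graph

end FlatNormalGraph

/-! ### The estimate on the graph -/

theorem mainTheorem2 (n : ℕ) (hn : 1 ≤ n) (p : ℝ) (hp4 : 4 ≤ p) (hp : p < 4 + √(8 / (n : ℝ))) :
    ∃ C : ℝ, 0 < C ∧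
      ∀ (k : ℕ), 1 ≤ k →
      ∀ (U : Set (EuclideanSpace ℝ (Fin n)))
        (ψ : EuclideanSpace ℝ (Fin n) → EuclideanSpace ℝ (Fin k)),
      IsOpen U → ContDiffOn ℝ ∞ ψ U →
      FlatNormalGraph.HasFlatNormalBundle (FlatNormalGraph.graphMap ψ) U →
      -- a test function on the graph, written in the global chart `(x, ψ(x)) ↦ x`
      ∀ φ : EuclideanSpace ℝ (Fin n) → ℝ,
      ContDiff ℝ ∞ φ → HasCompactSupport φ → tsupport φ ⊆ U → (∀ x, 0 ≤ φ x) →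
      let f := FlatNormalGraph.graphMap ψ
      let S : Set (WithLp 2 (EuclideanSpace ℝ (Fin n) × EuclideanSpace ℝ (Fin k))) := f '' U
      let lhs : EuclideanSpace ℝ (Fin n) → ℝ := fun x =>
        FlatNormalGraph.normSecondFund f x ^ p * φ x ^ p
      let rhs : EuclideanSpace ℝ (Fin n) → ℝ := fun x =>
        FlatNormalGraph.normGrad f φ x ^ p +
          (‖FlatNormalGraph.meanCurv f x‖ ^ p
            + FlatNormalGraph.normCovMeanCurv f x ^ (p / 2)
            + FlatNormalGraph.K₁ f x ^ (p / 2)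
            + FlatNormalGraph.K₂ f x ^ (p / 3)) * φ x ^ p
      IntegrableOn (fun y => lhs y.fst) S (μHE[n]) ∧
      IntegrableOn (fun y => rhs y.fst) S (μHE[n]) ∧
      ∫ y in S, lhs y.fst ∂(μHE[n]) ≤ C * ∫ y in S, rhs y.fst ∂(μHE[n]) := by
  have hn0 : (0 : ℝ) < n := by exact_mod_cast hn
  -- In terms of `q` the upper bound on `p` reads `2q < √(8/n)`, that is `q² n < 2`.
  obtain ⟨q, rfl⟩ : ∃ q, p = 2 * q + 4 := ⟨(p - 4) / 2, by ring⟩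
  have hq : 0 ≤ q := by linarith
  have hqn : q ^ 2 * n < 2 := by
    have h1 : 2 * q < √(8 / (n : ℝ)) := by linarith
    rw [Real.lt_sqrt (by linarith), lt_div_iff₀ hn0] at h1
    linarith
  obtain ⟨C, hC0, hC⟩ := FlatNormalGraph.exists_energy_constant n hn hq hqn
  refine ⟨C, hC0, ?_⟩
  intro k _ U ψ hU hψ hflat φ hφ hφc hφU hφ0 f S lhs rhs
  have hf : FlatNormalGraph.IsGraphOver (FlatNormalGraph.paramProj n k) f U :=
    FlatNormalGraph.isGraphOver_graphMap hU hψ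
  have hUm := hU.measurableSet
  have hp0 : 0 < 2 * q + 4 := by linarith
  have hlc : ContinuousOn lhs U := fun y hy => ContinuousAt.continuousWithinAt
    (((hf.continuousAt_normSecondFund hy hflat).rpow_const (Or.inr hp0.le)).mul
      (hφ.continuous.continuousAt.rpow_const (Or.inr hp0.le)))
  have hl0 : ∀ y ∉ tsupport φ, lhs y = 0 := fun y hy => by
    simp [lhs, image_eq_zero_of_notMem_tsupport hy, hp0.ne']
  -- The identification of `K₁` with the trace is available only over `U`, which carries the graph
  -- measure.
  have hrhs : ∀ y ∈ U, FlatNormalGraph.curvEnergy (FlatNormalGraph.paramProj n k) f φ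
      (2 * q + 4) y = rhs y := fun y hy => by
    simp only [rhs, FlatNormalGraph.curvEnergy, FlatNormalGraph.K₁_eq hf hy]
  have hlm : AEStronglyMeasurable lhs (volume.restrict U) := hlc.aestronglyMeasurable hUm
  have hrm : AEStronglyMeasurable rhs (volume.restrict U) :=
    (hf.aemeasurable_curvEnergy hflat hφ _).aestronglyMeasurable.congr
      ((ae_restrict_iff' hUm).2 (ae_of_all _ hrhs))
  have hli := hf.integrable_volDensity_mul hφc hφU hlc hl0
  have hri := hf.integrable_curvEnergy hflat hφ hφc hφU hφ0 hp0
  refine ⟨(hf.integrableOn_image_iff hlm).2 hli.integrableOn,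
    (hf.integrableOn_image_iff hrm).2 (hri.integrableOn.congr_fun
      (fun y hy => by simp only [hrhs y hy]) hUm), ?_⟩
  -- The area formula produces an integral over `U`; it extends to `ℝⁿ` because the integrand
  -- vanishes off the support of `φ`.
  have e1 : ∫ y in S, lhs y.fst ∂(μHE[n]) = ∫ y, FlatNormalGraph.volDensity f y * lhs y :=
    (hf.integral_image_eq hlm).trans (setIntegral_eq_integral_of_forall_compl_eq_zero
      fun y hy => by rw [hl0 y fun h => hy (hφU h), mul_zero])
  have e2 : ∫ y in S, rhs y.fst ∂(μHE[n]) = ∫ y, FlatNormalGraph.volDensity f y *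
      FlatNormalGraph.curvEnergy (FlatNormalGraph.paramProj n k) f φ (2 * q + 4) y := by
    refine (hf.integral_image_eq hrm).trans ((setIntegral_congr_fun hUm fun y hy => ?_).trans
      (setIntegral_eq_integral_of_forall_compl_eq_zero (s := U) fun y hy => ?_))
    · simp only [hrhs y hy]
    · rw [FlatNormalGraph.curvEnergy_eq_zero hp0.ne' fun h => hy (hφU h), mul_zero]
  rw [e1, e2]
  exact hC _ _ f U hf hflat φ hφ hφc hφU hφ0
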